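/- Let $\mathfrak g$ be the Lie algebra of a compact Lie group, i.e. a finite-dimensional real Lie algebra with an invariant inner product, and let $\mathbf T^3=\mathbf R^3/\mathbf Z^3$. Smooth $1$-forms are smooth maps $A=(A_1,A_2,A_3)\colon\mathbf T^3\to\mathfrak g^3$. The Yang--Mills (YM) flow with DeTurck term started from a smooth $1$-form $a$ is the equation $\partial_tA=-\mathrm d_A^*F(A)-\mathrm d_A\mathrm d^*A$, $A(0)=a$; in coordinates $$\partial_tA_i=\Delta A_i+(A\,\partial A)_i+\sum_j[A_j,[A_j,A_i]],\qquad (A\,\partial A)_i=\sum_j[A_j,2\partial_jA_i-\partial_iA_j].$$ Let $P_t=e^{t\Delta}$, and for $\alpha<0$ let $|f|_{C^\alpha}=\sup_{t\in(0,1)}t^{-\alpha/2}|P_tf|_{L^\infty}$ be the norm of the Hölder--Besov space $C^\alpha=B^\alpha_{\infty,\infty}$. Let $\eta<-\frac12$, $\beta<0$, and $\delta\in(1+\frac\beta2,1)$ with $\delta\ge 0$, and suppose that $$\eta>-\tfrac23,\qquad \beta(2\eta+1)<(1+\eta)(1-2\eta-2\delta).$$ (For given $\beta,\delta$ both inequalities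 hold as soon as $\eta<-\frac12$ is close enough to $-\frac12$; and, if $\eta>-\frac23$, the second follows from $\eta+\beta+2(1-\delta)>-1$.) Let $(\mathcal I,\Theta)$ be the completion of the smooth $1$-forms under $$\Theta(A,B)=|A-B|_{C^\eta}+\sup_{t\in(0,1)}t^\delta\,\big|P_tA\,\partial P_tA-P_tB\,\partial P_tB\big|_{C^\beta}.$$ Then for every ball $\mathcal B$ in $(\mathcal I,\Theta)$ centred at $0$ there exists $T>0$ such that for every $t\in(0,T)$ the following holds. For every smooth $a\in\mathcal B$ the YM flow started from $a$ has a smooth solution on $[0,t]$, and the map $a\mapsto A(t)$, where $A$ is any such solution, is well defined and extends to a continuous map $\mathcal F_t\colon\mathcal B\to C^\infty$. Moreover, for every $k\in\mathbf N$ there is a constant $L$ with $|\mathcal F_t(X)-\mathcal F_t(Y)|_{C^k}\le L\,\Theta(X,Y)$ for all $X,Y\in\mathcal B$. -/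

import Mathlib

open Set Filter Topology MeasureTheory
open scoped ENNReal NNReal ContDiff

noncomputable section

namespace YMFlow

/-- A Lie ring and a normed group on the same additive group. -/
class NormedLieRing (𝔤 : Type*) extends NormedAddCommGroup 𝔤, LieRing 𝔤

/-- A real Lie algebra with an inner product invariant under the adjoint action.  In finite
dimension these are the Lie algebras of compact Lie groups with an `Ad`-invariant inner product. -/
class CompactLieAlgebra (𝔤 : Type*) [NormedLieRing 𝔤] extends
    InnerProductSpace ℝ 𝔤, LieAlgebra ℝ 𝔤 where
  inner_lie : ∀ x y z : 𝔤, Inner.inner ℝ ⁅x, y⁆ z = Inner.inner ℝ x ⁅y, z⁆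

/-- The universal cover `ℝ^d` of the torus `ℝ^d / ℤ^d`. -/
abbrev E (d : ℕ) := EuclideanSpace ℝ (Fin d)

/-- `ℤ^d`-periodic functions, that is, functions on the torus. -/
def IsPeriodic {d : ℕ} {F : Type*} (f : E d → F) : Prop :=
  ∀ (x : E d) (n : Fin d → ℤ), f (x + WithLp.toLp 2 (fun i => (n i : ℝ))) = f x

/-- Smooth `𝔤`-valued `1`-forms `A = (A_1, …, A_d)` on the torus `ℝ^d / ℤ^d`. -/
@[ext]
structure SmoothOneForm (d : ℕ) (𝔤 : Type*) [NormedAddCommGroup 𝔤] [NormedSpace ℝ 𝔤] where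
  toFun : E d → Fin d → 𝔤
  contDiff' : ContDiff ℝ ∞ toFun
  periodic' : IsPeriodic toFun

/-- The partial derivative `∂_j f`. -/
def partialDeriv {d : ℕ} {F : Type*} [NormedAddCommGroup F] [NormedSpace ℝ F]
    (j : Fin d) (f : E d → F) (x : E d) : F :=
  fderiv ℝ f x (EuclideanSpace.single j 1)

/-- The Gauss–Weierstrass kernel `(4πt)^{-d/2} exp(-|y|²/4t)`. -/
def heatKernel (d : ℕ) (t : ℝ) (y : E d) : ℝ :=
  (4 * Real.pi * t) ^ (-(d : ℝ) / 2) * Real.exp (-(‖y‖ ^ 2 / (4 * t)))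

/-- The heat semigroup `P_t = e^{tΔ}` (used for `t > 0` only). -/
def heat {d : ℕ} {F : Type*} [NormedAddCommGroup F] [NormedSpace ℝ F]
    (t : ℝ) (f : E d → F) (x : E d) : F :=
  ∫ y, heatKernel d t y • f (x - y)

/-- The norm of the Hölder–Besov space `C^α = B^α_{∞,∞}` of negative order `α < 0`, in its heat
semigroup form `sup_{0 < t < 1} t^{-α/2} ‖P_t f‖_∞`. -/
def negHolderNorm {d : ℕ} {F : Type*} [NormedAddCommGroup F] [NormedSpace ℝ F]
    (α : ℝ) (f : E d → F) : ℝ≥0∞ :=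
  ⨆ t ∈ Ioo (0 : ℝ) 1, ⨆ x, ENNReal.ofReal (t ^ (-α / 2)) * ‖heat t f x‖ₑ

section YM

variable {d : ℕ} {𝔤 : Type*} [NormedLieRing 𝔤] [CompactLieAlgebra 𝔤]

/-- The term `A ∂A` of the flow: `(A ∂A)_i = ∑_j [A_j, 2 ∂_j A_i - ∂_i A_j]`. -/
def quadTerm (A : E d → Fin d → 𝔤) (x : E d) : Fin d → 𝔤 := fun i =>
  ∑ j, ⁅A x j, (2 : ℝ) • partialDeriv j A x i - partialDeriv i A x j⁆

/-- The term `A³` of the flow: `(A³)_i = ∑_j [A_j, [A_j, A_i]]`. -/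
def cubicTerm (A : E d → Fin d → 𝔤) (x : E d) : Fin d → 𝔤 := fun i =>
  ∑ j, ⁅A x j, ⁅A x j, A x i⁆⁆

/-- `-d_A^* F(A) - d_A d^* A = ΔA + A ∂A + A³` in coordinates. -/
def ymRHS (A : E d → Fin d → 𝔤) (x : E d) : Fin d → 𝔤 :=
  Laplacian.laplacian A x + quadTerm A x + cubicTerm A x

end YM

/-! ### Elementary facts on the heat semigroup, used to see that `Θ` is finite -/

theorem IsPeriodic.bounded {d : ℕ} {F : Type*} [NormedAddCommGroup F]
    {f : E d → F} (hp : IsPeriodic f) (hf : Continuous f) :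
    ∃ C, ∀ x, ‖f x‖ ≤ C := by
  have hK : IsCompact ((WithLp.toLp 2) '' (Set.pi univ fun _ : Fin d => Icc (0 : ℝ) 1) :
      Set (E d)) :=
    (isCompact_univ_pi fun _ => isCompact_Icc).image (PiLp.continuous_toLp 2 _)
  obtain ⟨C, hC⟩ := hK.exists_bound_of_continuousOn hf.continuousOn
  refine ⟨C, fun x => ?_⟩
  rw [← hp x (fun i => -⌊x i⌋)]
  refine hC _ ⟨fun i => Int.fract (x i), fun i _ => ⟨Int.fract_nonneg _, (Int.fract_lt_one _).le⟩, ?_⟩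
  ext i
  simp [Int.fract, sub_eq_add_neg]

section Heat

variable {d : ℕ} {F : Type*} [NormedAddCommGroup F] [NormedSpace ℝ F]

theorem heatKernel_nonneg {t : ℝ} (ht : 0 < t) (y : E d) : 0 ≤ heatKernel d t y := by
  unfold heatKernel; positivity

theorem heatKernel_continuous (t : ℝ) : Continuous (heatKernel d t) := by
  unfold heatKernel; fun_prop

theorem integral_heatKernel {t : ℝ} (ht : 0 < t) : ∫ y, heatKernel d t y = 1 := by
  have h := GaussianFourier.integral_rexp_neg_mul_sq_norm (V := E d)
    (b := 1 / (4 * t)) (by positivity)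
  have e : ∀ y : E d, heatKernel d t y
      = (4 * Real.pi * t) ^ (-(d : ℝ) / 2) * Real.exp (-(1 / (4 * t)) * ‖y‖ ^ 2) := by
    intro y; unfold heatKernel; congr 2; ring
  simp_rw [e]
  rw [integral_const_mul, h]
  have hp : 0 < 4 * Real.pi * t := by positivity
  have : Real.pi / (1 / (4 * t)) = 4 * Real.pi * t := by field_simp
  rw [this, finrank_euclideanSpace_fin, ← Real.rpow_add hp]
  have : -(d : ℝ) / 2 + (d : ℝ) / 2 = 0 := by ring
  rw [this, Real.rpow_zero]

theorem heatKernel_integrable {t : ℝ} (ht : 0 < t) : Integrable (heatKernel d t) := by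
  by_contra h
  have := integral_heatKernel (d := d) ht
  rw [integral_undef h] at this
  exact zero_ne_one this

theorem heat_integrable {t : ℝ} (ht : 0 < t) {f : E d → F} (hf : Continuous f) {C : ℝ}
    (hC : ∀ x, ‖f x‖ ≤ C) (x : E d) : Integrable (fun y => heatKernel d t y • f (x - y)) := by
  refine ((heatKernel_integrable (d := d) ht).mul_const C).mono'
    ((heatKernel_continuous t).smul (by fun_prop)).aestronglyMeasurable (ae_of_all _ fun y => ?_)
  rw [norm_smul, Real.norm_of_nonneg (heatKernel_nonneg ht y)]
  exact mul_le_mul_of_nonneg_left (hC _) (heatKernel_nonneg ht y)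

theorem heat_sub {t : ℝ} (ht : 0 < t) {f g : E d → F} (hf : Continuous f) (hg : Continuous g)
    {C D : ℝ} (hC : ∀ x, ‖f x‖ ≤ C) (hD : ∀ x, ‖g x‖ ≤ D) (x : E d) :
    heat t (f - g) x = heat t f x - heat t g x := by
  unfold heat
  rw [← integral_sub (heat_integrable ht hf hC x) (heat_integrable ht hg hD x)]
  simp [smul_sub]

theorem norm_heat_le {t : ℝ} (ht : 0 < t) {f : E d → F} {C : ℝ}
    (hC : ∀ x, ‖f x‖ ≤ C) (x : E d) : ‖heat t f x‖ ≤ C := by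
  have h : ‖heat t f x‖ ≤ ∫ y, heatKernel d t y * C := by
    refine norm_integral_le_of_norm_le ((heatKernel_integrable (d := d) ht).mul_const C)
      (ae_of_all _ fun y => ?_)
    rw [norm_smul, Real.norm_of_nonneg (heatKernel_nonneg ht y)]
    exact mul_le_mul_of_nonneg_left (hC _) (heatKernel_nonneg ht y)
  rwa [integral_mul_const, integral_heatKernel ht, one_mul] at h

theorem continuous_heat {t : ℝ} (ht : 0 < t) {f : E d → F} (hf : Continuous f) {C : ℝ}
    (hC : ∀ x, ‖f x‖ ≤ C) : Continuous (heat t f) := by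
  refine continuous_of_dominated (bound := fun y => heatKernel d t y * C)
    (fun x => (heat_integrable ht hf hC x).aestronglyMeasurable)
    (fun x => ae_of_all _ fun y => ?_) ((heatKernel_integrable (d := d) ht).mul_const C)
    (ae_of_all _ fun y => by fun_prop)
  rw [norm_smul, Real.norm_of_nonneg (heatKernel_nonneg ht y)]
  exact mul_le_mul_of_nonneg_left (hC _) (heatKernel_nonneg ht y)

theorem hasFDerivAt_heat {t : ℝ} (ht : 0 < t) {f : E d → F} (hf : ContDiff ℝ 1 f) {C D : ℝ}
    (hC : ∀ x, ‖f x‖ ≤ C) (hD : ∀ x, ‖fderiv ℝ f x‖ ≤ D) (x : E d) :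
    HasFDerivAt (heat t f) (heat t (fderiv ℝ f) x) x := by
  have hf' : Continuous (fderiv ℝ f) := hf.continuous_fderiv one_ne_zero
  refine hasFDerivAt_integral_of_dominated_of_fderiv_le
    (F' := fun x y => heatKernel d t y • fderiv ℝ f (x - y))
    (bound := fun y => heatKernel d t y * D) (s := univ) univ_mem
    (Eventually.of_forall fun x => (heat_integrable ht hf.continuous hC x).aestronglyMeasurable)
    (heat_integrable ht hf.continuous hC x)
    (heat_integrable ht hf' hD x).aestronglyMeasurable
    (ae_of_all _ fun y z _ => ?_) ((heatKernel_integrable (d := d) ht).mul_const D)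
    (ae_of_all _ fun y z _ => ?_)
  · rw [norm_smul, Real.norm_of_nonneg (heatKernel_nonneg ht y)]
    exact mul_le_mul_of_nonneg_left (hD _) (heatKernel_nonneg ht y)
  · have h1 : HasFDerivAt f (fderiv ℝ f (z - y)) (z - y) :=
      (hf.differentiable one_ne_zero _).hasFDerivAt
    have h2 := (h1.comp z ((hasFDerivAt_id z).sub_const y)).const_smul (heatKernel d t y)
    rw [ContinuousLinearMap.comp_id] at h2
    exact h2

theorem negHolderNorm_le {α : ℝ} (hα : α ≤ 0) {f : E d → F} {C : ℝ} (hC : ∀ x, ‖f x‖ ≤ C) :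
    negHolderNorm α f ≤ ENNReal.ofReal C := by
  refine iSup₂_le fun t ht => iSup_le fun x => ?_
  have h1 : ENNReal.ofReal (t ^ (-α / 2)) ≤ 1 := by
    rw [← ENNReal.ofReal_one]
    exact ENNReal.ofReal_le_ofReal (Real.rpow_le_one ht.1.le ht.2.le (by linarith))
  have h2 : ‖heat t f x‖ₑ ≤ ENNReal.ofReal C := by
    rw [← ofReal_norm]
    exact ENNReal.ofReal_le_ofReal (norm_heat_le ht.1 hC x)
  calc _ ≤ 1 * ENNReal.ofReal C := mul_le_mul' h1 h2
    _ = _ := one_mul _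

theorem negHolderNorm_sub_triangle (α : ℝ) {f g h : E d → F} (hf : Continuous f)
    (hg : Continuous g) (hh : Continuous h) (bf : ∃ C, ∀ x, ‖f x‖ ≤ C)
    (bg : ∃ C, ∀ x, ‖g x‖ ≤ C) (bh : ∃ C, ∀ x, ‖h x‖ ≤ C) :
    negHolderNorm α (f - h) ≤ negHolderNorm α (f - g) + negHolderNorm α (g - h) := by
  obtain ⟨Cf, bf⟩ := bf
  obtain ⟨Cg, bg⟩ := bg
  obtain ⟨Ch, bh⟩ := bh
  refine iSup₂_le fun t ht => iSup_le fun x => ?_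
  have e : heat t (f - h) x = heat t (f - g) x + heat t (g - h) x := by
    rw [heat_sub ht.1 hf hh bf bh, heat_sub ht.1 hf hg bf bg, heat_sub ht.1 hg hh bg bh]
    abel
  rw [e]
  calc _ ≤ ENNReal.ofReal (t ^ (-α / 2)) * (‖heat t (f - g) x‖ₑ + ‖heat t (g - h) x‖ₑ) :=
        mul_le_mul_right (enorm_add_le _ _) _
    _ = _ := mul_add _ _ _
    _ ≤ _ := add_le_add
        (le_iSup₂_of_le (f := fun t (_ : t ∈ Ioo (0 : ℝ) 1) => ⨆ x, _) t ht
          (le_iSup (fun x => ENNReal.ofReal (t ^ (-α / 2)) * ‖heat t (f - g) x‖ₑ) x))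
        (le_iSup₂_of_le (f := fun t (_ : t ∈ Ioo (0 : ℝ) 1) => ⨆ x, _) t ht
          (le_iSup (fun x => ENNReal.ofReal (t ^ (-α / 2)) * ‖heat t (g - h) x‖ₑ) x))

theorem negHolderNorm_sub_comm (α : ℝ) (f g : E d → F) :
    negHolderNorm α (f - g) = negHolderNorm α (g - f) := by
  unfold negHolderNorm
  congr 1; ext t; congr 1; ext ht; congr 1; ext x
  have : heat t (f - g) x = - heat t (g - f) x := by
    unfold heat
    rw [← integral_neg]
    congr 1; ext y
    simp [← smul_neg]
  rw [this, enorm_neg]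

theorem negHolderNorm_zero (α : ℝ) : negHolderNorm α (0 : E d → F) = 0 := by
  simp [negHolderNorm, heat]

theorem IsPeriodic.fderiv {f : E d → F} (hp : IsPeriodic f) : IsPeriodic (fderiv ℝ f) := by
  intro x n
  rw [← fderiv_comp_add_right]
  congr 1
  ext y
  exact hp y n

end Heat

namespace SmoothOneForm

variable {d : ℕ} {𝔤 : Type*} [NormedAddCommGroup 𝔤] [NormedSpace ℝ 𝔤]

instance : CoeFun (SmoothOneForm d 𝔤) (fun _ => E d → Fin d → 𝔤) := ⟨toFun⟩

instance : Zero (SmoothOneForm d 𝔤) := ⟨⟨0, contDiff_const, fun _ _ => rfl⟩⟩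

/-- The `C^∞` topology: uniform convergence of all derivatives. -/
instance : TopologicalSpace (SmoothOneForm d 𝔤) :=
  TopologicalSpace.induced
    (fun A => fun j : ℕ => UniformFun.ofFun (iteratedFDeriv ℝ j A.toFun)) inferInstance

/-- The distance of the norm `|·|_{C^k} = max_{j ≤ k} ‖D^j ·‖_∞`. -/
def ckEDist (k : ℕ) (A B : SmoothOneForm d 𝔤) : ℝ≥0∞ :=
  ⨆ j ∈ Iic k, ⨆ x, ‖iteratedFDeriv ℝ j (A.toFun - B.toFun) x‖ₑ

theorem continuous (A : SmoothOneForm d 𝔤) : Continuous A.toFun := A.contDiff'.continuous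

theorem bounded (A : SmoothOneForm d 𝔤) : ∃ C, ∀ x, ‖A.toFun x‖ ≤ C :=
  A.periodic'.bounded A.continuous

theorem bounded_fderiv (A : SmoothOneForm d 𝔤) : ∃ C, ∀ x, ‖fderiv ℝ A.toFun x‖ ≤ C :=
  A.periodic'.fderiv.bounded (A.contDiff'.continuous_fderiv (by simp))

end SmoothOneForm

/-- The exponents in the definition of the metric `Θ`. -/
structure ThetaExponents where
  η : ℝ
  β : ℝ
  δ : ℝ
  η_lt : η < -1 / 2
  β_lt : β < 0
  δ_gt : 1 + β / 2 < δ
  δ_lt : δ < 1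
  δ_nonneg : 0 ≤ δ

section Theta

variable {d : ℕ} {𝔤 : Type*} [NormedLieRing 𝔤] [CompactLieAlgebra 𝔤]

/-- `Θ(A, B) = |A - B|_{C^η} + sup_{0 < t < 1} t^δ |P_t A · ∂P_t A - P_t B · ∂P_t B|_{C^β}`. -/
def theta (p : ThetaExponents) (A B : SmoothOneForm d 𝔤) : ℝ≥0∞ :=
  negHolderNorm p.η (A.toFun - B.toFun) +
    ⨆ t ∈ Ioo (0 : ℝ) 1, ENNReal.ofReal (t ^ p.δ) *
      negHolderNorm p.β (quadTerm (heat t A.toFun) - quadTerm (heat t B.toFun))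

theorem exists_norm_lie_le [FiniteDimensional ℝ 𝔤] :
    ∃ K, 0 ≤ K ∧ ∀ x y : 𝔤, ‖⁅x, y⁆‖ ≤ K * ‖x‖ * ‖y‖ := by
  let b : 𝔤 →ₗ[ℝ] 𝔤 →ₗ[ℝ] 𝔤 := (LieAlgebra.ad ℝ 𝔤 : 𝔤 →ₗ[ℝ] Module.End ℝ 𝔤)
  let c := LinearMap.toContinuousBilinearMap b
  exact ⟨‖c‖, norm_nonneg c, fun x y => c.le_opNorm₂ x y⟩

theorem continuous_lie [FiniteDimensional ℝ 𝔤] :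
    Continuous fun p : 𝔤 × 𝔤 => ⁅p.1, p.2⁆ := by
  let b : 𝔤 →ₗ[ℝ] 𝔤 →ₗ[ℝ] 𝔤 := (LieAlgebra.ad ℝ 𝔤 : 𝔤 →ₗ[ℝ] Module.End ℝ 𝔤)
  let c := LinearMap.toContinuousBilinearMap b
  exact c.continuous₂

theorem fderiv_heat (A : SmoothOneForm d 𝔤) {t : ℝ} (ht : 0 < t) :
    fderiv ℝ (heat t A.toFun) = heat t (fderiv ℝ A.toFun) := by
  obtain ⟨C, hC⟩ := A.bounded
  obtain ⟨D, hD⟩ := A.bounded_fderiv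
  ext1 x
  exact (hasFDerivAt_heat ht (A.contDiff'.of_le (by simp)) hC hD x).fderiv

theorem continuous_quadTerm_heat [FiniteDimensional ℝ 𝔤] (A : SmoothOneForm d 𝔤) {t : ℝ}
    (ht : 0 < t) : Continuous (quadTerm (heat t A.toFun)) := by
  obtain ⟨C, hC⟩ := A.bounded
  obtain ⟨D, hD⟩ := A.bounded_fderiv
  have h1 : Continuous (heat t A.toFun) := continuous_heat ht A.continuous hC
  have h2 : Continuous (fderiv ℝ (heat t A.toFun)) := by
    rw [fderiv_heat A ht]
    exact continuous_heat ht (A.contDiff'.continuous_fderiv (by simp)) hD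
  have h3 : ∀ j, Continuous (partialDeriv j (heat t A.toFun)) := fun j =>
    h2.clm_apply continuous_const
  refine continuous_pi fun i => continuous_finsetSum _ fun j _ => ?_
  exact continuous_lie.comp (((continuous_apply j).comp h1).prodMk
    ((((continuous_apply i).comp (h3 j)).const_smul (2 : ℝ)).sub ((continuous_apply j).comp (h3 i))))

theorem exists_quadTerm_heat_le [FiniteDimensional ℝ 𝔤] (A : SmoothOneForm d 𝔤) :
    ∃ M, ∀ t, 0 < t → ∀ x, ‖quadTerm (heat t A.toFun) x‖ ≤ M := by
  obtain ⟨C, hC⟩ := A.bounded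
  obtain ⟨D, hD⟩ := A.bounded_fderiv
  obtain ⟨K, hK0, hK⟩ := exists_norm_lie_le (𝔤 := 𝔤)
  have hC0 : 0 ≤ C := (norm_nonneg _).trans (hC 0)
  have hD0 : 0 ≤ D := (norm_nonneg (fderiv ℝ A.toFun 0)).trans (hD 0)
  refine ⟨∑ _j : Fin d, K * C * (2 * D + D), fun t ht x => ?_⟩
  have h1 : ∀ j, ‖heat t A.toFun x j‖ ≤ C := fun j =>
    (norm_le_pi_norm _ j).trans (norm_heat_le ht hC x)
  have h2 : ∀ j i, ‖partialDeriv j (heat t A.toFun) x i‖ ≤ D := by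
    intro j i
    refine (norm_le_pi_norm _ i).trans ?_
    unfold partialDeriv
    rw [fderiv_heat A ht]
    refine (ContinuousLinearMap.le_opNorm _ _).trans ?_
    simpa using norm_heat_le ht hD x
  refine (pi_norm_le_iff_of_nonneg (Finset.sum_nonneg fun _ _ => by positivity)).2 fun i => ?_
  refine (norm_sum_le _ _).trans (Finset.sum_le_sum fun j _ => ?_)
  refine (hK _ _).trans (mul_le_mul (mul_le_mul_of_nonneg_left (h1 j) hK0) ?_ (norm_nonneg _)
    (by positivity))
  refine (norm_sub_le _ _).trans (add_le_add ?_ (h2 i j))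
  rw [norm_smul, Real.norm_of_nonneg (by norm_num : (0 : ℝ) ≤ 2)]
  exact mul_le_mul_of_nonneg_left (h2 j i) (by norm_num)

theorem theta_self (p : ThetaExponents) (A : SmoothOneForm d 𝔤) : theta p A A = 0 := by
  simp [theta, negHolderNorm_zero]

theorem theta_comm (p : ThetaExponents) (A B : SmoothOneForm d 𝔤) :
    theta p A B = theta p B A := by
  unfold theta
  rw [negHolderNorm_sub_comm]
  congr 1
  refine iSup_congr fun t => iSup_congr fun _ => ?_
  rw [negHolderNorm_sub_comm]

theorem theta_triangle [FiniteDimensional ℝ 𝔤] (p : ThetaExponents) (A B C : SmoothOneForm d 𝔤) :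
    theta p A C ≤ theta p A B + theta p B C := by
  unfold theta
  rw [add_add_add_comm]
  refine add_le_add (negHolderNorm_sub_triangle _ A.continuous B.continuous C.continuous
    A.bounded B.bounded C.bounded) (iSup₂_le fun t ht => ?_)
  have hq : ∀ X : SmoothOneForm d 𝔤, ∃ M, ∀ x, ‖quadTerm (heat t X.toFun) x‖ ≤ M := fun X =>
    (exists_quadTerm_heat_le X).imp fun M h => h t ht.1
  have h := negHolderNorm_sub_triangle p.β (continuous_quadTerm_heat A ht.1)
    (continuous_quadTerm_heat B ht.1) (continuous_quadTerm_heat C ht.1) (hq A) (hq B) (hq C)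
  refine (mul_le_mul_right h _).trans ?_
  rw [mul_add]
  exact add_le_add
    (le_iSup₂_of_le (f := fun t (_ : t ∈ Ioo (0 : ℝ) 1) => ENNReal.ofReal (t ^ p.δ) *
      negHolderNorm p.β (quadTerm (heat t A.toFun) - quadTerm (heat t B.toFun))) t ht le_rfl)
    (le_iSup₂_of_le (f := fun t (_ : t ∈ Ioo (0 : ℝ) 1) => ENNReal.ofReal (t ^ p.δ) *
      negHolderNorm p.β (quadTerm (heat t B.toFun) - quadTerm (heat t C.toFun))) t ht le_rfl)

theorem theta_ne_top [FiniteDimensional ℝ 𝔤] (p : ThetaExponents) (A B : SmoothOneForm d 𝔤) :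
    theta p A B ≠ ⊤ := by
  obtain ⟨a, ha⟩ := A.bounded
  obtain ⟨b, hb⟩ := B.bounded
  obtain ⟨M, hM⟩ := exists_quadTerm_heat_le A
  obtain ⟨N, hN⟩ := exists_quadTerm_heat_le B
  refine ENNReal.add_ne_top.2 ⟨ne_top_of_le_ne_top ENNReal.ofReal_ne_top
    (negHolderNorm_le (C := a + b) (by linarith [p.η_lt])
      fun x => (norm_sub_le _ _).trans (add_le_add (ha x) (hb x))), ?_⟩
  refine ne_top_of_le_ne_top (b := ENNReal.ofReal (M + N)) ENNReal.ofReal_ne_top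
    (iSup₂_le fun t ht => ?_)
  have h1 : ENNReal.ofReal (t ^ p.δ) ≤ 1 := by
    rw [← ENNReal.ofReal_one]
    exact ENNReal.ofReal_le_ofReal (Real.rpow_le_one ht.1.le ht.2.le p.δ_nonneg)
  calc _ ≤ 1 * ENNReal.ofReal (M + N) := mul_le_mul' h1
        (negHolderNorm_le p.β_lt.le fun x =>
          (norm_sub_le _ _).trans (add_le_add (hM t ht.1 x) (hN t ht.1 x)))
    _ = _ := one_mul _

/-- Smooth `1`-forms, to be equipped with the metric `Θ` (rather than the `C^∞` topology). -/
structure ThetaForm (p : ThetaExponents) (d : ℕ) (𝔤 : Type*) [NormedLieRing 𝔤]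
    [CompactLieAlgebra 𝔤] where
  form : SmoothOneForm d 𝔤

instance [FiniteDimensional ℝ 𝔤] (p : ThetaExponents) : PseudoMetricSpace (ThetaForm p d 𝔤) :=
  let _ : PseudoEMetricSpace (ThetaForm p d 𝔤) :=
    { edist := fun A B => theta p A.form B.form
      edist_self := fun A => theta_self p A.form
      edist_comm := fun A B => theta_comm p A.form B.form
      edist_triangle := fun A B C => theta_triangle p A.form B.form C.form }
  PseudoEMetricSpace.toPseudoMetricSpace fun A B => theta_ne_top p A.form B.form

/-- The space `(𝓘, Θ)`: the metric completion of the smooth `1`-forms under `Θ`. -/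
abbrev InitialSpace (p : ThetaExponents) (d : ℕ) (𝔤 : Type*) [NormedLieRing 𝔤]
    [CompactLieAlgebra 𝔤] [FiniteDimensional ℝ 𝔤] :=
  UniformSpace.Completion (ThetaForm p d 𝔤)

/-- The canonical map from smooth `1`-forms to `𝓘`. -/
def ofSmooth [FiniteDimensional ℝ 𝔤] (p : ThetaExponents) (A : SmoothOneForm d 𝔤) :
    InitialSpace p d 𝔤 :=
  ((⟨A⟩ : ThetaForm p d 𝔤) : UniformSpace.Completion (ThetaForm p d 𝔤))

/-- `A` is a classical (smooth) solution on `[0, t]` of the Yang–Mills flow with DeTurck term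
`∂_s A = -d_A^* F(A) - d_A d^* A`, `A(0) = a`. -/
structure IsYMFlow (t : ℝ) (a : SmoothOneForm d 𝔤) (A : ℝ → SmoothOneForm d 𝔤) : Prop where
  continuousOn : ContinuousOn A (Icc 0 t)
  initial : A 0 = a
  eqn : ∀ s ∈ Icc 0 t, ∀ x : E d,
    HasDerivWithinAt (fun r => A r x) (ymRHS (A s) x) (Icc 0 t) s

end Theta

end YMFlow

end

/-! Write a solution as `A(s) = P_s a + w(s)`. By the first part of `Θ`, the heat flow is of size
`s^{-ν}` with `ν = -η/2`, and its gradient costs a further `s^{-1/2}`. In Duhamel's formula the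
source `P_s a ∂P_s a` is thus a priori of size `s^{η-1/2}`, which is not integrable at zero because
`η < -1/2`. It is the only critical term, and the second part of `Θ` controls it: smoothed by `P_r`,
it is at most `Θ s^{-δ} r^{β/2}`. If `β` is very negative, this bound loses too much in `r`. A
geometric mean of it and the a priori bound, with weights `θ` and `1 - θ`, gives `s^{-δ'} r^{-b}`
with `b = -θβ/2` and `δ' = δθ + (1/2 - η)(1 - θ)`.

One then looks for `w` of size `s^{-μ}` with `μ = b`. The terms mixing `P_s a` and `w` have size at
most `s^{-ν-μ-1/2}` and the cubic ones `s^{-3ν}`. Everything is integrable when `δ' < 1`, `ν + μ <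
1/2` and `ν < 1/3`. The last condition is `η > -2/3`; a `θ` with the other two exists exactly under
the second inequality assumed on `η`, `β`, `δ` (`exists_interpolation_exponent`).

The quantitative core is `norm_dev_sub_le`: on a time interval depending only on the ball, `w` is
Lipschitz in the datum with respect to `Θ`, uniformly along the Picard iteration. Comparison with
the datum `0` also gives size bounds. For a fixed smooth datum, growth slower than `s^{-1/2}` makes
the equation subcritical, so that exponential weights in time yield uniform `C^k` bounds and
convergence of the iteration on that same interval (`exists_mild_solution`). At positive times the
Lipschitz bound in `C^1` improves to `C^k` by parabolic smoothing (`bd_sub_of_bd_one`), and a map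
that is Lipschitz into every `C^k` extends from smooth forms to the completion
(`exists_smoothOneForm_extension`). -/

open Set Filter Topology MeasureTheory
open scoped ENNReal NNReal ContDiff

noncomputable section

namespace YMFlow

universe u

set_option linter.unusedSectionVars false
set_option maxSynthPendingDepth 3

/-! ### Gaussian integrals and integration by parts. -/

section Gaussian

variable {d : ℕ} {F : Type*} [NormedAddCommGroup F] [NormedSpace ℝ F]

/-- The heat semigroup in scaled form; it makes sense for all `r`, with `hs r = id` for `r ≤ 0`. -/
def hs (r : ℝ) (f : E d → F) (x : E d) : F :=
  ∫ z, heatKernel d 1 z • f (x - √r • z)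

/-- Substitution `y = √r z`. The scaled form fixes the kernel and moves the time into the argument
of `f`, so that continuity at `r = 0` needs no separate treatment. -/
theorem hs_eq_heat {r : ℝ} (hr : 0 < r) (f : E d → F) (x : E d) : hs r f x = heat r f x := by
  have hq : 0 < √r := Real.sqrt_pos.2 hr
  have h := Measure.integral_comp_smul (volume : Measure (E d))
    (fun y => heatKernel d r y • f (x - y)) (√r)
  have e : ∀ z : E d, heatKernel d r (√r • z) = (√r ^ d)⁻¹ * heatKernel d 1 z := by
    intro z
    unfold heatKernel
    rw [norm_smul, Real.norm_of_nonneg hq.le, mul_pow, Real.sq_sqrt hr.le,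
      Real.mul_rpow (by positivity) hr.le, mul_one]
    have h1 : r ^ (-(d : ℝ) / 2) = (√r ^ d)⁻¹ := by
      rw [Real.sqrt_eq_rpow, ← Real.rpow_natCast, ← Real.rpow_mul hr.le, ← Real.rpow_neg hr.le]
      congr 1; ring
    rw [h1]
    have h2 : r * ‖z‖ ^ 2 / (4 * r) = ‖z‖ ^ 2 / 4 := by field_simp
    rw [h2]; simp; ring
  have hpos : 0 < √r ^ d := by positivity
  rw [finrank_euclideanSpace_fin, abs_of_pos (by positivity)] at h
  simp_rw [e, mul_smul] at h
  rw [integral_smul] at h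
  exact smul_right_injective F (inv_ne_zero hpos.ne') h

/-- The factor `‖z‖` is absorbed by halving the rate of the Gaussian, so the kernel at time `2` is a
dominating function. -/
theorem integrable_heatKernel_mul_norm :
    Integrable (fun z : E d => heatKernel d 1 z * ‖z‖) := by
  refine ((heatKernel_integrable (d := d) (t := 2) (by norm_num)).const_mul
    (2 * ((4 * Real.pi * 1) ^ (-(d : ℝ) / 2) / (4 * Real.pi * 2) ^ (-(d : ℝ) / 2)))).mono'
    ((heatKernel_continuous 1).mul continuous_norm).aestronglyMeasurable (ae_of_all _ fun z => ?_)
  have hz := norm_nonneg z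
  rw [Real.norm_of_nonneg (mul_nonneg (heatKernel_nonneg one_pos z) hz)]
  unfold heatKernel
  set c := (4 * Real.pi * 2) ^ (-(d : ℝ) / 2) with hc
  have hcp : 0 < c := by positivity
  have h1 : ‖z‖ * Real.exp (-(‖z‖ ^ 2 / (4 * 1))) ≤ 2 * Real.exp (-(‖z‖ ^ 2 / (4 * 2))) := by
    have h2 : Real.exp (-(‖z‖ ^ 2 / (4 * 2)))
        = Real.exp (-(‖z‖ ^ 2 / (4 * 1))) * Real.exp (‖z‖ ^ 2 / 8) := by
      rw [← Real.exp_add]; congr 1; ring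
    rw [h2]
    have h3 := Real.add_one_le_exp (‖z‖ ^ 2 / 8)
    have h4 : ‖z‖ ≤ 2 * Real.exp (‖z‖ ^ 2 / 8) := by nlinarith [sq_nonneg (‖z‖ - 2)]
    have h5 := Real.exp_pos (-(‖z‖ ^ 2 / (4 * 1)))
    nlinarith
  have h6 : 0 ≤ (4 * Real.pi * 1) ^ (-(d : ℝ) / 2) := by positivity
  calc _ = (4 * Real.pi * 1) ^ (-(d : ℝ) / 2) * (‖z‖ * Real.exp (-(‖z‖ ^ 2 / (4 * 1)))) := by ring
    _ ≤ (4 * Real.pi * 1) ^ (-(d : ℝ) / 2) * (2 * Real.exp (-(‖z‖ ^ 2 / (4 * 2)))) :=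
      mul_le_mul_of_nonneg_left h1 h6
    _ = _ := by field_simp

theorem hasFDerivAt_heatKernel (z : E d) :
    HasFDerivAt (heatKernel d 1) ((-(heatKernel d 1 z / 2)) • innerSL ℝ z) z := by
  have h1 : HasFDerivAt (fun z : E d => ‖z‖ ^ 2) (2 • innerSL ℝ z) z :=
    (hasStrictFDerivAt_norm_sq z).hasFDerivAt
  have h2 := (((h1.const_mul (-(1 / 4 : ℝ))).exp).const_mul ((4 * Real.pi * 1) ^ (-(d : ℝ) / 2)))
  refine (h2.congr_fderiv ?_).congr_of_eventuallyEq (Eventually.of_forall fun y => ?_)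
  · ext v
    simp only [heatKernel, smul_apply, nsmul_eq_mul, smul_eq_mul]
    rw [show -(1 / 4 : ℝ) * ‖z‖ ^ 2 = -(‖z‖ ^ 2 / (4 * 1)) by ring]
    simp
    ring
  · simp only [heatKernel]
    rw [show -(1 / 4 : ℝ) * ‖y‖ ^ 2 = -(‖y‖ ^ 2 / (4 * 1)) by ring]

theorem integrable_heatKernel_smul {f : E d → F} (hf : Continuous f) {C : ℝ}
    (hC : ∀ x, ‖f x‖ ≤ C) : Integrable (fun z => heatKernel d 1 z • f z) := by
  refine ((heatKernel_integrable (d := d) one_pos).mul_const C).mono'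
    ((heatKernel_continuous 1).smul hf).aestronglyMeasurable (ae_of_all _ fun y => ?_)
  rw [norm_smul, Real.norm_of_nonneg (heatKernel_nonneg one_pos y)]
  exact mul_le_mul_of_nonneg_left (hC _) (heatKernel_nonneg one_pos y)

theorem integrable_heatKernel_inner_smul {f : E d → F} (hf : Continuous f) {C : ℝ}
    (hC : ∀ x, ‖f x‖ ≤ C) (v : E d) :
    Integrable (fun z => (heatKernel d 1 z * (inner ℝ z v / 2)) • f z) := by
  refine (integrable_heatKernel_mul_norm.mul_const (‖v‖ * C)).mono'
    (((heatKernel_continuous 1).mul (by fun_prop)).smul hf).aestronglyMeasurable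
    (ae_of_all _ fun z => ?_)
  have h := heatKernel_nonneg (d := d) one_pos z
  have hC0 : 0 ≤ C := (norm_nonneg _).trans (hC 0)
  rw [norm_smul, norm_mul, Real.norm_of_nonneg h, norm_div, Real.norm_ofNat]
  have h1 := norm_inner_le_norm (𝕜 := ℝ) z v
  have h2 : ‖inner ℝ z v‖ / 2 ≤ ‖z‖ * ‖v‖ := by linarith [norm_nonneg (inner ℝ z v)]
  calc _ ≤ heatKernel d 1 z * (‖z‖ * ‖v‖) * C := by gcongr; exact hC z
    _ = _ := by ring

/-- Integration by parts: the gradient of the Gaussian at time `1` is `-z/2` times the Gaussian. -/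
theorem integral_heatKernel_fderiv {f : E d → F} (hf : Differentiable ℝ f)
    (hf' : Continuous (fderiv ℝ f)) {C D : ℝ} (hC : ∀ x, ‖f x‖ ≤ C)
    (hD : ∀ x, ‖fderiv ℝ f x‖ ≤ D) (v : E d) :
    ∫ z, heatKernel d 1 z • fderiv ℝ f z v
      = ∫ z, (heatKernel d 1 z * (inner ℝ z v / 2)) • f z := by
  have e : ∀ z, (fderiv ℝ (heatKernel d 1) z v) • f z
      = -((heatKernel d 1 z * (inner ℝ z v / 2)) • f z) := by
    intro z
    rw [(hasFDerivAt_heatKernel z).fderiv, ← neg_smul]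
    congr 1
    simp; ring
  rw [integral_smul_fderiv_eq_neg_fderiv_smul_of_integrable]
  · simp_rw [e]
    rw [integral_neg, neg_neg]
  · simp_rw [e]
    exact (integrable_heatKernel_inner_smul hf.continuous hC v).neg
  · refine integrable_heatKernel_smul (C := D * ‖v‖) (by fun_prop) fun x => ?_
    exact (ContinuousLinearMap.le_opNorm _ _).trans (by gcongr; exact hD x)
  · exact integrable_heatKernel_smul hf.continuous hC
  · exact fun z _ => (hasFDerivAt_heatKernel z).differentiableAt
  · exact fun z _ => hf z

end Gaussian

/-! ### The heat semigroup on bounded functions. -/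

section HeatScaled

variable {d : ℕ} {F : Type*} [NormedAddCommGroup F] [NormedSpace ℝ F]

theorem integrable_hs {f : E d → F} (hf : Continuous f) {C : ℝ} (hC : ∀ x, ‖f x‖ ≤ C) (r : ℝ)
    (x : E d) : Integrable (fun z => heatKernel d 1 z • f (x - √r • z)) :=
  integrable_heatKernel_smul (f := fun z => f (x - √r • z)) (by fun_prop) fun _ => hC _

theorem norm_hs_le {f : E d → F} {C : ℝ} (hC : ∀ x, ‖f x‖ ≤ C) (r : ℝ) (x : E d) :
    ‖hs r f x‖ ≤ C := by
  have h : ‖hs r f x‖ ≤ ∫ y, heatKernel d 1 y * C := by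
    refine norm_integral_le_of_norm_le ((heatKernel_integrable (d := d) one_pos).mul_const C)
      (ae_of_all _ fun y => ?_)
    rw [norm_smul, Real.norm_of_nonneg (heatKernel_nonneg one_pos y)]
    exact mul_le_mul_of_nonneg_left (hC _) (heatKernel_nonneg one_pos y)
  rwa [integral_mul_const, integral_heatKernel one_pos, one_mul] at h

theorem hs_of_nonpos [CompleteSpace F] {r : ℝ} (hr : r ≤ 0) (f : E d → F) (x : E d) :
    hs r f x = f x := by
  simp [hs, Real.sqrt_eq_zero_of_nonpos hr, integral_smul_const, integral_heatKernel one_pos]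

theorem hs_add {f g : E d → F} (hf : Continuous f) (hg : Continuous g) {C D : ℝ}
    (hC : ∀ x, ‖f x‖ ≤ C) (hD : ∀ x, ‖g x‖ ≤ D) (r : ℝ) (x : E d) :
    hs r (fun y => f y + g y) x = hs r f x + hs r g x := by
  unfold hs
  rw [← integral_add (integrable_hs hf hC r x) (integrable_hs hg hD r x)]
  simp [smul_add]

theorem hs_sub {f g : E d → F} (hf : Continuous f) (hg : Continuous g) {C D : ℝ}
    (hC : ∀ x, ‖f x‖ ≤ C) (hD : ∀ x, ‖g x‖ ≤ D) (r : ℝ) (x : E d) :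
    hs r (fun y => f y - g y) x = hs r f x - hs r g x := by
  unfold hs
  rw [← integral_sub (integrable_hs hf hC r x) (integrable_hs hg hD r x)]
  simp [smul_sub]

/-- Dominated convergence against the fixed kernel. All later joint continuity statements, including
those up to time zero, are instances of this one. -/
theorem continuous_hs_param {X : Type*} [TopologicalSpace X] [FirstCountableTopology X]
    {ρ : X → ℝ} (hρ : Continuous ρ) {φ : X → E d → F}
    (hφ : Continuous fun p : X × E d => φ p.1 p.2)
    (hb : ∀ p₀, ∃ C, ∀ᶠ p in 𝓝 p₀, ∀ y, ‖φ p y‖ ≤ C) {y : X → E d} (hy : Continuous y) :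
    Continuous fun p => hs (ρ p) (φ p) (y p) := by
  have hc : ∀ z : E d, Continuous fun p => heatKernel d 1 z • φ p (y p - √(ρ p) • z) := by
    intro z
    have : Continuous fun p => (p, y p - √(ρ p) • z) := by fun_prop
    exact (hφ.comp this).const_smul _
  have hc' : ∀ p, Continuous fun z => φ p (y p - √(ρ p) • z) := by
    intro p
    have : Continuous fun z : E d => (p, y p - √(ρ p) • z) := by fun_prop
    exact hφ.comp this
  refine continuous_iff_continuousAt.2 fun p₀ => ?_
  obtain ⟨C, hC⟩ := hb p₀
  refine continuousAt_of_dominated (bound := fun z => heatKernel d 1 z * C)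
    (Eventually.of_forall fun p =>
      ((heatKernel_continuous 1).smul (hc' p)).aestronglyMeasurable)
    (hC.mono fun p hp => ae_of_all _ fun z => ?_)
    ((heatKernel_integrable (d := d) one_pos).mul_const C) (ae_of_all _ fun z => (hc z).continuousAt)
  rw [norm_smul, Real.norm_of_nonneg (heatKernel_nonneg one_pos z)]
  exact mul_le_mul_of_nonneg_left (hp _) (heatKernel_nonneg one_pos z)

theorem hasFDerivAt_hs {f : E d → F} (hf : Differentiable ℝ f) (hf' : Continuous (fderiv ℝ f))
    {C D : ℝ} (hC : ∀ x, ‖f x‖ ≤ C) (hD : ∀ x, ‖fderiv ℝ f x‖ ≤ D) (r : ℝ) (x : E d) :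
    HasFDerivAt (hs r f) (hs r (fderiv ℝ f) x) x := by
  refine hasFDerivAt_integral_of_dominated_of_fderiv_le
    (F' := fun x z => heatKernel d 1 z • fderiv ℝ f (x - √r • z))
    (bound := fun y => heatKernel d 1 y * D) (s := univ) univ_mem
    (Eventually.of_forall fun x => (integrable_hs hf.continuous hC r x).aestronglyMeasurable)
    (integrable_hs hf.continuous hC r x)
    (integrable_hs hf' hD r x).aestronglyMeasurable
    (ae_of_all _ fun y z _ => ?_) ((heatKernel_integrable (d := d) one_pos).mul_const D)
    (ae_of_all _ fun y z _ => ?_)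
  · rw [norm_smul, Real.norm_of_nonneg (heatKernel_nonneg one_pos y)]
    exact mul_le_mul_of_nonneg_left (hD _) (heatKernel_nonneg one_pos y)
  · have h1 : HasFDerivAt f (fderiv ℝ f (z - √r • y)) (z - √r • y) := (hf _).hasFDerivAt
    have h2 := (h1.comp z ((hasFDerivAt_id z).sub_const (√r • y))).const_smul (heatKernel d 1 y)
    rw [ContinuousLinearMap.comp_id] at h2
    exact h2

theorem fderiv_hs {f : E d → F} (hf : Differentiable ℝ f) (hf' : Continuous (fderiv ℝ f))
    {C D : ℝ} (hC : ∀ x, ‖f x‖ ≤ C) (hD : ∀ x, ‖fderiv ℝ f x‖ ≤ D) (r : ℝ) :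
    fderiv ℝ (hs r f) = hs r (fderiv ℝ f) :=
  funext fun x => (hasFDerivAt_hs hf hf' hC hD r x).fderiv

/-- The constant in the gradient estimate for the heat semigroup. -/
def gradConst (d : ℕ) : ℝ := ∫ z : E d, heatKernel d 1 z * ‖z‖

theorem gradConst_nonneg (d : ℕ) : 0 ≤ gradConst d :=
  integral_nonneg fun z => mul_nonneg (heatKernel_nonneg one_pos z) (norm_nonneg z)

theorem hs_clm [CompleteSpace F] {G : Type*} [NormedAddCommGroup G] [NormedSpace ℝ G]
    [CompleteSpace G] (l : F →L[ℝ] G)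
    {f : E d → F} (hf : Continuous f) {C : ℝ} (hC : ∀ x, ‖f x‖ ≤ C) (r : ℝ) (x : E d) :
    hs r (fun y => l (f y)) x = l (hs r f x) := by
  unfold hs
  rw [← l.integral_comp_comm (integrable_hs hf hC r x)]
  simp

/-- The derivative of `z ↦ f (x - √r z)` is `-√r` times that of `f`, so moving it onto the Gaussian
gains `r^{-1/2}`. The bound `D` serves integrability only and does not enter the estimate. -/
theorem norm_hs_fderiv_le [CompleteSpace F] {f : E d → F} (hf : Differentiable ℝ f)
    (hf' : Continuous (fderiv ℝ f))
    {C D : ℝ} (hC : ∀ x, ‖f x‖ ≤ C) (hD : ∀ x, ‖fderiv ℝ f x‖ ≤ D) {r : ℝ} (hr : 0 < r)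
    (x : E d) : ‖hs r (fderiv ℝ f) x‖ ≤ gradConst d * r ^ (-(1 / 2) : ℝ) * C := by
  have hC0 : 0 ≤ C := (norm_nonneg _).trans (hC 0)
  have hq : 0 < √r := Real.sqrt_pos.2 hr
  have hg := gradConst_nonneg d
  have er : r ^ (-(1 / 2) : ℝ) = (√r)⁻¹ := by rw [Real.rpow_neg hr.le, Real.sqrt_eq_rpow]
  rw [er]
  refine ContinuousLinearMap.opNorm_le_bound _ (by positivity) fun v => ?_
  have hψ : ∀ z, HasFDerivAt (fun z => f (x - √r • z)) (-(√r • fderiv ℝ f (x - √r • z))) z := by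
    intro z
    have h1 : HasFDerivAt f (fderiv ℝ f (x - √r • z)) (x - √r • z) := (hf _).hasFDerivAt
    have h2 : HasFDerivAt (fun z : E d => x - √r • z)
        (-(√r • ContinuousLinearMap.id ℝ (E d))) z :=
      ((hasFDerivAt_id z).const_smul (√r)).const_sub x
    refine (h1.comp z h2).congr_fderiv ?_
    ext w; simp
  have hψ' : fderiv ℝ (fun z => f (x - √r • z)) = fun z => -(√r • fderiv ℝ f (x - √r • z)) :=
    funext fun z => (hψ z).fderiv
  have h := integral_heatKernel_fderiv (f := fun z => f (x - √r • z))
    (fun z => (hψ z).differentiableAt) (by rw [hψ']; fun_prop) (C := C) (D := √r * D)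
    (fun z => hC _) (fun z => by
      rw [hψ', norm_neg, norm_smul, Real.norm_of_nonneg hq.le]; gcongr; exact hD _) v
  rw [hψ'] at h
  have e1 : (fun z => heatKernel d 1 z • (-(√r • fderiv ℝ f (x - √r • z))) v)
      = fun z => (-√r) • (heatKernel d 1 z • fderiv ℝ f (x - √r • z)) v := by
    ext1 z; simp [smul_comm (√r)]
  simp only [e1] at h
  rw [integral_smul, ← ContinuousLinearMap.integral_apply (integrable_hs hf' hD r x)] at h
  have h3 : ‖(-√r) • hs r (fderiv ℝ f) x v‖ ≤ ∫ z, heatKernel d 1 z * ‖z‖ * (‖v‖ * C) := by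
    unfold hs
    rw [h]
    refine norm_integral_le_of_norm_le (integrable_heatKernel_mul_norm.mul_const _)
      (ae_of_all _ fun z => ?_)
    have h := heatKernel_nonneg (d := d) one_pos z
    rw [norm_smul, norm_mul, Real.norm_of_nonneg h, norm_div, Real.norm_ofNat]
    have h1 := norm_inner_le_norm (𝕜 := ℝ) z v
    have h2 : ‖inner ℝ z v‖ / 2 ≤ ‖z‖ * ‖v‖ := by linarith [norm_nonneg (inner ℝ z v)]
    calc _ ≤ heatKernel d 1 z * (‖z‖ * ‖v‖) * C := by gcongr; exact hC _
      _ = _ := by ring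
  rw [integral_mul_const, norm_smul, norm_neg, Real.norm_of_nonneg hq.le] at h3
  change √r * _ ≤ gradConst d * _ at h3
  rw [← mul_le_mul_iff_right₀ hq]
  refine h3.trans (le_of_eq ?_)
  field_simp

end HeatScaled

/-! ### Regular time-dependent functions and Duhamel integrals. -/

section Paths

variable {d : ℕ} {F G H : Type u} [NormedAddCommGroup F] [NormedSpace ℝ F]
  [NormedAddCommGroup G] [NormedSpace ℝ G] [NormedAddCommGroup H] [NormedSpace ℝ H]

/-- Time-dependent functions that are jointly continuous, and bounded on bounded time intervals. -/
structure Tame (f : ℝ → E d → F) : Prop where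
  cont : Continuous fun p : ℝ × E d => f p.1 p.2
  bdd : ∀ T, ∃ C, ∀ s, |s| ≤ T → ∀ x, ‖f s x‖ ≤ C

/-- Time-dependent functions whose spatial derivatives up to order `n` are tame. -/
def Reg : ℕ → ∀ {F : Type u} [NormedAddCommGroup F] [NormedSpace ℝ F], (ℝ → E d → F) → Prop
  | 0, _, _, _, f => Tame f
  | n + 1, _, _, _, f =>
    Tame f ∧ (∀ s, Differentiable ℝ (f s)) ∧ Reg n (fun s => fderiv ℝ (f s))

/-- The Duhamel integral `∫₀ᵗ P_{t-s} f_s ds`. -/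
def duh (f : ℝ → E d → F) (t : ℝ) (x : E d) : F := ∫ s in (0 : ℝ)..t, hs (t - s) (f s) x

namespace Tame

theorem cont_at {f : ℝ → E d → F} (hf : Tame f) (s : ℝ) : Continuous (f s) :=
  hf.cont.comp (continuous_const.prodMk continuous_id)

theorem bdd_at {f : ℝ → E d → F} (hf : Tame f) (s : ℝ) : ∃ C, ∀ x, ‖f s x‖ ≤ C :=
  (hf.bdd |s|).imp fun _ h => h s le_rfl

theorem locally_bdd {f : ℝ → E d → F} (hf : Tame f) {X : Type*} [TopologicalSpace X] {τ : X → ℝ}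
    (hτ : Continuous τ) (p₀ : X) : ∃ C, ∀ᶠ p in 𝓝 p₀, ∀ y, ‖f (τ p) y‖ ≤ C := by
  obtain ⟨C, hC⟩ := hf.bdd (|τ p₀| + 1)
  refine ⟨C, ?_⟩
  have : ∀ᶠ p in 𝓝 p₀, |τ p| < |τ p₀| + 1 :=
    (hτ.abs.continuousAt).eventually (gt_mem_nhds (by linarith))
  exact this.mono fun p hp y => hC _ hp.le y

theorem bilin {f : ℝ → E d → F} {g : ℝ → E d → G} (hf : Tame f) (hg : Tame g)
    (B : F →L[ℝ] G →L[ℝ] H) : Tame fun s x => B (f s x) (g s x) := by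
  refine ⟨B.continuous₂.comp (hf.cont.prodMk hg.cont), fun T => ?_⟩
  obtain ⟨C, hC⟩ := hf.bdd T
  obtain ⟨D, hD⟩ := hg.bdd T
  refine ⟨‖B‖ * C * D, fun s hs x => (B.le_opNorm₂ _ _).trans ?_⟩
  have hC0 : 0 ≤ C := (norm_nonneg _).trans (hC s hs x)
  gcongr
  exacts [hC s hs x, hD s hs x]

theorem clm {f : ℝ → E d → F} (hf : Tame f) (l : F →L[ℝ] G) : Tame fun s x => l (f s x) := by
  refine ⟨l.continuous.comp hf.cont, fun T => ?_⟩
  obtain ⟨C, hC⟩ := hf.bdd T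
  exact ⟨‖l‖ * C, fun s hs x => (l.le_opNorm _).trans (by gcongr; exact hC s hs x)⟩

theorem of_comp_eq {f : ℝ → E d → F} (hf : Tame f) {g : ℝ → E d → G} {L : F → G}
    (hL : Continuous L) (hn : ∀ y, ‖L y‖ = ‖y‖) (h : ∀ s x, L (f s x) = g s x) : Tame g := by
  obtain rfl : (fun s x => L (f s x)) = g := funext fun s => funext (h s)
  refine ⟨hL.comp hf.cont, fun T => (hf.bdd T).imp fun C hC s hs x => ?_⟩
  rw [hn]
  exact hC s hs x

theorem add {f g : ℝ → E d → F} (hf : Tame f) (hg : Tame g) : Tame fun s x => f s x + g s x := by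
  refine ⟨hf.cont.add hg.cont, fun T => ?_⟩
  obtain ⟨C, hC⟩ := hf.bdd T
  obtain ⟨D, hD⟩ := hg.bdd T
  exact ⟨C + D, fun s hs x => (norm_add_le _ _).trans (add_le_add (hC s hs x) (hD s hs x))⟩

theorem comp_time {f : ℝ → E d → F} (hf : Tame f) {φ : ℝ → ℝ} (hφ : Continuous φ) :
    Tame fun s => f (φ s) := by
  refine ⟨hf.cont.comp ((hφ.comp continuous_fst).prodMk continuous_snd), fun T => ?_⟩
  obtain ⟨K, hK⟩ := (isCompact_Icc (a := -T) (b := T)).exists_bound_of_continuousOn hφ.continuousOn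
  obtain ⟨C, hC⟩ := hf.bdd K
  exact ⟨C, fun s hs x => hC _ (hK s (abs_le.1 hs)) x⟩

theorem hs {f : ℝ → E d → F} (hf : Tame f) {ρ : ℝ → ℝ} (hρ : Continuous ρ) :
    Tame fun s => hs (ρ s) (f s) := by
  refine ⟨continuous_hs_param (X := ℝ × E d) (hρ.comp continuous_fst) (φ := fun p => f p.1) ?_
    (hf.locally_bdd continuous_fst) continuous_snd, fun T => ?_⟩
  · exact hf.cont.comp ((continuous_fst.comp continuous_fst).prodMk continuous_snd)
  · exact (hf.bdd T).imp fun C hC s hs => norm_hs_le (hC s hs) _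

theorem continuous_duh_integrand {f : ℝ → E d → F} (hf : Tame f) :
    Continuous fun p : (ℝ × E d) × ℝ => YMFlow.hs (p.1.1 - p.2) (f p.2) p.1.2 := by
  refine continuous_hs_param (by fun_prop) (φ := fun p : (ℝ × E d) × ℝ => f p.2) ?_
    (hf.locally_bdd continuous_snd) (by fun_prop)
  exact hf.cont.comp ((continuous_snd.comp continuous_fst).prodMk continuous_snd)

theorem continuous_hs_sub {f : ℝ → E d → F} (hf : Tame f) (t : ℝ) (x : E d) :
    Continuous fun s => YMFlow.hs (t - s) (f s) x :=
  hf.continuous_duh_integrand.comp (continuous_const (y := (t, x)) |>.prodMk continuous_id)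

theorem duh {f : ℝ → E d → F} (hf : Tame f) : Tame (duh f) := by
  refine ⟨intervalIntegral.continuous_parametric_intervalIntegral_of_continuous
    (X := ℝ × E d) (f := fun p s => YMFlow.hs (p.1 - s) (f s) p.2)
    hf.continuous_duh_integrand continuous_fst, fun T => ?_⟩
  obtain ⟨C, hC⟩ := hf.bdd T
  refine ⟨C * T, fun t ht x => ?_⟩
  have h : ‖∫ s in (0 : ℝ)..t, YMFlow.hs (t - s) (f s) x‖ ≤ C * |t - 0| := by
    refine intervalIntegral.norm_integral_le_of_norm_le_const fun s hs => norm_hs_le (hC s ?_) _ _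
    rcases le_total 0 t with h | h
    · rw [uIoc_of_le h] at hs
      rw [abs_of_pos hs.1]; rw [abs_of_nonneg h] at ht; exact hs.2.trans ht
    · rw [uIoc_of_ge h] at hs
      rw [abs_of_nonpos hs.2]; rw [abs_of_nonpos h] at ht; linarith [hs.1]
  rw [sub_zero] at h
  have hC0 : 0 ≤ C := (norm_nonneg _).trans (hC t ht x)
  exact h.trans (mul_le_mul_of_nonneg_left ht hC0)

end Tame

theorem hasFDerivAt_duh {f : ℝ → E d → F} (hf : Tame f) (hd : ∀ s, Differentiable ℝ (f s))
    (hf' : Tame fun s => fderiv ℝ (f s)) (t : ℝ) (x : E d) :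
    HasFDerivAt (duh f t) (duh (fun s => fderiv ℝ (f s)) t x) x := by
  obtain ⟨D, hD⟩ := hf'.bdd |t|
  refine intervalIntegral.hasFDerivAt_integral_of_dominated_of_fderiv_le
    (F' := fun x s => hs (t - s) (fderiv ℝ (f s)) x) (bound := fun _ => D) (s := univ) univ_mem
    (Eventually.of_forall fun x => (hf.continuous_hs_sub t x).aestronglyMeasurable)
    ((hf.continuous_hs_sub t x).intervalIntegrable _ _)
    (hf'.continuous_hs_sub t x).aestronglyMeasurable
    (ae_of_all _ fun s hs y _ => norm_hs_le (hD s ?_) _ _) intervalIntegrable_const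
    (ae_of_all _ fun s _ y _ => ?_)
  · rcases le_total 0 t with h | h
    · rw [uIoc_of_le h] at hs
      rw [abs_of_pos hs.1, abs_of_nonneg h]; exact hs.2
    · rw [uIoc_of_ge h] at hs
      rw [abs_of_nonpos hs.2, abs_of_nonpos h]; linarith [hs.1]
  · obtain ⟨C, hC⟩ := hf.bdd_at s
    obtain ⟨D, hD⟩ := hf'.bdd_at s
    exact hasFDerivAt_hs (hd s) (hf'.cont_at s) hC hD _ _

namespace Reg

theorem tame {n : ℕ} {f : ℝ → E d → F} (hf : Reg n f) : Tame f := by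
  cases n with
  | zero => exact hf
  | succ n => exact hf.1

theorem differentiable {n : ℕ} {f : ℝ → E d → F} (hf : Reg (n + 1) f) (s : ℝ) :
    Differentiable ℝ (f s) := hf.2.1 s

theorem fderiv {n : ℕ} {f : ℝ → E d → F} (hf : Reg (n + 1) f) :
    Reg n (fun s => fderiv ℝ (f s)) := hf.2.2

theorem pred {n : ℕ} {f : ℝ → E d → F} (hf : Reg (n + 1) f) : Reg n f := by
  induction n generalizing F with
  | zero => exact hf.1
  | succ n ih => exact ⟨hf.1, hf.2.1, ih hf.2.2⟩

theorem add {n : ℕ} {f g : ℝ → E d → F} (hf : Reg n f) (hg : Reg n g) :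
    Reg n (fun s x => f s x + g s x) := by
  induction n generalizing F with
  | zero => exact Tame.add hf hg
  | succ n ih =>
    refine ⟨hf.1.add hg.1, fun s => (hf.2.1 s).add (hg.2.1 s), ?_⟩
    convert ih hf.2.2 hg.2.2 using 2 with s
    ext1 x
    exact fderiv_add (hf.2.1 s x) (hg.2.1 s x)

theorem clm {n : ℕ} {f : ℝ → E d → F} (hf : Reg n f) (l : F →L[ℝ] G) :
    Reg n (fun s x => l (f s x)) := by
  induction n generalizing F G with
  | zero => exact Tame.clm hf l
  | succ n ih =>
    refine ⟨hf.1.clm l, fun s => l.differentiable.comp (hf.2.1 s), ?_⟩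
    convert ih hf.2.2 (ContinuousLinearMap.compL ℝ (E d) F G l) using 2 with s
    ext1 x
    exact (l.hasFDerivAt.comp x (hf.2.1 s x).hasFDerivAt).fderiv

theorem sub {n : ℕ} {f g : ℝ → E d → F} (hf : Reg n f) (hg : Reg n g) :
    Reg n (fun s x => f s x - g s x) := by
  simpa [sub_eq_add_neg] using hf.add (hg.clm (-ContinuousLinearMap.id ℝ F))

/-- Leibniz rule. The spaces are generalised in the induction because each derivative replaces `B`
by bilinear maps on other spaces. -/
theorem bilin {n : ℕ} {f : ℝ → E d → F} {g : ℝ → E d → G} (hf : Reg n f) (hg : Reg n g)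
    (B : F →L[ℝ] G →L[ℝ] H) : Reg n fun s x => B (f s x) (g s x) := by
  induction n generalizing F G H with
  | zero => exact Tame.bilin hf hg B
  | succ n ih =>
    refine ⟨hf.1.bilin hg.1 B, fun s => ?_, ?_⟩
    · exact fun x => (B.hasFDerivAt_of_bilinear (hf.2.1 s x).hasFDerivAt
        (hg.2.1 s x).hasFDerivAt).differentiableAt
    · have h1 := ih hf.pred hg.2.2 (B.precompR (E d))
      have h2 := ih hf.2.2 hg.pred (B.precompL (E d))
      convert h1.add h2 using 2 with s
      ext1 x
      exact B.fderiv_of_bilinear (hf.2.1 s x) (hg.2.1 s x)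

theorem comp_time {n : ℕ} {f : ℝ → E d → F} (hf : Reg n f) {φ : ℝ → ℝ} (hφ : Continuous φ) :
    Reg n (fun s => f (φ s)) := by
  induction n generalizing F with
  | zero => exact Tame.comp_time hf hφ
  | succ n ih => exact ⟨hf.1.comp_time hφ, fun s => hf.2.1 _, ih hf.2.2⟩

theorem fderiv_hs {n : ℕ} {f : ℝ → E d → F} (hf : Reg (n + 1) f) (r s : ℝ) :
    _root_.fderiv ℝ (hs r (f s)) = hs r (_root_.fderiv ℝ (f s)) := by
  obtain ⟨C, hC⟩ := hf.tame.bdd_at s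
  obtain ⟨D, hD⟩ := hf.fderiv.tame.bdd_at s
  exact YMFlow.fderiv_hs (hf.differentiable s) (hf.fderiv.tame.cont_at s) hC hD r

theorem hs {n : ℕ} {f : ℝ → E d → F} (hf : Reg n f) {ρ : ℝ → ℝ} (hρ : Continuous ρ) :
    Reg n (fun s => hs (ρ s) (f s)) := by
  induction n generalizing F with
  | zero => exact Tame.hs hf hρ
  | succ n ih =>
    refine ⟨hf.1.hs hρ, fun s x => ?_, ?_⟩
    · obtain ⟨C, hC⟩ := hf.tame.bdd_at s
      obtain ⟨D, hD⟩ := hf.fderiv.tame.bdd_at s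
      exact (hasFDerivAt_hs (hf.2.1 s) (hf.fderiv.tame.cont_at s) hC hD _ x).differentiableAt
    · simp_rw [hf.fderiv_hs]
      exact ih hf.2.2

theorem fderiv_duh {n : ℕ} {f : ℝ → E d → F} (hf : Reg (n + 1) f) (t : ℝ) :
    _root_.fderiv ℝ (duh f t) = duh (fun s => _root_.fderiv ℝ (f s)) t :=
  funext fun x => (hasFDerivAt_duh hf.tame hf.2.1 hf.fderiv.tame t x).fderiv

theorem duh {n : ℕ} {f : ℝ → E d → F} (hf : Reg n f) : Reg n (duh f) := by
  induction n generalizing F with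
  | zero => exact Tame.duh hf
  | succ n ih =>
    refine ⟨hf.1.duh, fun s x => (hasFDerivAt_duh hf.1 hf.2.1 hf.fderiv.tame s x).differentiableAt, ?_⟩
    simp_rw [hf.fderiv_duh]
    exact ih hf.2.2

theorem contDiff {n : ℕ} {f : ℝ → E d → F} (hf : Reg n f) (s : ℝ) : ContDiff ℝ n (f s) := by
  induction n generalizing F with
  | zero => exact contDiff_zero.2 (hf.tame.cont_at s)
  | succ n ih =>
    push_cast
    exact contDiff_succ_iff_fderiv.2 ⟨hf.2.1 s, by simp, ih hf.2.2⟩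

theorem tame_iteratedFDeriv {n : ℕ} {f : ℝ → E d → F} (hf : Reg n f) :
    Tame fun s => iteratedFDeriv ℝ n (f s) := by
  induction n generalizing F with
  | zero =>
    simp_rw [iteratedFDeriv_zero_eq_comp]
    exact Tame.clm hf
      (continuousMultilinearCurryFin0 ℝ (E d) F).symm.toContinuousLinearEquiv.toContinuousLinearMap
  | succ n ih =>
    have := (ih hf.2.2).clm (continuousMultilinearCurryRightEquiv' ℝ n (E d)
      F).symm.toContinuousLinearEquiv.toContinuousLinearMap
    convert this using 2 with s
    ext1 x
    rw [iteratedFDeriv_succ_eq_comp_right]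
    rfl

/-- Series and the `C^∞` topology are expressed by iterated derivatives, whereas the inductions use
the recursive form `Reg`. Currying is isometric, so continuity and bounds pass from one to the
other. -/
theorem of_iteratedFDeriv {n : ℕ} {f : ℝ → E d → F} (hf : ∀ s, ContDiff ℝ n (f s))
    (h : ∀ k ≤ n, Tame fun s => iteratedFDeriv ℝ k (f s)) : Reg n f := by
  have h0 : Tame f := (h 0 (by omega)).of_comp_eq
    (continuousMultilinearCurryFin0 ℝ (E d) F).continuous
    (continuousMultilinearCurryFin0 ℝ (E d) F).norm_map fun s x => by simp
  induction n generalizing F with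
  | zero => exact h0
  | succ n ih =>
    have h1 : ∀ k ≤ n, Tame fun s => iteratedFDeriv ℝ k (_root_.fderiv ℝ (f s)) := by
      intro k hk
      refine (h (k + 1) (by omega)).of_comp_eq
        (continuousMultilinearCurryRightEquiv' ℝ k (E d) F).continuous
        (continuousMultilinearCurryRightEquiv' ℝ k (E d) F).norm_map fun s x => ?_
      rw [iteratedFDeriv_succ_eq_comp_right]
      exact (continuousMultilinearCurryRightEquiv' ℝ k (E d) F).apply_symm_apply _
    push_cast at hf
    refine ⟨h0, fun s => (hf s).differentiable (by simp), ih (fun s => ?_) h1 ?_⟩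
    · exact (contDiff_succ_iff_fderiv.1 (hf s)).2.2
    · exact (h1 0 (by omega)).of_comp_eq
        (continuousMultilinearCurryFin0 ℝ (E d) (E d →L[ℝ] F)).continuous
        (continuousMultilinearCurryFin0 ℝ (E d) (E d →L[ℝ] F)).norm_map fun s x => by simp

end Reg

end Paths

/-! ### The time derivative of the heat semigroup along a path. -/

section HeatEquation

variable {d : ℕ} {F : Type u} [NormedAddCommGroup F] [NormedSpace ℝ F]

/-- The trace of a second derivative. -/
def lapL (d : ℕ) (F : Type u) [NormedAddCommGroup F] [NormedSpace ℝ F] :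
    (E d →L[ℝ] E d →L[ℝ] F) →L[ℝ] F :=
  ∑ i : Fin d, (ContinuousLinearMap.apply ℝ F (EuclideanSpace.single i (1 : ℝ))).comp
    (ContinuousLinearMap.apply ℝ (E d →L[ℝ] F) (EuclideanSpace.single i (1 : ℝ)))

/-- The Laplacian as the trace of the second derivative. -/
def lap (f : E d → F) (x : E d) : F := lapL d F (fderiv ℝ (fderiv ℝ f) x)

theorem lapL_apply (T : E d →L[ℝ] E d →L[ℝ] F) :
    lapL d F T = ∑ i, T (EuclideanSpace.single i 1) (EuclideanSpace.single i 1) := by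
  simp [lapL]

theorem laplacian_eq_lap (f : E d → F) : Laplacian.laplacian f = lap f := by
  rw [InnerProductSpace.laplacian_eq_iteratedFDeriv_orthonormalBasis f
    (EuclideanSpace.basisFun (Fin d) ℝ)]
  ext1 x
  rw [lap, lapL_apply]
  simp [iteratedFDeriv_two_apply]

theorem Reg.lap {n : ℕ} {f : ℝ → E d → F} (hf : Reg (n + 2) f) :
    Reg n (fun s => lap (f s)) :=
  hf.fderiv.fderiv.clm (lapL d F)

variable [CompleteSpace F]

/-- Expand `z` in the standard basis and integrate each coordinate by parts. This turns the
first-order term produced by differentiating `√(t - s)` into a Laplacian. -/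
theorem integral_heatKernel_fderiv_self {φ : E d → E d →L[ℝ] F} (hφ : Differentiable ℝ φ)
    (hφ' : Continuous (fderiv ℝ φ)) {C D : ℝ} (hC : ∀ x, ‖φ x‖ ≤ C)
    (hD : ∀ x, ‖fderiv ℝ φ x‖ ≤ D) :
    ∫ z, heatKernel d 1 z • φ z z = ∫ z, heatKernel d 1 z • (2 : ℝ) • lapL d F (fderiv ℝ φ z) := by
  have hC0 : 0 ≤ C := (norm_nonneg _).trans (hC 0)
  let e : Fin d → E d := fun i => EuclideanSpace.single i 1
  have hz : ∀ z : E d, z = ∑ i, z i • e i := by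
    intro z
    have := (EuclideanSpace.basisFun (Fin d) ℝ).sum_repr z
    simpa [e] using this.symm
  have h1 : ∀ z, heatKernel d 1 z • φ z z
      = ∑ i, (2 : ℝ) • (heatKernel d 1 z * (inner ℝ z (e i) / 2)) • φ z (e i) := by
    intro z
    have h0 := congrArg (φ z) (hz z)
    rw [map_sum] at h0
    rw [h0, Finset.smul_sum]
    refine Finset.sum_congr rfl fun i _ => ?_
    rw [map_smul, smul_smul, smul_smul]
    congr 1
    simp [e, EuclideanSpace.inner_single_right]
    ring
  have hle : ∀ i, ‖e i‖ ≤ 1 := fun i => by simp [e]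
  have hi : ∀ i, Integrable fun z => (heatKernel d 1 z * (inner ℝ z (e i) / 2)) • φ z (e i) :=
    fun i => integrable_heatKernel_inner_smul (f := fun z => φ z (e i)) (C := C)
      (hφ.continuous.clm_apply continuous_const)
      (fun z => ((φ z).le_opNorm _).trans ((mul_le_mul (hC z) (hle i) (norm_nonneg _) hC0).trans
        (mul_one C).le)) _
  have hf : ∀ i z, HasFDerivAt (fun z => φ z (e i))
      ((ContinuousLinearMap.apply ℝ F (e i)).comp (fderiv ℝ φ z)) z := fun i z =>
    (ContinuousLinearMap.apply ℝ F (e i)).hasFDerivAt.comp z (hφ z).hasFDerivAt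
  have hD0 : 0 ≤ D := (norm_nonneg (fderiv ℝ φ 0)).trans (hD 0)
  have hbd : ∀ i z, ‖fderiv ℝ φ z (e i) (e i)‖ ≤ D := fun i z =>
    (ContinuousLinearMap.le_opNorm₂ _ _ _).trans (by
      have h1 := hD z; have h2 := hle i; have := norm_nonneg (e i)
      calc _ ≤ D * 1 * 1 := by gcongr
        _ = D := by ring)
  have hi2 : ∀ i, Integrable fun z => heatKernel d 1 z • fderiv ℝ φ z (e i) (e i) := fun i =>
    integrable_heatKernel_smul (f := fun z => fderiv ℝ φ z (e i) (e i))
      ((hφ'.clm_apply continuous_const).clm_apply continuous_const) (hbd i)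
  have h2 : ∀ i, ∫ z, (heatKernel d 1 z * (inner ℝ z (e i) / 2)) • φ z (e i)
      = ∫ z, heatKernel d 1 z • fderiv ℝ φ z (e i) (e i) := by
    intro i
    have hfd : fderiv ℝ (fun z => φ z (e i))
        = fun z => (ContinuousLinearMap.apply ℝ F (e i)).comp (fderiv ℝ φ z) :=
      funext fun z => (hf i z).fderiv
    rw [← integral_heatKernel_fderiv (f := fun z => φ z (e i)) (C := C)
      (D := ‖ContinuousLinearMap.apply ℝ F (e i)‖ * D)
      (fun z => (hf i z).differentiableAt) (by rw [hfd]; fun_prop)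
      (fun z => ((φ z).le_opNorm _).trans ((mul_le_mul (hC z) (hle i) (norm_nonneg _) hC0).trans
        (mul_one C).le))
      (fun z => by
        rw [hfd]
        exact (ContinuousLinearMap.opNorm_comp_le _ _).trans (by gcongr; exact hD z)) (e i), hfd]
    rfl
  simp_rw [h1, lapL_apply, Finset.smul_sum]
  have hi' : ∀ i ∈ Finset.univ, Integrable
      fun z => (2 : ℝ) • (heatKernel d 1 z * (inner ℝ z (e i) / 2)) • φ z (e i) :=
    fun i _ => (hi i).smul (2 : ℝ)
  rw [integral_finsetSum _ hi', integral_finsetSum]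
  · refine Finset.sum_congr rfl fun i _ => ?_
    rw [integral_smul, h2, ← integral_smul]
    congr 1; ext1 z
    rw [smul_comm]
  · intro i _
    have := (hi2 i).smul (2 : ℝ)
    refine this.congr (ae_of_all _ fun z => ?_)
    simp only [Pi.smul_apply]
    rw [smul_comm]

/-- This is `∂_s (P_{t-s} u_s) = P_{t-s} (∂_s u - Δu)`, the source of Duhamel's formula.
Differentiation under the integral gives `Du · z / (2√(t-s))`, and Gaussian integration by parts
converts this into `-Δu`. -/
theorem hasDerivAt_hs_sub {u ut : ℝ → E d → F} (hu : Reg 2 u) (hut : Tame ut) {a b : ℝ}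
    (h : ∀ s ∈ Ioo a b, ∀ x, HasDerivAt (fun r => u r x) (ut s x) s) {t : ℝ} (x : E d) {s₀ : ℝ}
    (hs₀ : s₀ ∈ Ioo a b) (ht : s₀ < t) :
    HasDerivAt (fun s => hs (t - s) (u s) x) (hs (t - s₀) (fun y => ut s₀ y - lap (u s₀) y) x) s₀ := by
  -- Within `ρ` of `s₀` one has `t - s > ρ`, so the factor `1 / √(t - s)` stays bounded.
  set ρ := (t - s₀) / 2 with hρ
  have hρ0 : 0 < ρ := by rw [hρ]; linarith
  obtain ⟨C, hC⟩ := hut.bdd (|s₀| + ρ)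
  obtain ⟨D, hD⟩ := hu.fderiv.tame.bdd (|s₀| + ρ)
  let S : Set ℝ := Ioo a b ∩ Metric.ball s₀ ρ
  have hS : S ∈ 𝓝 s₀ := inter_mem (isOpen_Ioo.mem_nhds hs₀) (Metric.ball_mem_nhds _ hρ0)
  have hS1 : ∀ s ∈ S, ρ < t - s ∧ |s| ≤ |s₀| + ρ := by
    intro s hs
    have h1 := hs.2
    rw [Metric.mem_ball, Real.dist_eq] at h1
    refine ⟨by have := (abs_lt.1 h1).2; linarith, ?_⟩
    have : |s| = |s₀ + (s - s₀)| := by congr 1; ring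
    rw [this]
    exact (abs_add_le _ _).trans (by linarith)
  let Y : ℝ → E d → E d := fun s z => x - √(t - s) • z
  let w : ℝ → E d → F := fun s z =>
    heatKernel d 1 z • (ut s (Y s z) + (1 / (2 * √(t - s))) • fderiv ℝ (u s) (Y s z) z)
  have hder : ∀ s ∈ S, ∀ z, HasDerivAt (fun s => heatKernel d 1 z • u s (Y s z)) (w s z) s := by
    intro s hs z
    have hts : 0 < t - s := hρ0.trans (hS1 s hs).1
    have h1 : HasStrictFDerivAt (fun p : ℝ × E d => u p.1 p.2)
        ((ContinuousLinearMap.toSpanSingleton ℝ (ut s (Y s z))).coprod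
          (fderiv ℝ (u s) (Y s z))) (s, Y s z) := by
      refine hasStrictFDerivAt_uncurry_coprod (𝕜 := ℝ) (E₁ := ℝ) (E₂ := E d) (F := F)
        (u := (s, Y s z)) (f := u)
        (f₁ := fun r y => ContinuousLinearMap.toSpanSingleton ℝ (ut r y))
        (f₂ := fun r y => fderiv ℝ (u r) y) ?_ ?_ ?_ ?_
      · have : ∀ᶠ v : ℝ × E d in 𝓝 (s, Y s z), v.1 ∈ Ioo a b :=
          continuous_fst.continuousAt.eventually (isOpen_Ioo.mem_nhds hs.1)
        exact this.mono fun v hv => (h v.1 hv v.2).hasFDerivAt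
      · exact Eventually.of_forall fun v => (hu.differentiable v.1 v.2).hasFDerivAt
      · have h1 : Continuous fun p : ℝ × E d => ut p.1 p.2 := hut.cont
        have h2 := (ContinuousLinearMap.toSpanSingletonCLE (𝕜 := ℝ) (E := F)).continuous.comp h1
        exact h2.continuousAt
      · exact hu.fderiv.tame.cont.continuousAt
    have h2 : HasDerivAt (fun s => (s, Y s z)) ((1 : ℝ), (1 / (2 * √(t - s))) • z) s := by
      refine (hasDerivAt_id s).prodMk ?_
      have h3 : HasDerivAt (fun s => √(t - s)) (-1 / (2 * √(t - s))) s :=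
        ((hasDerivAt_id s).const_sub t).sqrt hts.ne'
      have h4 := (h3.smul_const z).const_sub x
      refine h4.congr_deriv ?_
      rw [← neg_smul]; congr 1; ring
    have h5 := (h1.hasFDerivAt.comp_hasDerivAt s h2).const_smul (heatKernel d 1 z)
    refine h5.congr_deriv ?_
    simp [w]
  have hcY : ∀ s, Continuous (Y s) := fun s => by fun_prop
  have hwc : ∀ s, Continuous (w s) := by
    intro s
    have h1 := (hut.cont_at s).comp (hcY s)
    have h2 := (hu.fderiv.tame.cont_at s).comp (hcY s)
    exact (heatKernel_continuous 1).smul (h1.add ((h2.clm_apply continuous_id).const_smul _))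
  obtain ⟨K, hK⟩ := hu.tame.bdd_at s₀
  have hmain := (hasDerivAt_integral_of_dominated_loc_of_deriv_le (𝕜 := ℝ) (μ := volume)
    (F := fun s z => heatKernel d 1 z • u s (Y s z)) (F' := w) (x₀ := s₀) (s := S)
    (bound := fun z => heatKernel d 1 z * C + heatKernel d 1 z * ‖z‖ * (1 / (2 * √ρ) * D))
    hS ?_ ?_ (hwc s₀).aestronglyMeasurable ?_ ?_ (ae_of_all _ fun z s hs => hder s hs z)).2
  · refine hmain.congr_deriv ?_
    have hts : 0 < t - s₀ := by linarith
    set q := √(t - s₀) with hq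
    have hq0 : 0 < q := Real.sqrt_pos.2 hts
    obtain ⟨C', hC'⟩ := hut.bdd_at s₀
    obtain ⟨D', hD'⟩ := hu.fderiv.tame.bdd_at s₀
    obtain ⟨D2, hD2⟩ := hu.fderiv.fderiv.tame.bdd_at s₀
    have hD0 : 0 ≤ D' := (norm_nonneg _).trans (hD' 0)
    have hYd : ∀ z, HasFDerivAt (Y s₀) (-(q • ContinuousLinearMap.id ℝ (E d))) z := fun z =>
      ((hasFDerivAt_id z).const_smul q).const_sub x
    have hφd : ∀ z, HasFDerivAt (fun z => fderiv ℝ (u s₀) (Y s₀ z))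
        ((-q) • fderiv ℝ (fderiv ℝ (u s₀)) (Y s₀ z)) z := by
      intro z
      have h1 : HasFDerivAt (fderiv ℝ (u s₀)) (fderiv ℝ (fderiv ℝ (u s₀)) (Y s₀ z)) (Y s₀ z) :=
        (hu.fderiv.differentiable s₀ _).hasFDerivAt
      refine (h1.comp z (hYd z)).congr_fderiv ?_
      ext v; simp
    have hφd' : fderiv ℝ (fun z => fderiv ℝ (u s₀) (Y s₀ z))
        = fun z => (-q) • fderiv ℝ (fderiv ℝ (u s₀)) (Y s₀ z) := funext fun z => (hφd z).fderiv
    -- The inner derivative of `Y s₀` contributes `-q`, which cancels `1 / (2q)` and the factor `2`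
    -- up to sign and leaves `-Δu`.
    have hIBP := integral_heatKernel_fderiv_self (φ := fun z => fderiv ℝ (u s₀) (Y s₀ z))
      (fun z => (hφd z).differentiableAt)
      (by
        rw [hφd']
        have h1 := (hu.fderiv.fderiv.tame.cont_at s₀).comp (hcY s₀)
        exact (continuous_const (y := -q)).smul h1)
      (fun z => hD' _) (D := q * D2)
      (fun z => by
        rw [hφd']
        have h1 := norm_smul (-q) (fderiv ℝ (fderiv ℝ (u s₀)) (Y s₀ z))
        rw [norm_neg, Real.norm_of_nonneg hq0.le] at h1
        exact h1.le.trans (mul_le_mul_of_nonneg_left (hD2 _) hq0.le))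
    have hlap : Tame fun s => lap (u s) := hu.lap (n := 0)
    obtain ⟨D3, hD3⟩ := hlap.bdd_at s₀
    have i1 : Integrable fun z => heatKernel d 1 z • ut s₀ (Y s₀ z) :=
      integrable_hs (hut.cont_at s₀) hC' _ _
    have i2 : Integrable fun z => heatKernel d 1 z • fderiv ℝ (u s₀) (Y s₀ z) z := by
      refine (integrable_heatKernel_mul_norm.mul_const D').mono'
        ((heatKernel_continuous 1).smul (((hu.fderiv.tame.cont_at s₀).comp (hcY s₀)).clm_apply
          continuous_id)).aestronglyMeasurable (ae_of_all _ fun z => ?_)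
      have h := heatKernel_nonneg (d := d) one_pos z
      rw [norm_smul, Real.norm_of_nonneg h, mul_assoc, mul_comm ‖z‖]
      gcongr
      exact (ContinuousLinearMap.le_opNorm _ _).trans (by gcongr; exact hD' _)
    rw [hs_sub (hut.cont_at s₀) (hlap.cont_at s₀) hC' hD3]
    have e1 : (fun z => w s₀ z) = fun z => heatKernel d 1 z • ut s₀ (Y s₀ z)
        + (1 / (2 * q)) • (heatKernel d 1 z • fderiv ℝ (u s₀) (Y s₀ z) z) := by
      ext1 z
      simp only [w]
      rw [smul_add, smul_comm (1 / (2 * q)), hq]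
    have i3 : Integrable fun z =>
        (1 / (2 * q)) • (heatKernel d 1 z • fderiv ℝ (u s₀) (Y s₀ z) z) := i2.smul (1 / (2 * q))
    rw [e1, integral_add i1 i3, integral_smul, hIBP, hφd', sub_eq_add_neg, hs, hs]
    congr 1
    rw [← integral_smul, ← integral_neg]
    congr 1; ext1 z
    rw [map_smul, smul_smul, smul_smul, smul_smul, ← neg_smul]
    simp only [lap, Y, ← hq]
    congr 1
    field_simp
  · refine Eventually.of_forall fun s => ?_
    exact ((heatKernel_continuous 1).smul ((hu.tame.cont_at s).comp (hcY s))).aestronglyMeasurable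
  · exact integrable_hs (hu.tame.cont_at s₀) hK _ _
  · refine ae_of_all _ fun z s hs => ?_
    obtain ⟨h1, h2⟩ := hS1 s hs
    have hg := heatKernel_nonneg (d := d) one_pos z
    have h3 : √ρ ≤ √(t - s) := Real.sqrt_le_sqrt h1.le
    have h4 : 0 < √ρ := Real.sqrt_pos.2 hρ0
    have hD0 : 0 ≤ D := (norm_nonneg _).trans (hD s h2 0)
    simp only [w]
    rw [norm_smul, Real.norm_of_nonneg hg, mul_assoc, ← mul_add]
    gcongr
    refine (norm_add_le _ _).trans (add_le_add (hC s h2 _) ?_)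
    rw [norm_smul, Real.norm_of_nonneg (by positivity)]
    calc _ ≤ 1 / (2 * √ρ) * (D * ‖z‖) := by
          gcongr
          exact (ContinuousLinearMap.le_opNorm _ _).trans (by gcongr; exact hD s h2 _)
      _ = _ := by ring
  · exact ((heatKernel_integrable one_pos).mul_const _).add
      (integrable_heatKernel_mul_norm.mul_const _)

theorem integral_hs_sub {u ut : ℝ → E d → F} (hu : Reg 2 u) (hut : Tame ut) {a b t : ℝ}
    (hab : a ≤ b) (hbt : b ≤ t)
    (h : ∀ s ∈ Ioo a b, ∀ x, HasDerivAt (fun r => u r x) (ut s x) s) (x : E d) :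
    ∫ s in a..b, hs (t - s) (fun y => ut s y - lap (u s) y) x
      = hs (t - b) (u b) x - hs (t - a) (u a) x := by
  have hlap : Tame fun s => lap (u s) := hu.lap (n := 0)
  have hd : Tame fun s y => ut s y - lap (u s) y := Reg.sub (n := 0) hut hlap
  exact intervalIntegral.integral_eq_sub_of_hasDerivAt_of_le hab
    (hu.tame.continuous_hs_sub t x).continuousOn
    (fun s hs => hasDerivAt_hs_sub hu hut h x hs (hs.2.trans_le hbt))
    ((hd.continuous_hs_sub t x).intervalIntegrable _ _)

end HeatEquation

/-! ### Equivalence of mild and classical solutions. -/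

section Duhamel

variable {d : ℕ} {F : Type u} [NormedAddCommGroup F] [NormedSpace ℝ F] [CompleteSpace F]

/-- Fubini on the triangle `s < ρ`: both iterated integrals are integrals over the square of `G` cut
off by an indicator. -/
theorem integral_integral_triangle {G : ℝ → ℝ → F}
    (hG : Continuous fun p : ℝ × ℝ => G p.1 p.2) {t : ℝ} (ht : 0 ≤ t) :
    ∫ s in (0 : ℝ)..t, ∫ ρ in s..t, G ρ s = ∫ ρ in (0 : ℝ)..t, ∫ s in (0 : ℝ)..ρ, G ρ s := by
  let K : ℝ → ℝ → F := fun s ρ => if s < ρ then G ρ s else 0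
  have h1 : ∀ s ∈ uIcc 0 t, ∫ ρ in s..t, G ρ s = ∫ ρ in (0 : ℝ)..t, K s ρ := by
    intro s hs
    rw [uIcc_of_le ht] at hs
    rw [intervalIntegral.integral_of_le hs.2, intervalIntegral.integral_of_le ht]
    have e : (fun ρ => K s ρ) = (Ioi s).indicator fun ρ => G ρ s := by
      ext ρ; simp [K, indicator]
    rw [e, setIntegral_indicator measurableSet_Ioi]
    congr 2
    ext ρ; simp only [mem_Ioc, mem_inter_iff, mem_Ioi]
    constructor
    · rintro ⟨a, b⟩; exact ⟨⟨hs.1.trans_lt a, b⟩, a⟩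
    · rintro ⟨⟨_, b⟩, c⟩; exact ⟨c, b⟩
  have h2 : ∀ ρ ∈ uIcc 0 t, ∫ s in (0 : ℝ)..ρ, G ρ s = ∫ s in (0 : ℝ)..t, K s ρ := by
    intro ρ hs
    rw [uIcc_of_le ht] at hs
    rw [intervalIntegral.integral_of_le hs.1, intervalIntegral.integral_of_le ht]
    have e : (fun s => K s ρ) = (Iio ρ).indicator fun s => G ρ s := by
      ext s; simp [K, indicator]
    rw [e, setIntegral_indicator measurableSet_Iio, integral_Ioc_eq_integral_Ioo]
    congr 2
    ext s; simp only [mem_Ioc, mem_Ioo, mem_inter_iff, mem_Iio]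
    constructor
    · rintro ⟨a, b⟩; exact ⟨⟨a, b.le.trans hs.2⟩, b⟩
    · rintro ⟨⟨a, _⟩, c⟩; exact ⟨a, c⟩
  rw [intervalIntegral.integral_congr h1, intervalIntegral.integral_congr h2]
  refine intervalIntegral_intervalIntegral_swap ?_
  have e : Function.uncurry K = {p : ℝ × ℝ | p.1 < p.2}.indicator fun p => G p.2 p.1 := by
    ext p; simp [K, indicator, Function.uncurry]
  rw [e]
  refine IntegrableOn.indicator ?_ (measurableSet_lt measurable_fst measurable_snd)
  have hc : Continuous fun p : ℝ × ℝ => G p.2 p.1 := hG.comp continuous_swap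
  refine (hc.continuousOn.integrableOn_compact
    (isCompact_Icc.prod isCompact_Icc : IsCompact (Icc 0 t ×ˢ Icc 0 t))).mono_set ?_
  rw [uIoc_of_le ht]
  exact prod_mono Ioc_subset_Icc_self Ioc_subset_Icc_self

/-- Duhamel's formula for classical solutions of the inhomogeneous heat equation. -/
theorem eq_hs_add_duh {u f : ℝ → E d → F} (hu : Reg 2 u) (hf : Tame f) {T : ℝ}
    (h : ∀ s ∈ Ioo 0 T, ∀ x, HasDerivAt (fun r => u r x) (lap (u s) x + f s x) s) {t : ℝ}
    (ht : t ∈ Icc 0 T) (x : E d) : u t x = hs t (u 0) x + duh f t x := by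
  have hut : Tame fun s x => lap (u s) x + f s x := Reg.add (n := 0) (hu.lap (n := 0)) hf
  -- The source is `∂_s u - Δu`, so its Duhamel integral is the increment of `s ↦ P_{t-s} u_s` over
  -- `[0, t]`.
  have h1 := integral_hs_sub hu hut ht.1 le_rfl
    (fun s hs x => h s ⟨hs.1, hs.2.trans_le ht.2⟩ x) x
  simp only [add_sub_cancel_left, sub_self, sub_zero, hs_of_nonpos le_rfl] at h1
  rw [duh, h1]; abel

theorem hs_eq_add_integral {f : E d → F} (hf : Reg 2 fun _ => f) {r : ℝ} (hr : 0 ≤ r) (x : E d) :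
    hs r f x = f x + ∫ s in (0 : ℝ)..r, hs s (lap f) x := by
  have h0 : Tame (fun (_ : ℝ) (_ : E d) => (0 : F)) :=
    ⟨continuous_const, fun _ => ⟨0, fun _ _ _ => by simp⟩⟩
  have h1 := integral_hs_sub hf h0 hr le_rfl (fun s _ x => hasDerivAt_const s _) x
  have e : ∀ s y, hs s (fun y => 0 - lap f y) y = - hs s (lap f) y := by
    intro s y
    simp only [hs, zero_sub, smul_neg, integral_neg]
  simp only [e, intervalIntegral.integral_neg, sub_self, sub_zero, hs_of_nonpos le_rfl] at h1
  rw [intervalIntegral.integral_comp_sub_left (fun s => hs s (lap f) x), sub_self, sub_zero] at h1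
  rw [neg_eq_iff_eq_neg.1 h1]
  abel

theorem lap_hs {f : ℝ → E d → F} (hf : Reg 2 f) (r s : ℝ) : lap (hs r (f s)) = hs r (lap (f s)) := by
  ext1 x
  obtain ⟨C, hC⟩ := hf.fderiv.fderiv.tame.bdd_at s
  rw [lap, hf.fderiv_hs, hf.fderiv.fderiv_hs, ← hs_clm _ (hf.fderiv.fderiv.tame.cont_at s) hC]
  rfl

theorem lap_duh {f : ℝ → E d → F} (hf : Reg 2 f) (t : ℝ) :
    lap (duh f t) = duh (fun s => lap (f s)) t := by
  ext1 x
  rw [lap, hf.fderiv_duh, hf.fderiv.fderiv_duh, duh,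
    ← (lapL d F).intervalIntegral_comp_comm
      ((hf.fderiv.fderiv.tame.continuous_hs_sub t x).intervalIntegrable _ _)]
  refine intervalIntegral.integral_congr fun s _ => ?_
  obtain ⟨C, hC⟩ := hf.fderiv.fderiv.tame.bdd_at s
  exact (hs_clm _ (hf.fderiv.fderiv.tame.cont_at s) hC _ _).symm

theorem Tame.continuous_hs {f : E d → F} (hf : Tame fun _ : ℝ => f) (x : E d) :
    Continuous fun s => YMFlow.hs s f x :=
  (hf.hs continuous_id).cont.comp (continuous_id.prodMk continuous_const)

theorem hasDerivAt_hs {f : E d → F} (hf : Reg 2 fun _ => f) {r : ℝ} (hr : 0 < r) (x : E d) :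
    HasDerivAt (fun r => hs r f x) (lap (hs r f) x) r := by
  have hl : Tame fun _ : ℝ => lap f := hf.lap (n := 0)
  have h1 := ((hl.continuous_hs x).integral_hasStrictDerivAt 0 r).hasDerivAt.const_add (f x)
  rw [lap_hs hf r 0]
  refine h1.congr_of_eventuallyEq ?_
  filter_upwards [lt_mem_nhds hr] with s hs
  exact hs_eq_add_integral hf hs.le x

/-- Semigroup law by uniqueness: `σ ↦ P_{σ+s} f` solves the homogeneous heat equation, so Duhamel's
formula represents it by its value at `σ = 0`. -/
theorem hs_hs {f : E d → F} (hf : Reg 2 fun _ => f) {r s : ℝ} (hr : 0 ≤ r) (hs0 : 0 ≤ s)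
    (x : E d) : hs r (hs s f) x = hs (r + s) f x := by
  have h0 : Tame (fun (_ : ℝ) (_ : E d) => (0 : F)) :=
    ⟨continuous_const, fun _ => ⟨0, fun _ _ _ => by simp⟩⟩
  have hu : Reg 2 fun σ => hs (σ + s) f := hf.hs (by fun_prop)
  have h := eq_hs_add_duh hu h0 (T := r) (fun σ hσ x => by
    have h1 := hasDerivAt_hs hf (r := σ + s) (by linarith [hσ.1]) x
    rw [add_zero]
    exact h1.comp_add_const σ s) (right_mem_Icc.2 hr) x
  rw [h]
  simp [duh, hs]

/-- Insert `P_{t-s} f_s = f_s + ∫ P_{ρ-s} Δf_s dρ` and exchange the integrals. The result is a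
primitive of a continuous function, so it can be differentiated in `t` even at the endpoints. -/
theorem duh_eq_integral {f : ℝ → E d → F} (hf : Reg 2 f) {t : ℝ} (ht : 0 ≤ t) (x : E d) :
    duh f t x = ∫ s in (0 : ℝ)..t, (f s x + duh (fun s => lap (f s)) s x) := by
  have hl : Tame fun s => lap (f s) := hf.lap (n := 0)
  have hG : Continuous fun p : ℝ × ℝ => hs (p.1 - p.2) (lap (f p.2)) x := by
    have : Continuous fun p : ℝ × ℝ => ((p.1, x), p.2) := by fun_prop
    exact hl.continuous_duh_integrand.comp this
  have h1 : ∀ s ∈ uIcc 0 t, hs (t - s) (f s) x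
      = f s x + ∫ ρ in s..t, hs (ρ - s) (lap (f s)) x := by
    intro s hs'
    rw [uIcc_of_le ht] at hs'
    rw [hs_eq_add_integral (hf.comp_time (φ := fun _ => s) continuous_const)
      (sub_nonneg.2 hs'.2) x, intervalIntegral.integral_comp_sub_right
        (fun ρ => hs ρ (lap (f s)) x), sub_self]
  have hc : Continuous fun s => f s x := hf.tame.cont.comp (continuous_id.prodMk continuous_const)
  have hc2 : Continuous fun s => ∫ ρ in s..t, hs (ρ - s) (lap (f s)) x := by
    simp_rw [fun s => intervalIntegral.integral_symm (f := fun ρ => hs (ρ - s) (lap (f s)) x)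
      (μ := volume) t s]
    refine (intervalIntegral.continuous_parametric_intervalIntegral_of_continuous
      (f := fun s ρ => hs (ρ - s) (lap (f s)) x) (hG.comp continuous_swap) continuous_id).neg
  have hc3 : Continuous fun s => duh (fun s => lap (f s)) s x :=
    hl.duh.cont.comp (continuous_id.prodMk continuous_const)
  rw [duh, intervalIntegral.integral_congr h1, intervalIntegral.integral_add
    (hc.intervalIntegrable _ _) (hc2.intervalIntegrable _ _), intervalIntegral.integral_add
    (hc.intervalIntegrable _ _) (hc3.intervalIntegrable _ _), integral_integral_triangle hG ht]
  rfl

/-- Mild solutions of the inhomogeneous heat equation are classical solutions. -/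
theorem hasDerivWithinAt_hs_add_duh {a : E d → F} {f : ℝ → E d → F} (ha : Reg 2 fun _ => a)
    (hf : Reg 2 f) {t T : ℝ} (ht : t ∈ Icc 0 T) (x : E d) :
    HasDerivWithinAt (fun r => hs r a x + duh f r x)
      (lap (fun y => hs t a y + duh f t y) x + f t x) (Icc 0 T) t := by
  have hla : Tame fun _ : ℝ => lap a := ha.lap (n := 0)
  have hlf : Tame fun s => lap (f s) := hf.lap (n := 0)
  have hc : Continuous fun s => hs s (lap a) x + (f s x + duh (fun s => lap (f s)) s x) :=
    (hla.continuous_hs x).add ((hf.tame.cont.comp (continuous_id.prodMk continuous_const)).add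
      (hlf.duh.cont.comp (continuous_id.prodMk continuous_const)))
  have h1 := (hc.integral_hasStrictDerivAt 0 t).hasDerivAt.const_add (a x)
  have e : lap (fun y => hs t a y + duh f t y) x = lap (hs t a) x + lap (duh f t) x := by
    have r1 : Reg 2 fun _ : ℝ => hs t a := ha.hs (ρ := fun _ => t) continuous_const
    have r2 : Reg 2 fun _ : ℝ => duh f t := hf.duh.comp_time (φ := fun _ => t) continuous_const
    have e1 : fderiv ℝ (fun y => hs t a y + duh f t y)
        = fun y => fderiv ℝ (hs t a) y + fderiv ℝ (duh f t) y := funext fun y =>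
      fderiv_add (r1.differentiable 0 y) (r2.differentiable 0 y)
    rw [lap, e1]
    have e2 := fderiv_add (r1.fderiv.differentiable 0 x) (r2.fderiv.differentiable 0 x)
    rw [lap, lap, ← map_add]
    exact congrArg _ e2
  rw [e, lap_hs ha t 0, lap_duh hf t]
  refine (h1.hasDerivWithinAt.congr_of_mem (fun s hs' => ?_) ht).congr_deriv (by abel)
  have hc1 := hla.continuous_hs x
  have hc2 : Continuous fun s => f s x + duh (fun s => lap (f s)) s x :=
    (hf.tame.cont.comp (continuous_id.prodMk continuous_const)).add
      (hlf.duh.cont.comp (continuous_id.prodMk continuous_const))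
  rw [hs_eq_add_integral ha hs'.1, duh_eq_integral hf hs'.1, intervalIntegral.integral_add
    (hc1.intervalIntegrable _ _) (hc2.intervalIntegrable _ _)]
  abel

end Duhamel

/-! ### Beta integrals and exponential weights in time. -/

section SingularKernels

/-- Euler's beta integral `∫₀¹ (1-s)^{-p} s^{-q} ds`. -/
def betaC (p q : ℝ) : ℝ := ∫ s in (0 : ℝ)..1, (1 - s) ^ (-p) * s ^ (-q)

theorem betaC_nonneg (p q : ℝ) : 0 ≤ betaC p q :=
  intervalIntegral.integral_nonneg zero_le_one fun _ hs =>
    mul_nonneg (Real.rpow_nonneg (sub_nonneg.2 hs.2) _) (Real.rpow_nonneg hs.1 _)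

variable {p q : ℝ}

theorem intervalIntegrable_beta_one (hp : p < 1) (hq : q < 1) :
    IntervalIntegrable (fun s : ℝ => (1 - s) ^ (-p) * s ^ (-q)) volume 0 1 := by
  have h := (Complex.betaIntegral_convergent (u := ((1 - q : ℝ) : ℂ)) (v := ((1 - p : ℝ) : ℂ))
    (by simpa using hq) (by simpa using hp)).norm
  rw [intervalIntegrable_iff_integrableOn_Ioo_of_le zero_le_one] at h ⊢
  refine h.congr_fun (fun s hs => ?_) measurableSet_Ioo
  have h1 : (1 : ℂ) - (s : ℂ) = ((1 - s : ℝ) : ℂ) := by push_cast; ring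
  simp only [norm_mul]
  rw [h1, Complex.norm_cpow_eq_rpow_re_of_pos hs.1,
    Complex.norm_cpow_eq_rpow_re_of_pos (sub_pos.2 hs.2), mul_comm]
  simp

theorem intervalIntegrable_beta (hp : p < 1) (hq : q < 1) {t : ℝ} (ht : 0 < t) :
    IntervalIntegrable (fun s : ℝ => (t - s) ^ (-p) * s ^ (-q)) volume 0 t := by
  have h := ((intervalIntegrable_beta_one hp hq).comp_mul_left (c := t⁻¹)).const_mul
    (t ^ (-p) * t ^ (-q))
  simp only [zero_div, one_div, inv_inv] at h
  rw [intervalIntegrable_iff_integrableOn_Ioo_of_le ht.le] at h ⊢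
  refine h.congr_fun (fun s hs => ?_) measurableSet_Ioo
  have h1 : 0 ≤ 1 - t⁻¹ * s := by
    rw [sub_nonneg, inv_mul_le_iff₀ ht, mul_one]; exact hs.2.le
  have h2 : 0 ≤ t⁻¹ * s := mul_nonneg (inv_nonneg.2 ht.le) hs.1.le
  calc _ = (t ^ (-p) * (1 - t⁻¹ * s) ^ (-p)) * (t ^ (-q) * (t⁻¹ * s) ^ (-q)) := by ring
    _ = _ := by
      rw [← Real.mul_rpow ht.le h1, ← Real.mul_rpow ht.le h2]
      congr 2 <;> field_simp

theorem integral_beta {t : ℝ} (ht : 0 < t) :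
    ∫ s in (0 : ℝ)..t, (t - s) ^ (-p) * s ^ (-q) = t ^ (1 - p - q) * betaC p q := by
  have h := intervalIntegral.integral_comp_mul_left (a := 0) (b := 1)
    (fun s : ℝ => (t - s) ^ (-p) * s ^ (-q)) ht.ne'
  rw [mul_zero, mul_one, smul_eq_mul] at h
  rw [← mul_right_injective₀ (inv_ne_zero ht.ne') |>.eq_iff]
  rw [← h, betaC, ← mul_assoc, ← intervalIntegral.integral_const_mul]
  refine intervalIntegral.integral_congr fun s hs => ?_
  rw [uIcc_of_le zero_le_one] at hs
  have e : t - t * s = t * (1 - s) := by ring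
  rw [e, Real.mul_rpow ht.le (sub_nonneg.2 hs.2), Real.mul_rpow ht.le hs.1]
  have e2 : t⁻¹ * t ^ (1 - p - q) = t ^ (-p) * t ^ (-q) := by
    rw [← Real.rpow_neg_one, ← Real.rpow_add ht, ← Real.rpow_add ht]
    congr 1; ring
  rw [e2]; ring

theorem exp_neg_le_rpow_neg {x θ : ℝ} (hx : 0 < x) (hθ0 : 0 ≤ θ) (hθ1 : θ ≤ 1) :
    Real.exp (-x) ≤ x ^ (-θ) := by
  rw [Real.exp_neg, Real.rpow_neg hx.le]
  refine inv_anti₀ (Real.rpow_pos_of_pos hx _) ?_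
  rcases le_total x 1 with h | h
  · exact (Real.rpow_le_one hx.le h hθ0).trans (Real.one_le_exp hx.le)
  · calc x ^ θ ≤ x ^ (1 : ℝ) := Real.rpow_le_rpow_of_exponent_le h hθ1
      _ = x := Real.rpow_one x
      _ ≤ _ := by linarith [Real.add_one_le_exp x]

/-- Exponential weights make weakly singular Volterra kernels small. -/
theorem exists_exp_weight (hp : 0 ≤ p) (hq : 0 ≤ q) (hpq : p + q < 1) {ε : ℝ} (hε : 0 < ε) :
    ∃ l₀ : ℝ, 0 < l₀ ∧ ∀ l ≥ l₀, ∀ t ∈ Ioc (0 : ℝ) 1,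
      IntervalIntegrable (fun s : ℝ => (t - s) ^ (-p) * s ^ (-q) * Real.exp (l * s)) volume 0 t ∧
      ∫ s in (0 : ℝ)..t, (t - s) ^ (-p) * s ^ (-q) * Real.exp (l * s) ≤ ε * Real.exp (l * t) := by
  -- Half of the gap: the worsened kernel `(t - s)^{-(p+θ)} s^{-q}` is still integrable.
  set θ := (1 - p - q) / 2 with hθ
  have hθ0 : 0 < θ := by rw [hθ]; linarith
  obtain ⟨l₀, hl₀, hl₁⟩ : ∃ l₀ : ℝ, 0 < l₀ ∧ ∀ l ≥ l₀, l ^ (-θ) * betaC (p + θ) q ≤ ε := by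
    have h1 : Tendsto (fun l : ℝ => l ^ (-θ) * betaC (p + θ) q) atTop (𝓝 (0 * betaC (p + θ) q)) :=
      (tendsto_rpow_neg_atTop hθ0).mul_const _
    rw [zero_mul] at h1
    obtain ⟨l, h2⟩ := eventually_atTop.1 (h1.eventually (gt_mem_nhds hε))
    exact ⟨max l 1, by positivity, fun l' h => (h2 l' ((le_max_left _ _).trans h)).le⟩
  refine ⟨l₀, hl₀, fun l hll t ht => ?_⟩
  have hl0 : 0 < l := hl₀.trans_le hll
  have hl := hl₁ l hll
  have hi : IntervalIntegrable (fun s : ℝ => (t - s) ^ (-p) * s ^ (-q) * Real.exp (l * s))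
      volume 0 t :=
    (intervalIntegrable_beta (by linarith) (by linarith) ht.1).mul_continuousOn
      (by fun_prop)
  refine ⟨hi, ?_⟩
  calc _ ≤ ∫ s in (0 : ℝ)..t, (Real.exp (l * t) * l ^ (-θ)) * ((t - s) ^ (-(p + θ)) * s ^ (-q)) := by
        refine intervalIntegral.integral_mono_on_of_le_Ioo ht.1.le hi
          ((intervalIntegrable_beta (by linarith) (by linarith) ht.1).const_mul _) fun s hs => ?_
        have hts : 0 < t - s := sub_pos.2 hs.2
        -- The decay `e^{-l(t-s)}` is traded for the small factor `l^{-θ}` at the cost of a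
        -- singularity `(t - s)^{-θ}`.
        have h1 := exp_neg_le_rpow_neg (mul_pos hl0 hts) hθ0.le (by linarith)
        rw [Real.mul_rpow hl0.le hts.le] at h1
        have h2 : Real.exp (l * s) = Real.exp (l * t) * Real.exp (-(l * (t - s))) := by
          rw [← Real.exp_add]; congr 1; ring
        have h3 : (t - s) ^ (-(p + θ)) = (t - s) ^ (-p) * (t - s) ^ (-θ) := by
          rw [← Real.rpow_add hts]; congr 1; ring
        rw [h2, h3]
        have h4 : 0 ≤ (t - s) ^ (-p) * s ^ (-q) * Real.exp (l * t) :=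
          mul_nonneg (mul_nonneg (Real.rpow_nonneg hts.le _) (Real.rpow_nonneg hs.1.le _))
            (Real.exp_pos _).le
        calc _ = (t - s) ^ (-p) * s ^ (-q) * Real.exp (l * t) * Real.exp (-(l * (t - s))) := by ring
          _ ≤ (t - s) ^ (-p) * s ^ (-q) * Real.exp (l * t) * (l ^ (-θ) * (t - s) ^ (-θ)) :=
            mul_le_mul_of_nonneg_left h1 h4
          _ = _ := by ring
    _ = Real.exp (l * t) * (l ^ (-θ) * betaC (p + θ) q) * t ^ (1 - (p + θ) - q) := by
        rw [intervalIntegral.integral_const_mul, integral_beta ht.1]; ring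
    _ ≤ Real.exp (l * t) * ε * 1 := by
        have h0 := betaC_nonneg (p + θ) q
        have h5 : t ^ (1 - (p + θ) - q) ≤ 1 := Real.rpow_le_one ht.1.le ht.2 (by linarith)
        have h6 : 0 ≤ t ^ (1 - (p + θ) - q) := Real.rpow_nonneg ht.1.le _
        gcongr
    _ = _ := by ring

end SingularKernels

/-! ### Derivative bounds for products, the heat flow and Duhamel integrals. -/

section Bounds

variable {d : ℕ} {F G H : Type u} [NormedAddCommGroup F] [NormedSpace ℝ F]
  [NormedAddCommGroup G] [NormedSpace ℝ G] [NormedAddCommGroup H] [NormedSpace ℝ H]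

/-- A bound on the derivatives of order at most `k`. -/
def Bd (k : ℕ) (f : E d → F) (C : ℝ) : Prop := ∀ j ≤ k, ∀ x, ‖iteratedFDeriv ℝ j f x‖ ≤ C

theorem Bd.nonneg {k : ℕ} {f : E d → F} {C : ℝ} (h : Bd k f C) : 0 ≤ C :=
  (norm_nonneg _).trans (h 0 (by omega) 0)

theorem Bd.mono {k : ℕ} {f : E d → F} {C D : ℝ} (h : Bd k f C) (hCD : C ≤ D) : Bd k f D :=
  fun j hj x => (h j hj x).trans hCD

theorem Bd.of_le {k l : ℕ} {f : E d → F} {C : ℝ} (h : Bd k f C) (hl : l ≤ k) : Bd l f C :=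
  fun j hj x => h j (hj.trans hl) x

theorem Bd.norm_le {k : ℕ} {f : E d → F} {C : ℝ} (h : Bd k f C) (x : E d) : ‖f x‖ ≤ C := by
  simpa using h 0 (by omega) x

theorem bd_zero_iff {f : E d → F} {C : ℝ} : Bd 0 f C ↔ ∀ x, ‖f x‖ ≤ C :=
  ⟨fun h => h.norm_le, fun h j hj x => by
    obtain rfl : j = 0 := by omega
    simpa using h x⟩

theorem Bd.fderiv {k : ℕ} {f : E d → F} {C : ℝ} (h : Bd (k + 1) f C) : Bd k (fderiv ℝ f) C :=
  fun j hj x => by rw [norm_iteratedFDeriv_fderiv]; exact h (j + 1) (by omega) x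

theorem bd_succ_iff {k : ℕ} {f : E d → F} {C : ℝ} :
    Bd (k + 1) f C ↔ (∀ x, ‖f x‖ ≤ C) ∧ Bd k (fderiv ℝ f) C := by
  refine ⟨fun h => ⟨h.norm_le, h.fderiv⟩, fun h j hj x => ?_⟩
  cases j with
  | zero => simpa using h.1 x
  | succ j => rw [← norm_iteratedFDeriv_fderiv]; exact h.2 j (by omega) x

theorem Bd.add {k : ℕ} {f g : E d → F} (hf : ContDiff ℝ k f) (hg : ContDiff ℝ k g) {C D : ℝ}
    (h1 : Bd k f C) (h2 : Bd k g D) : Bd k (fun x => f x + g x) (C + D) := by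
  intro j hj x
  have hj' : (j : WithTop ℕ∞) ≤ k := by exact_mod_cast hj
  have := iteratedFDeriv_add_apply (x := x) (i := j) ((hf.of_le hj').contDiffAt)
    ((hg.of_le hj').contDiffAt)
  rw [show (fun x => f x + g x) = f + g from rfl, this]
  exact (norm_add_le _ _).trans (add_le_add (h1 j hj x) (h2 j hj x))

theorem Bd.bilin {k : ℕ} {f : E d → F} {g : E d → G} (hf : ContDiff ℝ k f) (hg : ContDiff ℝ k g)
    {C D : ℝ} (h1 : Bd k f C) (h2 : Bd k g D) (B : F →L[ℝ] G →L[ℝ] H) :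
    Bd k (fun x => B (f x) (g x)) (2 ^ k * ‖B‖ * C * D) := by
  intro j hj x
  have hj' : (j : WithTop ℕ∞) ≤ k := by exact_mod_cast hj
  have hC := h1.nonneg
  have hD := h2.nonneg
  refine (B.norm_iteratedFDeriv_le_of_bilinear hf hg x hj').trans ?_
  calc _ ≤ ‖B‖ * ∑ i ∈ Finset.range (j + 1), (j.choose i : ℝ) * C * D := by
        gcongr with i hi
        · exact h1 i (by have := Finset.mem_range.1 hi; omega) x
        · exact h2 (j - i) (by omega) x
    _ = ‖B‖ * (2 ^ j * C * D) := by
        rw [← Finset.sum_mul, ← Finset.sum_mul]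
        congr 3
        exact_mod_cast Nat.sum_range_choose j
    _ ≤ ‖B‖ * (2 ^ k * C * D) := by
        gcongr
        norm_num
    _ = _ := by ring

theorem Reg.norm_iteratedFDeriv_hs_le {j : ℕ} {f : ℝ → E d → F} (hf : Reg j f) {s C : ℝ}
    (h : ∀ x, ‖iteratedFDeriv ℝ j (f s) x‖ ≤ C) (r : ℝ) (x : E d) :
    ‖iteratedFDeriv ℝ j (YMFlow.hs r (f s)) x‖ ≤ C := by
  induction j generalizing F with
  | zero =>
    simp only [norm_iteratedFDeriv_zero] at h ⊢
    exact norm_hs_le h r x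
  | succ j ih =>
    rw [← norm_iteratedFDeriv_fderiv, hf.fderiv_hs]
    have h' : ∀ x, ‖iteratedFDeriv ℝ j (_root_.fderiv ℝ (f s)) x‖ ≤ C := fun x => by
      rw [norm_iteratedFDeriv_fderiv]; exact h x
    exact ih (f := fun s => _root_.fderiv ℝ (f s)) hf.fderiv h'

theorem Reg.norm_iteratedFDeriv_succ_hs_le [CompleteSpace F] {j : ℕ} {f : ℝ → E d → F}
    (hf : Reg (j + 1) f) {s C : ℝ} (h : ∀ x, ‖iteratedFDeriv ℝ j (f s) x‖ ≤ C) {r : ℝ} (hr : 0 < r)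
    (x : E d) :
    ‖iteratedFDeriv ℝ (j + 1) (YMFlow.hs r (f s)) x‖ ≤ gradConst d * r ^ (-(1 / 2) : ℝ) * C := by
  induction j generalizing F with
  | zero =>
    rw [← norm_iteratedFDeriv_fderiv]
    simp only [norm_iteratedFDeriv_zero] at h ⊢
    obtain ⟨D, hD⟩ := hf.fderiv.tame.bdd_at s
    rw [hf.fderiv_hs]
    exact norm_hs_fderiv_le (hf.differentiable s) (hf.fderiv.tame.cont_at s) h hD hr x
  | succ j ih =>
    rw [← norm_iteratedFDeriv_fderiv, hf.fderiv_hs]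
    have h' : ∀ x, ‖iteratedFDeriv ℝ j (_root_.fderiv ℝ (f s)) x‖ ≤ C := fun x => by
      rw [norm_iteratedFDeriv_fderiv]; exact h x
    exact ih (f := fun s => _root_.fderiv ℝ (f s)) hf.fderiv h'

/-- The bound is asked for on the open interval only, since the functions `K` in use are singular at
`0` and at `t`. -/
theorem Reg.norm_iteratedFDeriv_duh_le {j : ℕ} {f : ℝ → E d → F} (hf : Reg j f) {t : ℝ}
    (ht : 0 ≤ t) {K : ℝ → ℝ} (hK : IntervalIntegrable K volume 0 t)
    (h : ∀ s ∈ Ioo 0 t, ∀ x, ‖iteratedFDeriv ℝ j (YMFlow.hs (t - s) (f s)) x‖ ≤ K s) (x : E d) :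
    ‖iteratedFDeriv ℝ j (YMFlow.duh f t) x‖ ≤ ∫ s in (0 : ℝ)..t, K s := by
  induction j generalizing F with
  | zero =>
    simp only [norm_iteratedFDeriv_zero] at h ⊢
    refine intervalIntegral.norm_integral_le_of_norm_le ht ?_ hK
    have : ∀ᵐ s : ℝ, s ≠ t := by simp [ae_iff]
    filter_upwards [this] with s hs1 hs2
    exact h s ⟨hs2.1, lt_of_le_of_ne hs2.2 hs1⟩ x
  | succ j ih =>
    rw [← norm_iteratedFDeriv_fderiv, hf.fderiv_duh]
    refine ih (f := fun s => _root_.fderiv ℝ (f s)) hf.fderiv fun s hs x => ?_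
    rw [← hf.fderiv_hs, norm_iteratedFDeriv_fderiv]
    exact h s hs x

theorem Reg.bd_hs {k : ℕ} {f : ℝ → E d → F} (hf : Reg k f) {s C : ℝ} (h : Bd k (f s) C) (r : ℝ) :
    Bd k (YMFlow.hs r (f s)) C := by
  intro j hj x
  have hj' : Reg j f := by
    obtain ⟨i, rfl⟩ := Nat.exists_eq_add_of_le hj
    clear h
    induction i with
    | zero => exact hf
    | succ i ih => exact ih (Reg.pred hf) (by omega)
  exact hj'.norm_iteratedFDeriv_hs_le (h j hj) r x

/-- Only the top derivative needs the smoothing kernel. As `t ≤ 1`, this kernel is at least `1` and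
covers the lower derivatives too. -/
theorem Reg.bd_duh [CompleteSpace F] {m : ℕ} {f : ℝ → E d → F} (hf : ∀ k, Reg k f) {t : ℝ}
    (ht : t ∈ Ioc 0 1) {K : ℝ → ℝ}
    (hK : IntervalIntegrable (fun s => (t - s) ^ (-(1 / 2) : ℝ) * K s) volume 0 t)
    (h : ∀ s ∈ Ioo 0 t, Bd m (f s) (K s)) :
    Bd (m + 1) (YMFlow.duh f t)
      ((1 + gradConst d) * ∫ s in (0 : ℝ)..t, (t - s) ^ (-(1 / 2) : ℝ) * K s) := by
  intro j hj x
  rw [← intervalIntegral.integral_const_mul]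
  refine (hf j).norm_iteratedFDeriv_duh_le ht.1.le (hK.const_mul _) (fun s hs y => ?_) x
  have hts : 0 < t - s := sub_pos.2 hs.2
  have hg := gradConst_nonneg d
  have hK0 := (h s hs).nonneg
  have h1 : 1 ≤ (t - s) ^ (-(1 / 2) : ℝ) :=
    Real.one_le_rpow_of_pos_of_le_one_of_nonpos hts (by linarith [hs.1, ht.2]) (by norm_num)
  rcases hj.lt_or_eq with hj | rfl
  · calc _ ≤ K s := (hf j).norm_iteratedFDeriv_hs_le (h s hs j (by omega)) _ y
      _ = 1 * (1 * K s) := by ring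
      _ ≤ _ := by gcongr; linarith
  · calc _ ≤ gradConst d * (t - s) ^ (-(1 / 2) : ℝ) * K s :=
          (hf (m + 1)).norm_iteratedFDeriv_succ_hs_le (h s hs m le_rfl) hts y
      _ = gradConst d * ((t - s) ^ (-(1 / 2) : ℝ) * K s) := by ring
      _ ≤ _ := by gcongr; linarith

/-- With an exponential weight in time, the Duhamel integral gains a derivative with a small
constant. -/
theorem exists_exp_bd_duh [CompleteSpace F] {ε : ℝ} (hε : 0 < ε) :
    ∃ l : ℝ, 0 < l ∧ ∀ (m : ℕ) (f : ℝ → E d → F), (∀ k, Reg k f) → ∀ t ∈ Ioc (0 : ℝ) 1, ∀ K₀ : ℝ,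
      0 ≤ K₀ → (∀ s ∈ Ioo 0 t, Bd m (f s) (K₀ * Real.exp (l * s))) →
      Bd (m + 1) (duh f t) (ε * K₀ * Real.exp (l * t)) := by
  have hg : 0 < 1 + gradConst d := by linarith [gradConst_nonneg d]
  obtain ⟨l, hl, h⟩ := exists_exp_weight (p := 1 / 2) (q := 0) (by norm_num) le_rfl (by norm_num)
    (div_pos hε hg)
  refine ⟨l, hl, fun m f hf t ht K₀ hK₀ hb => ?_⟩
  obtain ⟨h1, h2⟩ := h l le_rfl t ht
  have e : (fun s => (t - s) ^ (-(1 / 2) : ℝ) * (K₀ * Real.exp (l * s)))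
      = fun s => K₀ * ((t - s) ^ (-(1 / 2) : ℝ) * s ^ (-0 : ℝ) * Real.exp (l * s)) := by
    ext s; simp; ring
  refine (Reg.bd_duh hf ht (K := fun s => K₀ * Real.exp (l * s)) ?_ hb).mono ?_
  · rw [e]; exact h1.const_mul _
  · rw [e, intervalIntegral.integral_const_mul]
    calc _ ≤ (1 + gradConst d) * (K₀ * (ε / (1 + gradConst d) * Real.exp (l * t))) := by gcongr
      _ = _ := by field_simp

end Bounds

/-! ### The abstract nonlinearity and its Picard iteration. -/

section Nonlinearity

variable {d : ℕ} {V W : Type u} [NormedAddCommGroup V] [NormedSpace ℝ V]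
  [NormedAddCommGroup W] [NormedSpace ℝ W]

/-- Nonlinearities of the form `b(u, Du) + c(u, q(u, u))`. -/
structure Nonlin (d : ℕ) (V W : Type u) [NormedAddCommGroup V] [NormedSpace ℝ V]
    [NormedAddCommGroup W] [NormedSpace ℝ W] where
  b : V →L[ℝ] (E d →L[ℝ] V) →L[ℝ] V
  c : V →L[ℝ] W →L[ℝ] V
  q : V →L[ℝ] V →L[ℝ] W

namespace Nonlin

variable (N : Nonlin d V W)

/-- The quadratic part of the nonlinearity. -/
def quad (u : E d → V) (x : E d) : V := N.b (u x) (fderiv ℝ u x)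

/-- The nonlinearity as an operator on functions. -/
def app (u : E d → V) (x : E d) : V := N.quad u x + N.c (u x) (N.q (u x) (u x))

/-- The size of the nonlinearity in `C^m`. -/
def const (m : ℕ) : ℝ := 2 ^ m * ‖N.b‖ + 3 * (2 ^ m * ‖N.c‖ * (2 ^ m * ‖N.q‖))

theorem const_nonneg (m : ℕ) : 0 ≤ N.const m := by unfold const; positivity

theorem reg_quad {n : ℕ} {u : ℝ → E d → V} (hu : Reg (n + 1) u) : Reg n fun s => N.quad (u s) :=
  hu.pred.bilin hu.fderiv N.b

theorem reg_app {n : ℕ} {u : ℝ → E d → V} (hu : Reg (n + 1) u) : Reg n fun s => N.app (u s) :=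
  (N.reg_quad hu).add (hu.pred.bilin (hu.pred.bilin hu.pred N.q) N.c)

theorem app_zero : N.app (0 : E d → V) = 0 := by ext x; simp [app, quad]

theorem cubic_sub (u v : V) : N.c u (N.q u u) - N.c v (N.q v v)
    = N.c (u - v) (N.q u u) + (N.c v (N.q (u - v) u) + N.c v (N.q v (u - v))) := by
  simp only [map_sub, sub_apply]
  abel

theorem app_sub {u v : E d → V} (hu : Differentiable ℝ u) (hv : Differentiable ℝ v) (x : E d) :
    N.app u x - N.app v x = (N.b (u x - v x) (fderiv ℝ u x)
      + N.b (v x) (fderiv ℝ (fun y => u y - v y) x))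
      + (N.c (u x - v x) (N.q (u x) (u x))
        + (N.c (v x) (N.q (u x - v x) (u x)) + N.c (v x) (N.q (v x) (u x - v x)))) := by
  have h : fderiv ℝ (fun y => u y - v y) x = fderiv ℝ u x - fderiv ℝ v x := fderiv_sub (hu x) (hv x)
  rw [← N.cubic_sub, h, app, app, quad, quad]
  simp only [map_sub, sub_apply]
  abel

/-- The telescoping in `app_sub` puts the top derivative on `u` and on `u - v`, never on `v` alone.
The estimate is therefore linear in the `C^{m+1}` quantities, and `u = 0` (so `M₁ = 0`) gives a
bound on `N(v)` itself. -/
theorem bd_app_sub {m : ℕ} {u v : E d → V} (hu : ContDiff ℝ (m + 1) u) (hv : ContDiff ℝ (m + 1) v)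
    {ω₀ ω₁ M M₁ : ℝ} (h0 : Bd m (fun x => u x - v x) ω₀) (h1 : Bd (m + 1) (fun x => u x - v x) ω₁)
    (hum : Bd m u M) (hvm : Bd m v M) (hu1 : Bd (m + 1) u M₁) :
    Bd m (fun x => N.app u x - N.app v x) (N.const m * (ω₀ * M₁ + M * ω₁ + M ^ 2 * ω₀)) := by
  have hm : (m : WithTop ℕ∞) ≤ m + 1 := by exact_mod_cast Nat.le_succ m
  have hu' := hu.of_le hm
  have hv' := hv.of_le hm
  have hw' := hu'.sub hv'
  have hdu : ContDiff ℝ m (fderiv ℝ u) := (contDiff_succ_iff_fderiv.1 hu).2.2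
  have hdw : ContDiff ℝ m (fderiv ℝ fun y => u y - v y) :=
    (contDiff_succ_iff_fderiv.1 (hu.sub hv)).2.2
  have hcb : ∀ {X Y Z : Type u} [NormedAddCommGroup X] [NormedSpace ℝ X] [NormedAddCommGroup Y]
      [NormedSpace ℝ Y] [NormedAddCommGroup Z] [NormedSpace ℝ Z] (B : X →L[ℝ] Y →L[ℝ] Z)
      {f : E d → X} {g : E d → Y}, ContDiff ℝ m f → ContDiff ℝ m g →
      ContDiff ℝ m fun x => B (f x) (g x) := fun B _ _ hf hg =>
    B.isBoundedBilinearMap.contDiff.comp (hf.prodMk hg)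
  have t1 := h0.bilin hw' hdu hu1.fderiv N.b
  have t2 := hvm.bilin hv' hdw h1.fderiv N.b
  have t3 := h0.bilin hw' (hcb N.q hu' hu') (hum.bilin hu' hu' hum N.q) N.c
  have t4 := hvm.bilin hv' (hcb N.q hw' hu') (h0.bilin hw' hu' hum N.q) N.c
  have t5 := hvm.bilin hv' (hcb N.q hv' hw') (hvm.bilin hv' hw' h0 N.q) N.c
  have t := (t1.add (hcb N.b hw' hdu) (hcb N.b hv' hdw) t2).add
    ((hcb N.b hw' hdu).add (hcb N.b hv' hdw))
    ((hcb N.c hw' (hcb N.q hu' hu')).add ((hcb N.c hv' (hcb N.q hw' hu')).add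
      (hcb N.c hv' (hcb N.q hv' hw'))))
    (t3.add (hcb N.c hw' (hcb N.q hu' hu'))
      ((hcb N.c hv' (hcb N.q hw' hu')).add (hcb N.c hv' (hcb N.q hv' hw')))
      (t4.add (hcb N.c hv' (hcb N.q hw' hu')) (hcb N.c hv' (hcb N.q hv' hw')) t5))
  have hdiff : (fun x => N.app u x - N.app v x) = _ := funext fun x =>
    N.app_sub (hu.differentiable (by simp)) (hv.differentiable (by simp)) x
  rw [hdiff]
  refine t.mono ?_
  have hω₀ := h0.nonneg
  have hω₁ := h1.nonneg
  have hM := hum.nonneg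
  have hM₁ := hu1.nonneg
  unfold const
  have e1 : 0 ≤ 2 ^ m * ‖N.b‖ := by positivity
  have e2 : 0 ≤ 2 ^ m * ‖N.c‖ * (2 ^ m * ‖N.q‖) := by positivity
  have e3 : 0 ≤ (2 ^ m * ‖N.b‖) * (M ^ 2 * ω₀) := by positivity
  have e4 : 0 ≤ (2 ^ m * ‖N.c‖ * (2 ^ m * ‖N.q‖)) * (ω₀ * M₁ + M * ω₁) := by positivity
  linarith

variable [CompleteSpace V]

/-- The Picard iteration for `∂ₜ u = Δ u + N(u)`, `u(0) = a`. -/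
def picard (a : E d → V) : ℕ → ℝ → E d → V
  | 0 => fun t => hs t a
  | n + 1 => fun t x => hs t a x + duh (fun s => N.app (picard a n s)) t x

/-- The deviation of the Picard iterates from the heat flow. -/
def dev (a : E d → V) (n : ℕ) (t : ℝ) (x : E d) : V := N.picard a n t x - hs t a x

theorem reg_picard {a : E d → V} (ha : ∀ k, Reg k fun _ => a) (n k : ℕ) :
    Reg k (N.picard a n) := by
  induction n generalizing k with
  | zero => exact (ha k).hs continuous_id
  | succ n ih => exact ((ha k).hs continuous_id).add (N.reg_app (ih (k + 1))).duh

theorem reg_dev {a : E d → V} (ha : ∀ k, Reg k fun _ => a) (n k : ℕ) : Reg k (N.dev a n) :=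
  (N.reg_picard ha n k).sub ((ha k).hs continuous_id)

theorem dev_zero (a : E d → V) : N.dev a 0 = 0 := by ext t x; simp [dev, picard]

theorem dev_succ (a : E d → V) (n : ℕ) :
    N.dev a (n + 1) = duh fun s => N.app (N.picard a n s) := by
  ext t x; simp [dev, picard]

theorem picard_at_zero (a : E d → V) (n : ℕ) : N.picard a n 0 = a := by
  ext1 x
  cases n with
  | zero => exact hs_of_nonpos le_rfl a x
  | succ n => simp [picard, duh, hs_of_nonpos le_rfl a x]

theorem hs_zero_fun (t : ℝ) : hs t (0 : E d → V) = 0 := by ext x; simp [hs]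

theorem picard_zero_fun (n : ℕ) : N.picard (0 : E d → V) n = 0 := by
  induction n with
  | zero => ext t x; simp [picard, hs_zero_fun]
  | succ n ih =>
    ext t x
    simp only [picard, ih, hs_zero_fun, Pi.zero_apply, N.app_zero, duh]
    simp

end Nonlin

end Nonlinearity

/-! ### Uniform Lipschitz bounds near time zero for the Picard iterates. -/

section Weighted

variable {d : ℕ} {V W : Type u} [NormedAddCommGroup V] [NormedSpace ℝ V]
  [NormedAddCommGroup W] [NormedSpace ℝ W]

theorem duh_sub [CompleteSpace V] {f g : ℝ → E d → V} (hf : Tame f) (hg : Tame g) (t : ℝ)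
    (x : E d) : duh (fun s y => f s y - g s y) t x = duh f t x - duh g t x := by
  rw [duh, duh, duh, ← intervalIntegral.integral_sub
    ((hf.continuous_hs_sub t x).intervalIntegrable _ _)
    ((hg.continuous_hs_sub t x).intervalIntegrable _ _)]
  refine intervalIntegral.integral_congr fun s _ => ?_
  obtain ⟨C, hC⟩ := hf.bdd_at s
  obtain ⟨D, hD⟩ := hg.bdd_at s
  exact hs_sub (hf.cont_at s) (hg.cont_at s) hC hD _ _

namespace Nonlin

variable (N : Nonlin d V W)

/-- The constant in `norm_perturbation_le`. -/
def pertConst (c R : ℝ) : ℝ :=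
  ‖N.b‖ * R * (4 * c + 2) + 3 * (‖N.c‖ * ‖N.q‖ * (c + 1) ^ 3 * R ^ 2)

theorem pertConst_nonneg {c R : ℝ} (hc : 0 ≤ c) (hR : 0 ≤ R) : 0 ≤ N.pertConst c R := by
  unfold pertConst; positivity

/-- Pointwise algebra with `U` the heat flow, `B` the deviation, `P = s^{-ν}`, `m = s^{-μ}` and `h =
s^{-1/2}`. Once `b(U, DU)`, the only contribution of order `P² h`, is removed, each quadratic term
contains a factor `B` or `DB` and is of order at most `P m h`, while the cubic terms are of order
`P³`. -/
theorem norm_perturbation_le {U U' B B' : V} {DU DU' DB DB' : E d →L[ℝ] V}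
    {c R θ P m h k : ℝ} (hc : 0 ≤ c) (hR : 0 ≤ R) (hθ : 0 ≤ θ) (hm : 0 ≤ m) (hmP : m ≤ P)
    (hh : 0 ≤ h) (hk1 : P * m * h ≤ k) (hk2 : P ^ 3 ≤ k)
    (hU : ‖U‖ ≤ c * R * P) (hU' : ‖U'‖ ≤ c * R * P) (hdU : ‖U - U'‖ ≤ c * θ * P)
    (hDU : ‖DU‖ ≤ c * R * (P * h)) (hdDU : ‖DU - DU'‖ ≤ c * θ * (P * h))
    (hB : ‖B‖ ≤ R * m) (hB' : ‖B'‖ ≤ R * m) (hdB : ‖B - B'‖ ≤ θ * m)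
    (hDB : ‖DB‖ ≤ R * (m * h)) (hdDB : ‖DB - DB'‖ ≤ θ * (m * h)) :
    ‖(N.b (U + B) (DU + DB) + N.c (U + B) (N.q (U + B) (U + B)))
      - (N.b (U' + B') (DU' + DB') + N.c (U' + B') (N.q (U' + B') (U' + B')))
      - (N.b U DU - N.b U' DU')‖ ≤ N.pertConst c R * θ * k := by
  have hP : 0 ≤ P := hm.trans hmP
  have e : (N.b (U + B) (DU + DB) + N.c (U + B) (N.q (U + B) (U + B)))
      - (N.b (U' + B') (DU' + DB') + N.c (U' + B') (N.q (U' + B') (U' + B')))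
      - (N.b U DU - N.b U' DU')
      = (N.b (U - U') DB + N.b U' (DB - DB')) + (N.b (B - B') (DU + DB)
        + N.b B' ((DU - DU') + (DB - DB')))
        + (N.c (U + B) (N.q (U + B) (U + B)) - N.c (U' + B') (N.q (U' + B') (U' + B'))) := by
    simp only [map_sub, map_add, sub_apply, add_apply]
    abel
  have hw : ‖U + B - (U' + B')‖ ≤ (c + 1) * θ * P := by
    calc _ = ‖(U - U') + (B - B')‖ := by congr 1; abel
      _ ≤ c * θ * P + θ * m := (norm_add_le _ _).trans (add_le_add hdU hdB)
      _ ≤ c * θ * P + θ * P := by gcongr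
      _ = _ := by ring
  have hA : ∀ {X Y : V}, ‖X‖ ≤ c * R * P → ‖Y‖ ≤ R * m → ‖X + Y‖ ≤ (c + 1) * R * P := by
    intro X Y hX hY
    calc _ ≤ c * R * P + R * m := (norm_add_le _ _).trans (add_le_add hX hY)
      _ ≤ c * R * P + R * P := by gcongr
      _ = _ := by ring
  have h1 := hA hU hB
  have h2 := hA hU' hB'
  have hmPh : m * h ≤ P * h := by gcongr
  have b1 : ‖N.b (U - U') DB‖ ≤ ‖N.b‖ * (c * θ * P) * (R * (m * h)) :=
    (N.b.le_opNorm₂ _ _).trans (by gcongr)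
  have b2 : ‖N.b U' (DB - DB')‖ ≤ ‖N.b‖ * (c * R * P) * (θ * (m * h)) :=
    (N.b.le_opNorm₂ _ _).trans (by gcongr)
  have b3 : ‖N.b (B - B') (DU + DB)‖ ≤ ‖N.b‖ * (θ * m) * (c * R * (P * h) + R * (P * h)) :=
    (N.b.le_opNorm₂ _ _).trans (by
      gcongr
      exact (norm_add_le _ _).trans (add_le_add hDU (hDB.trans (by gcongr))))
  have b4 : ‖N.b B' ((DU - DU') + (DB - DB'))‖
      ≤ ‖N.b‖ * (R * m) * (c * θ * (P * h) + θ * (P * h)) :=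
    (N.b.le_opNorm₂ _ _).trans (by
      gcongr
      exact (norm_add_le _ _).trans (add_le_add hdDU (hdDB.trans (by gcongr))))
  have hc3 : ∀ {X Y Z : V} {x y z : ℝ}, ‖X‖ ≤ x → ‖Y‖ ≤ y → ‖Z‖ ≤ z →
      ‖N.c X (N.q Y Z)‖ ≤ ‖N.c‖ * x * (‖N.q‖ * y * z) := by
    intro X Y Z x y z hx hy hz
    have := (norm_nonneg _).trans hx
    have := (norm_nonneg _).trans hy
    refine (N.c.le_opNorm₂ _ _).trans ?_
    have := N.q.le_opNorm₂ Y Z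
    gcongr
    exact this.trans (by gcongr)
  have c1 := hc3 hw h1 h1
  have c2 := hc3 h2 hw h1
  have c3 := hc3 h2 h2 hw
  rw [e, N.cubic_sub]
  calc _ ≤ ((‖N.b‖ * (c * θ * P) * (R * (m * h)) + ‖N.b‖ * (c * R * P) * (θ * (m * h)))
        + (‖N.b‖ * (θ * m) * (c * R * (P * h) + R * (P * h))
        + ‖N.b‖ * (R * m) * (c * θ * (P * h) + θ * (P * h))))
        + (‖N.c‖ * ((c + 1) * θ * P) * (‖N.q‖ * ((c + 1) * R * P) * ((c + 1) * R * P))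
        + (‖N.c‖ * ((c + 1) * R * P) * (‖N.q‖ * ((c + 1) * θ * P) * ((c + 1) * R * P))
        + ‖N.c‖ * ((c + 1) * R * P) * (‖N.q‖ * ((c + 1) * R * P) * ((c + 1) * θ * P)))) := by
        refine (norm_add_le _ _).trans (add_le_add ((norm_add_le _ _).trans (add_le_add
          ((norm_add_le _ _).trans (add_le_add b1 b2))
          ((norm_add_le _ _).trans (add_le_add b3 b4)))) ?_)
        exact (norm_add_le _ _).trans (add_le_add c1
          ((norm_add_le _ _).trans (add_le_add c2 c3)))
    _ = ‖N.b‖ * R * (4 * c + 2) * θ * (P * m * h)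
        + 3 * (‖N.c‖ * ‖N.q‖ * (c + 1) ^ 3 * R ^ 2) * θ * P ^ 3 := by ring
    _ ≤ ‖N.b‖ * R * (4 * c + 2) * θ * k
        + 3 * (‖N.c‖ * ‖N.q‖ * (c + 1) ^ 3 * R ^ 2) * θ * k := by gcongr
    _ = _ := by rw [pertConst]; ring

/-- A set `S` of initial data with a distance `Θ` controlling the heat flow and the quadratic term
along the heat flow, by negative powers of time. -/
structure Admissible (S : Set (E d → V)) (Θ : (E d → V) → (E d → V) → ℝ) (R c ν δ b : ℝ) :
    Prop where
  reg : ∀ a ∈ S, ∀ k, Reg k fun _ => a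
  zero_mem : 0 ∈ S
  nonneg : ∀ a b, 0 ≤ Θ a b
  dist_zero_le : ∀ a ∈ S, Θ a 0 ≤ R
  heat_sub : ∀ a₁ ∈ S, ∀ a₂ ∈ S, ∀ s ∈ Ioo (0 : ℝ) 1, ∀ x,
    ‖hs s a₁ x - hs s a₂ x‖ ≤ c * Θ a₁ a₂ * s ^ (-ν)
  dheat_sub : ∀ a₁ ∈ S, ∀ a₂ ∈ S, ∀ s ∈ Ioo (0 : ℝ) 1, ∀ x,
    ‖fderiv ℝ (hs s a₁) x - fderiv ℝ (hs s a₂) x‖ ≤ c * Θ a₁ a₂ * s ^ (-(ν + 1 / 2))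
  quad_sub : ∀ a₁ ∈ S, ∀ a₂ ∈ S, ∀ s ∈ Ioo (0 : ℝ) 1, ∀ r ∈ Ioo (0 : ℝ) 1, ∀ x,
    ‖hs r (fun y => N.quad (hs s a₁) y - N.quad (hs s a₂) y) x‖
      ≤ c * Θ a₁ a₂ * (r ^ (-b) * s ^ (-δ))
  dquad_sub : ∀ a₁ ∈ S, ∀ a₂ ∈ S, ∀ s ∈ Ioo (0 : ℝ) 1, ∀ r ∈ Ioo (0 : ℝ) 1, ∀ x,
    ‖fderiv ℝ (hs r (fun y => N.quad (hs s a₁) y - N.quad (hs s a₂) y)) x‖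
      ≤ c * Θ a₁ a₂ * (r ^ (-(b + 1 / 2)) * s ^ (-δ))

variable {N} [CompleteSpace V]

theorem fderiv_picard {a : E d → V} (ha : ∀ k, Reg k fun _ => a) (n : ℕ) (s : ℝ) (x : E d) :
    fderiv ℝ (N.picard a n s) x = fderiv ℝ (hs s a) x + fderiv ℝ (N.dev a n s) x := by
  have h : N.picard a n s = fun y => hs s a y + N.dev a n s y := by ext y; simp [dev]
  rw [h]
  exact fderiv_add (((ha 1).hs (ρ := fun _ => s) continuous_const).differentiable s x)
    ((N.reg_dev ha n 1).differentiable s x)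

theorem dev_zero_fun (n : ℕ) : N.dev (0 : E d → V) n = 0 := by
  ext t x; simp [dev, picard_zero_fun, hs_zero_fun]

namespace Admissible

variable {S : Set (E d → V)} {Θ : (E d → V) → (E d → V) → ℝ} {R c ν δ b : ℝ}

theorem R_nonneg (hA : N.Admissible S Θ R c ν δ b) : 0 ≤ R :=
  (hA.nonneg _ _).trans (hA.dist_zero_le 0 hA.zero_mem)

/-- The part of the source that needs no cancellation: it is bounded pointwise by `s^{-κ}`, which is
integrable in the application. Only the quadratic term of the heat flow is left to `quad_sub`. -/
theorem norm_source_le (hA : N.Admissible S Θ R c ν δ b) (hc : 0 ≤ c) {μ κ : ℝ} (hμν : μ ≤ ν)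
    (hκ1 : ν + μ + 1 / 2 ≤ κ) (hκ2 : 3 * ν ≤ κ) {T : ℝ} (hT : T < 1) {n : ℕ}
    (ih : ∀ a₁ ∈ S, ∀ a₂ ∈ S, ∀ s ∈ Ioc 0 T, ∀ x,
      ‖N.dev a₁ n s x - N.dev a₂ n s x‖ ≤ Θ a₁ a₂ * s ^ (-μ) ∧
      ‖fderiv ℝ (N.dev a₁ n s) x - fderiv ℝ (N.dev a₂ n s) x‖ ≤ Θ a₁ a₂ * s ^ (-(μ + 1 / 2)))
    {a₁ a₂ : E d → V} (h₁ : a₁ ∈ S) (h₂ : a₂ ∈ S) {s : ℝ} (hs' : s ∈ Ioc 0 T) (x : E d) :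
    ‖N.app (N.picard a₁ n s) x - N.app (N.picard a₂ n s) x
      - (N.quad (hs s a₁) x - N.quad (hs s a₂) x)‖ ≤ N.pertConst c R * Θ a₁ a₂ * s ^ (-κ) := by
  have hs0 := hs'.1
  have hs1 : s ≤ 1 := hs'.2.trans hT.le
  have hs2 : s ∈ Ioo (0 : ℝ) 1 := ⟨hs0, hs'.2.trans_lt hT⟩
  have hpow : ∀ {y z : ℝ}, y ≤ z → s ^ (-y) ≤ s ^ (-z) := fun h =>
    Real.rpow_le_rpow_of_exponent_ge hs0 hs1 (neg_le_neg h)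
  have hsplit : ∀ y : ℝ, s ^ (-(y + 1 / 2)) = s ^ (-y) * s ^ (-(1 / 2) : ℝ) := fun y => by
    rw [← Real.rpow_add hs0]; congr 1; ring
  have hpos : ∀ y : ℝ, 0 ≤ s ^ y := fun y => Real.rpow_nonneg hs0.le _
  have hR := hA.R_nonneg
  -- Size bounds are difference bounds against the datum `0`, whose heat flow and deviations vanish.
  have key : ∀ a ∈ S, ‖hs s a x‖ ≤ c * R * s ^ (-ν) ∧
      ‖fderiv ℝ (hs s a) x‖ ≤ c * R * (s ^ (-ν) * s ^ (-(1 / 2) : ℝ)) ∧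
      ‖N.dev a n s x‖ ≤ R * s ^ (-μ) ∧
      ‖fderiv ℝ (N.dev a n s) x‖ ≤ R * (s ^ (-μ) * s ^ (-(1 / 2) : ℝ)) := by
    intro a ha
    have hΘ := hA.dist_zero_le a ha
    have h1 := hA.heat_sub a ha 0 hA.zero_mem s hs2 x
    have h2 := hA.dheat_sub a ha 0 hA.zero_mem s hs2 x
    obtain ⟨h3, h4⟩ := ih a ha 0 hA.zero_mem s hs' x
    rw [hs_zero_fun] at h1 h2
    rw [dev_zero_fun] at h3 h4
    have hz : fderiv ℝ (0 : E d → V) x = 0 := by simp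
    simp only [Pi.zero_apply, hz, sub_zero, hsplit] at h1 h2 h3 h4
    have := hpos (-ν)
    have := hpos (-μ)
    have := hpos (-(1 / 2))
    exact ⟨h1.trans (by gcongr), h2.trans (by gcongr), h3.trans (by gcongr), h4.trans (by gcongr)⟩
  obtain ⟨u1, u2, u3, u4⟩ := key a₁ h₁
  obtain ⟨v1, v2, v3, v4⟩ := key a₂ h₂
  obtain ⟨w3, w4⟩ := ih a₁ h₁ a₂ h₂ s hs' x
  have w1 := hA.heat_sub a₁ h₁ a₂ h₂ s hs2 x
  have w2 := hA.dheat_sub a₁ h₁ a₂ h₂ s hs2 x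
  rw [hsplit] at w2 w4
  have hres := N.norm_perturbation_le (k := s ^ (-κ)) hc hR (hA.nonneg a₁ a₂) (hpos (-μ))
    (hpow hμν) (hpos (-(1 / 2))) ?_ ?_ u1 v1 w1 u2 w2 u3 v3 w3 u4 w4
  · have e : ∀ a, hs s a x + N.dev a n s x = N.picard a n s x := fun a => by simp [dev]
    rw [e, e, ← fderiv_picard (hA.reg _ h₁), ← fderiv_picard (hA.reg _ h₂)] at hres
    exact hres
  · rw [← Real.rpow_add hs0, ← Real.rpow_add hs0]
    exact Real.rpow_le_rpow_of_exponent_ge hs0 hs1 (by linarith)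
  · rw [← Real.rpow_natCast, ← Real.rpow_mul hs0.le]
    exact Real.rpow_le_rpow_of_exponent_ge hs0 hs1 (by push_cast; linarith)

/-- Induction along the Picard iteration with the constant `1` in front of `Θ`. Each step reproduces
the weight `t^{-μ}` times a positive power of `t`, which absorbs all constants when `T` is small.
The gradient bound needs `(t - s)^{-(b+1/2)}` integrable, hence `b < 1/2`. -/
theorem norm_dev_sub_le (hA : N.Admissible S Θ R c ν δ b) (hc : 0 ≤ c) {μ κ : ℝ} (hμ : 0 ≤ μ)
    (hμν : μ ≤ ν) (hκ1 : ν + μ + 1 / 2 ≤ κ) (hκ2 : 3 * ν ≤ κ) (hκ : κ < 1) (hb : b < 1 / 2)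
    (hδ : δ < 1) (hμb : b + δ - 1 < μ) :
    ∃ T, 0 < T ∧ T < 1 ∧ ∀ n, ∀ a₁ ∈ S, ∀ a₂ ∈ S, ∀ s ∈ Ioc 0 T, ∀ x,
      ‖N.dev a₁ n s x - N.dev a₂ n s x‖ ≤ Θ a₁ a₂ * s ^ (-μ) ∧
      ‖fderiv ℝ (N.dev a₁ n s) x - fderiv ℝ (N.dev a₂ n s) x‖ ≤ Θ a₁ a₂ * s ^ (-(μ + 1 / 2)) := by
  have hR := hA.R_nonneg
  set K := N.pertConst c R with hKdef
  have hK0 : 0 ≤ K := N.pertConst_nonneg hc hR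
  have hg := gradConst_nonneg d
  set C₁ := c * (betaC b δ + betaC (b + 1 / 2) δ) with hC₁
  set C₂ := K * (betaC 0 κ + gradConst d * betaC (1 / 2) κ) with hC₂
  have hb1 := betaC_nonneg b δ
  have hb2 := betaC_nonneg (b + 1 / 2) δ
  have hb3 := betaC_nonneg 0 κ
  have hb4 := betaC_nonneg (1 / 2) κ
  -- Both exponents are positive, by `b + δ - 1 < μ` and by `κ < 1` with `0 ≤ μ`. `T` does not
  -- depend on `n` or on the data.
  obtain ⟨T, hT0, hT1, hT⟩ : ∃ T : ℝ, 0 < T ∧ T < 1 ∧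
      ∀ t ∈ Ioc 0 T, C₁ * t ^ (1 - b - δ + μ) + C₂ * t ^ (1 - κ + μ) ≤ 1 := by
    have e1 : 0 < 1 - b - δ + μ := by linarith
    have e2 : 0 < 1 - κ + μ := by linarith
    have h1 : Tendsto (fun t : ℝ => C₁ * t ^ (1 - b - δ + μ) + C₂ * t ^ (1 - κ + μ)) (𝓝 0)
        (𝓝 (C₁ * 0 ^ (1 - b - δ + μ) + C₂ * 0 ^ (1 - κ + μ))) :=
      ((Real.continuousAt_rpow_const 0 _ (Or.inr e1.le)).tendsto.const_mul _).add
        ((Real.continuousAt_rpow_const 0 _ (Or.inr e2.le)).tendsto.const_mul _)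
    rw [Real.zero_rpow e1.ne', Real.zero_rpow e2.ne', mul_zero, mul_zero, add_zero] at h1
    obtain ⟨ε, hε, h2⟩ := Metric.eventually_nhds_iff.1 (h1.eventually (gt_mem_nhds one_pos))
    refine ⟨min (ε / 2) (1 / 2), by positivity, (min_le_right _ _).trans_lt (by norm_num),
      fun t ht => (h2 ?_).le⟩
    rw [Real.dist_eq, sub_zero, abs_of_pos ht.1]
    exact (ht.2.trans (min_le_left _ _)).trans_lt (by linarith)
  refine ⟨T, hT0, hT1, fun n => ?_⟩
  induction n with
  | zero =>
    intro a₁ _ a₂ _ s hs' x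
    have hz : fderiv ℝ (0 : E d → V) x = 0 := by simp
    simp only [dev_zero, Pi.zero_apply, hz, sub_self, norm_zero]
    exact ⟨mul_nonneg (hA.nonneg _ _) (Real.rpow_nonneg hs'.1.le _),
      mul_nonneg (hA.nonneg _ _) (Real.rpow_nonneg hs'.1.le _)⟩
  | succ n ih =>
    intro a₁ h₁ a₂ h₂ t ht x
    have ht0 := ht.1
    set θ := Θ a₁ a₂ with hθdef
    have hθ : 0 ≤ θ := hA.nonneg _ _
    have ra₁ := hA.reg _ h₁
    have ra₂ := hA.reg _ h₂
    let f : ℝ → E d → V := fun s y => N.app (N.picard a₁ n s) y - N.app (N.picard a₂ n s) y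
    -- `Q` is estimated only after smoothing, through `quad_sub` and `dquad_sub`; the remainder `g =
    -- f - Q` is estimated pointwise before smoothing.
    let Q : ℝ → E d → V := fun s y => N.quad (hs s a₁) y - N.quad (hs s a₂) y
    have rf1 : ∀ k, Reg k fun s => N.app (N.picard a₁ n s) := fun k =>
      N.reg_app (N.reg_picard ra₁ n (k + 1))
    have rf2 : ∀ k, Reg k fun s => N.app (N.picard a₂ n s) := fun k =>
      N.reg_app (N.reg_picard ra₂ n (k + 1))
    have rf : ∀ k, Reg k f := fun k => (rf1 k).sub (rf2 k)
    have rQ : ∀ k, Reg k Q := fun k => (N.reg_quad ((ra₁ (k + 1)).hs continuous_id)).sub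
      (N.reg_quad ((ra₂ (k + 1)).hs continuous_id))
    let g : ℝ → E d → V := fun s y => f s y - Q s y
    have rg : ∀ k, Reg k g := fun k => (rf k).sub (rQ k)
    have hgb : ∀ s ∈ Ioc 0 T, ∀ y, ‖g s y‖ ≤ K * θ * s ^ (-κ) := fun s hs' y =>
      hA.norm_source_le hc hμν hκ1 hκ2 hT1 ih h₁ h₂ hs' y
    have hsum : ∀ r s, hs r (f s) = fun y => hs r (Q s) y + hs r (g s) y := by
      intro r s
      ext1 y
      obtain ⟨C, hC⟩ := (rQ 0).tame.bdd_at s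
      obtain ⟨D, hD⟩ := (rg 0).tame.bdd_at s
      rw [← hs_add ((rQ 0).tame.cont_at s) ((rg 0).tame.cont_at s) hC hD]
      congr 1; ext z; simp [g]
    have hd : ∀ y, N.dev a₁ (n + 1) t y - N.dev a₂ (n + 1) t y = duh f t y := fun y => by
      rw [dev_succ, dev_succ, duh_sub (rf1 0).tame (rf2 0).tame]
    have hdd : fderiv ℝ (N.dev a₁ (n + 1) t) x - fderiv ℝ (N.dev a₂ (n + 1) t) x
        = fderiv ℝ (duh f t) x := by
      rw [← fderiv_sub ((N.reg_dev ra₁ _ 1).differentiable t x)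
        ((N.reg_dev ra₂ _ 1).differentiable t x)]
      congr 1; ext1 y; exact hd y
    have hst : ∀ s ∈ Ioo 0 t, s ∈ Ioc 0 T ∧ s ∈ Ioo (0 : ℝ) 1 ∧ t - s ∈ Ioo (0 : ℝ) 1 := by
      intro s hs'
      refine ⟨⟨hs'.1, hs'.2.le.trans ht.2⟩, ⟨hs'.1, ?_⟩, sub_pos.2 hs'.2, ?_⟩
      · linarith [hs'.2, ht.2]
      · linarith [hs'.1, ht.2]
    have hTt := hT t ht
    have p1 : 0 ≤ t ^ (1 - b - δ + μ) := Real.rpow_nonneg ht0.le _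
    have p2 : 0 ≤ t ^ (1 - κ + μ) := Real.rpow_nonneg ht0.le _
    constructor
    · rw [hd, ← norm_iteratedFDeriv_zero (𝕜 := ℝ) (f := duh f t)]
      have i1 := intervalIntegrable_beta (p := b) (q := δ) (by linarith) hδ ht0
      have i2 := intervalIntegrable_beta (p := 0) (q := κ) (by linarith) hκ ht0
      refine ((rf 0).norm_iteratedFDeriv_duh_le ht0.le (K := fun s =>
        c * θ * ((t - s) ^ (-b) * s ^ (-δ)) + K * θ * ((t - s) ^ (-0 : ℝ) * s ^ (-κ)))
        ((i1.const_mul _).add (i2.const_mul _)) (fun s hs' y => ?_) x).trans ?_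
      · obtain ⟨h3, h4, h5⟩ := hst s hs'
        rw [norm_iteratedFDeriv_zero, hsum]
        refine (norm_add_le _ _).trans (add_le_add (hA.quad_sub _ h₁ _ h₂ s h4 _ h5 y) ?_)
        rw [neg_zero, Real.rpow_zero, one_mul]
        exact norm_hs_le (hgb s h3) _ _
      · rw [intervalIntegral.integral_add (i1.const_mul _) (i2.const_mul _),
          intervalIntegral.integral_const_mul, intervalIntegral.integral_const_mul,
          integral_beta ht0, integral_beta ht0]
        have q1 : t ^ (1 - b - δ) = t ^ (-μ) * t ^ (1 - b - δ + μ) := by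
          rw [← Real.rpow_add ht0]; congr 1; ring
        have q2 : t ^ (1 - 0 - κ) = t ^ (-μ) * t ^ (1 - κ + μ) := by
          rw [← Real.rpow_add ht0]; congr 1; ring
        rw [q1, q2]
        have p3 : 0 ≤ t ^ (-μ) := Real.rpow_nonneg ht0.le _
        calc _ = θ * t ^ (-μ) * (c * betaC b δ * t ^ (1 - b - δ + μ)
              + K * betaC 0 κ * t ^ (1 - κ + μ)) := by ring
          _ ≤ θ * t ^ (-μ) * (C₁ * t ^ (1 - b - δ + μ) + C₂ * t ^ (1 - κ + μ)) := by
              rw [hC₁, hC₂]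
              gcongr
              · linarith
              · nlinarith
          _ ≤ θ * t ^ (-μ) * 1 := by gcongr
          _ = _ := mul_one _
    · rw [hdd, ← norm_iteratedFDeriv_zero (𝕜 := ℝ) (f := fderiv ℝ (duh f t)),
        norm_iteratedFDeriv_fderiv]
      have i1 := intervalIntegrable_beta (p := b + 1 / 2) (q := δ) (by linarith) hδ ht0
      have i2 := intervalIntegrable_beta (p := 1 / 2) (q := κ) (by norm_num) hκ ht0
      refine ((rf 1).norm_iteratedFDeriv_duh_le ht0.le (K := fun s =>
        c * θ * ((t - s) ^ (-(b + 1 / 2)) * s ^ (-δ))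
          + gradConst d * K * θ * ((t - s) ^ (-(1 / 2) : ℝ) * s ^ (-κ)))
        ((i1.const_mul _).add (i2.const_mul _)) (fun s hs' y => ?_) x).trans ?_
      · obtain ⟨h3, h4, h5⟩ := hst s hs'
        have hgd : ‖fderiv ℝ (hs (t - s) (g s)) y‖
            ≤ gradConst d * (t - s) ^ (-(1 / 2) : ℝ) * (K * θ * s ^ (-κ)) := by
          have := (rg 1).norm_iteratedFDeriv_succ_hs_le (j := 0) (s := s)
            (C := K * θ * s ^ (-κ)) (fun y => by simpa using hgb s h3 y) h5.1 y
          rwa [← norm_iteratedFDeriv_fderiv, norm_iteratedFDeriv_zero] at this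
        have hsd : fderiv ℝ (hs (t - s) (f s)) y
            = fderiv ℝ (hs (t - s) (Q s)) y + fderiv ℝ (hs (t - s) (g s)) y := by
          rw [hsum]
          exact fderiv_add (((rQ 1).hs (ρ := fun _ => t - s) continuous_const).differentiable s y)
            (((rg 1).hs (ρ := fun _ => t - s) continuous_const).differentiable s y)
        rw [← norm_iteratedFDeriv_fderiv, norm_iteratedFDeriv_zero, hsd]
        refine (norm_add_le _ _).trans (add_le_add (hA.dquad_sub _ h₁ _ h₂ s h4 _ h5 y) ?_)
        exact hgd.trans (le_of_eq (by ring))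
      · rw [intervalIntegral.integral_add (i1.const_mul _) (i2.const_mul _),
          intervalIntegral.integral_const_mul, intervalIntegral.integral_const_mul,
          integral_beta ht0, integral_beta ht0]
        have q1 : t ^ (1 - (b + 1 / 2) - δ) = t ^ (-(μ + 1 / 2)) * t ^ (1 - b - δ + μ) := by
          rw [← Real.rpow_add ht0]; congr 1; ring
        have q2 : t ^ (1 - 1 / 2 - κ) = t ^ (-(μ + 1 / 2)) * t ^ (1 - κ + μ) := by
          rw [← Real.rpow_add ht0]; congr 1; ring
        rw [q1, q2]
        have p3 : 0 ≤ t ^ (-(μ + 1 / 2)) := Real.rpow_nonneg ht0.le _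
        calc _ = θ * t ^ (-(μ + 1 / 2)) * (c * betaC (b + 1 / 2) δ * t ^ (1 - b - δ + μ)
              + K * (gradConst d * betaC (1 / 2) κ) * t ^ (1 - κ + μ)) := by ring
          _ ≤ θ * t ^ (-(μ + 1 / 2)) * (C₁ * t ^ (1 - b - δ + μ) + C₂ * t ^ (1 - κ + μ)) := by
              rw [hC₁, hC₂]
              gcongr
              · linarith
              · linarith
          _ ≤ θ * t ^ (-(μ + 1 / 2)) * 1 := by gcongr
          _ = _ := mul_one _

end Admissible

end Nonlin

end Weighted

/-! ### Limits of geometrically Cauchy sequences with all derivatives. -/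

section Limits

variable {d : ℕ} {F : Type u} [NormedAddCommGroup F] [NormedSpace ℝ F] [CompleteSpace F]

theorem reg_tsum {f : ℕ → ℝ → E d → F} (hf : ∀ n k, Reg k (f n)) {v : ℕ → ℕ → ℝ}
    (hv : ∀ k, Summable (v k)) (h : ∀ k n s x, ‖iteratedFDeriv ℝ k (f n s) x‖ ≤ v k n) (k : ℕ) :
    Reg k fun s x => ∑' n, f n s x := by
  have hc : ∀ n s, ContDiff ℝ ((⊤ : ℕ∞) : WithTop ℕ∞) (f n s) := fun n s =>
    contDiff_infty.2 fun k => (hf n k).contDiff s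
  refine Reg.of_iteratedFDeriv (fun s => (contDiff_tsum (N := (⊤ : ℕ∞)) (fun n => hc n s)
    (fun k _ => hv k) fun k n x _ => h k n s x).of_le (by exact_mod_cast le_top)) fun j _ => ?_
  have e : (fun s => iteratedFDeriv ℝ j fun x => ∑' n, f n s x)
      = fun s x => ∑' n, iteratedFDeriv ℝ j (f n s) x := funext fun s =>
    iteratedFDeriv_tsum (N := (⊤ : ℕ∞)) (fun n => hc n s) (fun k _ => hv k)
      (fun k n x _ => h k n s x) le_top
  rw [e]
  refine ⟨continuous_tsum (fun n => (hf n j).tame_iteratedFDeriv.cont) (hv j)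
    fun n p => h j n p.1 p.2, fun T => ⟨∑' n, v j n, fun s _ x => ?_⟩⟩
  exact tsum_of_norm_bounded (hv j).hasSum fun n => h j n s x

/-- A sequence of regular functions that is Cauchy at a geometric rate, with all derivatives,
converges to a regular function. -/
theorem exists_reg_limit {A : ℕ → ℝ → E d → F} (hA : ∀ n k, Reg k (A n))
    (h : ∀ k, ∃ C, ∀ n s, Bd k (fun x => A (n + 1) s x - A n s x) (C * (1 / 2) ^ n)) :
    ∃ u : ℝ → E d → F, (∀ k, Reg k u) ∧
      ∀ k, ∃ C, ∀ n s, Bd k (fun x => u s x - A n s x) (C * (1 / 2) ^ n) := by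
  choose C hC using h
  -- The limit is the telescoping series, whose tail from `i` on is the error `u - A i`.
  let D : ℕ → ℝ → E d → F := fun n s x => A (n + 1) s x - A n s x
  have hD : ∀ n k, Reg k (D n) := fun n k => (hA (n + 1) k).sub (hA n k)
  have hgeo : ∀ (c : ℝ) (i : ℕ), Summable fun n : ℕ => c * (1 / 2 : ℝ) ^ (n + i) := fun c i => by
    simp_rw [pow_add]
    exact (summable_geometric_two.mul_right _).mul_left _
  have hDb : ∀ i k n s x, ‖iteratedFDeriv ℝ k (D (n + i) s) x‖ ≤ C k * (1 / 2) ^ (n + i) :=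
    fun i k n s x => hC k (n + i) s k le_rfl x
  have hreg : ∀ i k, Reg k fun s x => ∑' n, D (n + i) s x := fun i k =>
    reg_tsum (fun n => hD (n + i)) (fun k => hgeo (C k) i) (hDb i) k
  refine ⟨fun s x => A 0 s x + ∑' n, D (n + 0) s x, fun k => (hA 0 k).add (hreg 0 k), fun k => ?_⟩
  -- The sum dominates the constants of all orders up to `k`; the factor `2` is the sum of the
  -- geometric series.
  refine ⟨∑ j ∈ Finset.range (k + 1), |C j| * 2, fun i s j hj x => ?_⟩
  have hsm : ∀ x, Summable fun n => D n s x := fun x =>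
    Summable.of_norm_bounded (hgeo (C 0) 0) fun n => by
      have := hDb 0 0 n s x
      rw [norm_iteratedFDeriv_zero] at this
      exact this
  have e : (fun x => A 0 s x + ∑' n, D (n + 0) s x - A i s x) = fun x => ∑' n, D (n + i) s x := by
    ext1 x
    have h1 := (hsm x).sum_add_tsum_nat_add i
    have h2 : ∑ n ∈ Finset.range i, D n s x = A i s x - A 0 s x :=
      Finset.sum_range_sub (fun n => A n s x) i
    rw [h2] at h1
    simp only [add_zero]
    rw [← h1]; abel
  rw [e, iteratedFDeriv_tsum (N := (⊤ : ℕ∞)) (fun n => contDiff_infty.2 fun k =>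
    (hD (n + i) k).contDiff s) (fun k _ => hgeo (C k) i) (fun k n x _ => hDb i k n s x) le_top]
  refine (tsum_of_norm_bounded (hgeo (C j) i).hasSum fun n => hDb i j n s x).trans ?_
  simp_rw [pow_add, ← mul_assoc]
  rw [tsum_mul_right, tsum_mul_left, tsum_geometric_two]
  gcongr
  calc _ ≤ |C j| * 2 := by gcongr; exact le_abs_self _
    _ ≤ _ := Finset.single_le_sum (f := fun j => |C j| * 2) (fun _ _ => by positivity)
      (Finset.mem_range.2 (by omega))

end Limits

/-! ### Convergence of the Picard iteration for a smooth datum. -/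

section PicardBounds

variable {d : ℕ} {V W : Type u} [NormedAddCommGroup V] [NormedSpace ℝ V]
  [NormedAddCommGroup W] [NormedSpace ℝ W] [CompleteSpace V]

theorem Reg.exists_bd {F : Type u} [NormedAddCommGroup F] [NormedSpace ℝ F] {f : ℝ → E d → F}
    (hf : ∀ k, Reg k f) (k : ℕ) (T : ℝ) : ∃ C, ∀ s, |s| ≤ T → Bd k (f s) C := by
  choose C hC using fun j => (hf j).tame_iteratedFDeriv.bdd T
  refine ⟨∑ j ∈ Finset.range (k + 1), |C j|, fun s hs j hj x => ?_⟩
  exact ((hC j s hs x).trans (le_abs_self _)).trans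
    (Finset.single_le_sum (f := fun j => |C j|) (fun _ _ => abs_nonneg _)
      (Finset.mem_range.2 (by omega)))

namespace Nonlin

variable {N : Nonlin d V W} {a : E d → V}

theorem norm_app_le (u : E d → V) (x : E d) {A D : ℝ} (hA : ‖u x‖ ≤ A) (hD : ‖fderiv ℝ u x‖ ≤ D) :
    ‖N.app u x‖ ≤ ‖N.b‖ * A * D + ‖N.c‖ * A * (‖N.q‖ * A * A) := by
  have hA0 := (norm_nonneg _).trans hA
  refine (norm_add_le _ _).trans (add_le_add ?_ ?_)
  · exact (N.b.le_opNorm₂ _ _).trans (by gcongr)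
  · refine (N.c.le_opNorm₂ _ _).trans ?_
    have := N.q.le_opNorm₂ (u x) (u x)
    gcongr
    exact this.trans (by gcongr)

/-- The growth bound, uniform in `n`, is fed back into the nonlinearity: every term keeps one factor
in the weighted norm and bounds the others by `C s^{-ν}`. The recursion becomes linear with an
integrable kernel, so exponential weights close it without shrinking `T`. The gradient carries the
extra weight `s^{-1/2}`. -/
theorem picard_bd_zero (ha : ∀ k, Reg k fun _ => a) {T : ℝ} (hT : T ≤ 1) {C ν : ℝ} (hC : 0 ≤ C)
    (hν0 : 0 ≤ ν) (hν : ν < 1 / 2)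
    (h : ∀ n, ∀ s ∈ Ioc 0 T, ∀ x, ‖N.picard a n s x‖ ≤ C * s ^ (-ν)) :
    ∃ M, ∀ n, ∀ s ∈ Icc 0 T, Bd 0 (N.picard a n s) M := by
  obtain ⟨Ma, hMa⟩ := Reg.exists_bd ha 1 0
  replace hMa := hMa 0 (by simp)
  have hMa0 := hMa.nonneg
  have hg := gradConst_nonneg d
  set q := ν + 1 / 2 with hq
  set K := ‖N.b‖ * C + ‖N.c‖ * ‖N.q‖ * C ^ 2 with hK
  have hK0 : 0 ≤ K := by positivity
  -- Makes the contraction factors of the bounds for the function and for its gradient both at most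
  -- `1/2`.
  set ε := 1 / (2 * (K + gradConst d * K * 2 + 1)) with hε
  have hden : 0 < K + gradConst d * K * 2 + 1 := by positivity
  have hε0 : 0 < ε := by positivity
  have hεle : (K + gradConst d * K * 2) * ε ≤ 1 / 2 := by
    rw [hε, mul_one_div, div_le_div_iff₀ (by positivity) (by norm_num)]; linarith
  have hgK : 0 ≤ gradConst d * K * 2 := by positivity
  have hε1 : K * ε ≤ 1 / 2 := le_trans (by gcongr; linarith) hεle
  have hε2 : gradConst d * K * 2 * ε ≤ 1 / 2 := le_trans (by gcongr; linarith) hεle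
  obtain ⟨l₁, hl₁, w₁⟩ := exists_exp_weight (p := 0) (q := q) le_rfl (by positivity)
    (by linarith) hε0
  obtain ⟨l₂, hl₂, w₂⟩ := exists_exp_weight (p := 1 / 2) (q := ν) (by norm_num) hν0
    (by linarith) hε0
  set l := max l₁ l₂ with hl
  have hl0 : 0 < l := hl₁.trans_le (le_max_left _ _)
  set M := 2 * Ma with hM
  have hM0 : 0 ≤ M := by positivity
  have hexp : ∀ s, 0 ≤ s → 1 ≤ Real.exp (l * s) := fun s hs => Real.one_le_exp (by positivity)
  have hs1 : ∀ s ∈ Ioc 0 T, 1 ≤ s ^ (-(1 / 2) : ℝ) := fun s hs =>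
    Real.one_le_rpow_of_pos_of_le_one_of_nonpos hs.1 (hs.2.trans hT) (by norm_num)
  have hheat : ∀ t x, ‖hs t a x‖ ≤ Ma ∧ ‖fderiv ℝ (hs t a) x‖ ≤ Ma := fun t x =>
    ⟨((ha 1).bd_hs (s := 0) hMa t).norm_le x, ((ha 1).bd_hs (s := 0) hMa t).fderiv.norm_le x⟩
  have main : ∀ n, ∀ s ∈ Ioc 0 T, ∀ x, ‖N.picard a n s x‖ ≤ M * Real.exp (l * s) ∧
      ‖fderiv ℝ (N.picard a n s) x‖ ≤ M * s ^ (-(1 / 2) : ℝ) * Real.exp (l * s) := by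
    intro n
    induction n with
    | zero =>
      intro s hs' x
      obtain ⟨h1, h2⟩ := hheat s x
      have h3 := hexp s hs'.1.le
      have h4 := hs1 s hs'
      refine ⟨h1.trans ?_, h2.trans ?_⟩
      · nlinarith
      · have : 1 ≤ s ^ (-(1 / 2) : ℝ) * Real.exp (l * s) := one_le_mul_of_one_le_of_one_le h4 h3
        nlinarith
    | succ n ih =>
      intro t ht x
      have ht0 := ht.1
      have ht1 : t ∈ Ioc (0 : ℝ) 1 := ⟨ht.1, ht.2.trans hT⟩
      obtain ⟨h1, h2⟩ := hheat t x
      have h3 := hexp t ht0.le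
      have h4 := hs1 t ht
      have rP := N.reg_picard ha n
      have rf : ∀ k, Reg k fun s => N.app (N.picard a n s) := fun k => N.reg_app (rP (k + 1))
      -- The bound is linear in `M`, and its singularity `s^{-q}` is integrable because `q = ν + 1/2
      -- < 1`.
      have hsrc : ∀ s ∈ Ioo 0 t, ∀ y, ‖N.app (N.picard a n s) y‖
          ≤ K * M * (s ^ (-q) * Real.exp (l * s)) := by
        intro s hs' y
        have hsT : s ∈ Ioc 0 T := ⟨hs'.1, hs'.2.le.trans ht.2⟩
        have hs1' : s ≤ 1 := hsT.2.trans hT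
        obtain ⟨i1, i2⟩ := ih s hsT y
        have i3 := h n s hsT y
        have hν' : 0 ≤ s ^ (-ν) := Real.rpow_nonneg hs'.1.le _
        have e1 : s ^ (-ν) * s ^ (-(1 / 2) : ℝ) = s ^ (-q) := by
          rw [← Real.rpow_add hs'.1]; congr 1; rw [hq]; ring
        have e2 : s ^ (-ν) * s ^ (-ν) ≤ s ^ (-q) := by
          rw [← Real.rpow_add hs'.1]
          exact Real.rpow_le_rpow_of_exponent_ge hs'.1 hs1' (by rw [hq]; linarith)
        have hu0 := norm_nonneg (N.picard a n s y)
        have hexp0 := Real.exp_pos (l * s)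
        refine (norm_app_le _ _ le_rfl le_rfl).trans ?_
        have t1 : ‖N.picard a n s y‖ * ‖fderiv ℝ (N.picard a n s) y‖
            ≤ C * M * (s ^ (-q) * Real.exp (l * s)) := by
          calc _ ≤ (C * s ^ (-ν)) * (M * s ^ (-(1 / 2) : ℝ) * Real.exp (l * s)) := by gcongr
            _ = C * M * ((s ^ (-ν) * s ^ (-(1 / 2) : ℝ)) * Real.exp (l * s)) := by ring
            _ = _ := by rw [e1]
        have t2 : ‖N.picard a n s y‖ * ‖N.picard a n s y‖ * ‖N.picard a n s y‖
            ≤ C ^ 2 * M * (s ^ (-q) * Real.exp (l * s)) := by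
          calc _ ≤ (C * s ^ (-ν)) * (C * s ^ (-ν)) * (M * Real.exp (l * s)) := by gcongr
            _ = C ^ 2 * M * ((s ^ (-ν) * s ^ (-ν)) * Real.exp (l * s)) := by ring
            _ ≤ _ := by gcongr
        calc _ = ‖N.b‖ * (‖N.picard a n s y‖ * ‖fderiv ℝ (N.picard a n s) y‖)
              + ‖N.c‖ * ‖N.q‖ * (‖N.picard a n s y‖ * ‖N.picard a n s y‖ * ‖N.picard a n s y‖) := by
              ring
          _ ≤ ‖N.b‖ * (C * M * (s ^ (-q) * Real.exp (l * s)))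
              + ‖N.c‖ * ‖N.q‖ * (C ^ 2 * M * (s ^ (-q) * Real.exp (l * s))) := by gcongr
          _ = _ := by rw [hK]; ring
      obtain ⟨j1, j2⟩ := w₁ l (le_max_left _ _) t ht1
      obtain ⟨j3, j4⟩ := w₂ l (le_max_right _ _) t ht1
      simp only [neg_zero, Real.rpow_zero, one_mul] at j1 j2
      constructor
      · have hd : ‖duh (fun s => N.app (N.picard a n s)) t x‖
            ≤ K * M * (ε * Real.exp (l * t)) := by
          rw [← norm_iteratedFDeriv_zero (𝕜 := ℝ) (f := duh _ t)]
          refine ((rf 0).norm_iteratedFDeriv_duh_le ht0.le (j1.const_mul (K * M))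
            (fun s hs' y => ?_) x).trans ?_
          · rw [norm_iteratedFDeriv_zero]; exact norm_hs_le (hsrc s hs') _ _
          · rw [intervalIntegral.integral_const_mul]; gcongr
        calc _ ≤ Ma + K * M * (ε * Real.exp (l * t)) := (norm_add_le _ _).trans (add_le_add h1 hd)
          _ = Ma * 1 + K * ε * (M * Real.exp (l * t)) := by ring
          _ ≤ Ma * Real.exp (l * t) + 1 / 2 * (M * Real.exp (l * t)) := by gcongr
          _ = _ := by rw [hM]; ring
      · have hd : ‖fderiv ℝ (duh (fun s => N.app (N.picard a n s)) t) x‖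
            ≤ gradConst d * (K * M) * t ^ (-(1 / 2) : ℝ) * (2 * ε * Real.exp (l * t)) := by
          rw [← norm_iteratedFDeriv_zero (𝕜 := ℝ) (f := fderiv ℝ (duh _ t)),
            norm_iteratedFDeriv_fderiv]
          refine ((rf 1).norm_iteratedFDeriv_duh_le ht0.le ((j1.add j3).const_mul
            (gradConst d * (K * M) * t ^ (-(1 / 2) : ℝ))) (fun s hs' y => ?_) x).trans ?_
          · have hts : 0 < t - s := sub_pos.2 hs'.2
            have := (rf 1).norm_iteratedFDeriv_succ_hs_le (j := 0) (s := s)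
              (C := K * M * (s ^ (-q) * Real.exp (l * s)))
              (fun y => by simpa using hsrc s hs' y) hts y
            refine this.trans ?_
            -- The exponents of `(t - s)^{-1/2} s^{-q}` add up to at least `1`, out of reach of
            -- `exists_exp_weight`. Subadditivity of the square root pulls out the weight `t^{-1/2}`
            -- and leaves two admissible kernels.
            have k1 : t ^ (1 / 2 : ℝ) ≤ (t - s) ^ (1 / 2 : ℝ) + s ^ (1 / 2 : ℝ) := by
              have := Real.rpow_add_le_add_rpow hts.le hs'.1.le (p := 1 / 2) (by norm_num)
                (by norm_num)
              rwa [sub_add_cancel] at this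
            have k2 : (t - s) ^ (-(1 / 2) : ℝ) * s ^ (-q)
                ≤ t ^ (-(1 / 2) : ℝ) * (s ^ (-q) + (t - s) ^ (-(1 / 2) : ℝ) * s ^ (-ν)) := by
              have m1 : t ^ (-(1 / 2) : ℝ) * t ^ (1 / 2 : ℝ) = 1 := by
                rw [← Real.rpow_add ht0]; norm_num
              have m2 : (t - s) ^ (-(1 / 2) : ℝ) * (t - s) ^ (1 / 2 : ℝ) = 1 := by
                rw [← Real.rpow_add hts]; norm_num
              have m3 : s ^ (1 / 2 : ℝ) * s ^ (-q) = s ^ (-ν) := by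
                rw [← Real.rpow_add hs'.1]; congr 1; rw [hq]; ring
              have n1 : 0 ≤ t ^ (-(1 / 2) : ℝ) := Real.rpow_nonneg ht0.le _
              have n2 : 0 ≤ (t - s) ^ (-(1 / 2) : ℝ) := Real.rpow_nonneg hts.le _
              have n3 : 0 ≤ s ^ (-q) := Real.rpow_nonneg hs'.1.le _
              calc _ = t ^ (-(1 / 2) : ℝ) * t ^ (1 / 2 : ℝ)
                    * ((t - s) ^ (-(1 / 2) : ℝ) * s ^ (-q)) := by rw [m1, one_mul]
                _ ≤ t ^ (-(1 / 2) : ℝ) * ((t - s) ^ (1 / 2 : ℝ) + s ^ (1 / 2 : ℝ))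
                    * ((t - s) ^ (-(1 / 2) : ℝ) * s ^ (-q)) := by gcongr
                _ = t ^ (-(1 / 2) : ℝ) * ((t - s) ^ (-(1 / 2) : ℝ) * (t - s) ^ (1 / 2 : ℝ) * s ^ (-q)
                    + (t - s) ^ (-(1 / 2) : ℝ) * (s ^ (1 / 2 : ℝ) * s ^ (-q))) := by ring
                _ = _ := by rw [m2, m3, one_mul]
            have hexp0 := Real.exp_pos (l * s)
            calc _ = gradConst d * (K * M) * ((t - s) ^ (-(1 / 2) : ℝ) * s ^ (-q))
                  * Real.exp (l * s) := by ring
              _ ≤ gradConst d * (K * M) * (t ^ (-(1 / 2) : ℝ) * (s ^ (-q)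
                  + (t - s) ^ (-(1 / 2) : ℝ) * s ^ (-ν))) * Real.exp (l * s) := by gcongr
              _ = _ := by ring
          · rw [intervalIntegral.integral_const_mul, intervalIntegral.integral_add j1 j3]
            have n1 : 0 ≤ t ^ (-(1 / 2) : ℝ) := Real.rpow_nonneg ht0.le _
            gcongr
            linarith
        have hfd : fderiv ℝ (N.picard a (n + 1) t) x = fderiv ℝ (hs t a) x
            + fderiv ℝ (duh (fun s => N.app (N.picard a n s)) t) x :=
          fderiv_add (((ha 1).hs (ρ := fun _ => t) continuous_const).differentiable t x)
            ((rf 1).duh.differentiable t x)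
        rw [hfd]
        have n1 : 0 ≤ t ^ (-(1 / 2) : ℝ) := Real.rpow_nonneg ht0.le _
        calc _ ≤ Ma + gradConst d * (K * M) * t ^ (-(1 / 2) : ℝ) * (2 * ε * Real.exp (l * t)) :=
              (norm_add_le _ _).trans (add_le_add h2 hd)
          _ = Ma * (1 * 1) + gradConst d * K * 2 * ε
              * (M * t ^ (-(1 / 2) : ℝ) * Real.exp (l * t)) := by ring
          _ ≤ Ma * (t ^ (-(1 / 2) : ℝ) * Real.exp (l * t)) + 1 / 2
              * (M * t ^ (-(1 / 2) : ℝ) * Real.exp (l * t)) := by gcongr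
          _ = _ := by rw [hM]; ring
  refine ⟨M * Real.exp (l * 1), fun n s hs' => bd_zero_iff.2 fun x => ?_⟩
  rcases hs'.1.eq_or_lt with rfl | hs0
  · rw [picard_at_zero]
    have := hMa.norm_le x
    have := hexp 1 zero_le_one
    nlinarith
  · refine (main n s ⟨hs0, hs'.2⟩ x).1.trans ?_
    have := hs'.2.trans hT
    gcongr

/-- The nonlinearity is linear in its `C^{m+1}` argument once the `C^m` norm is bounded, and
Duhamel's integral regains the derivative with a small constant. -/
theorem picard_bd_succ (ha : ∀ k, Reg k fun _ => a) {T : ℝ} (hT : T ≤ 1) {m : ℕ} {M : ℝ}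
    (h : ∀ n, ∀ s ∈ Icc 0 T, Bd m (N.picard a n s) M) :
    ∃ M', ∀ n, ∀ s ∈ Icc 0 T, Bd (m + 1) (N.picard a n s) M' := by
  rcases lt_or_ge T 0 with hT0 | hT0
  · exact ⟨0, fun n s hs' => absurd (hs'.1.trans hs'.2) (not_le.2 hT0)⟩
  obtain ⟨Ma, hMa⟩ := Reg.exists_bd ha (m + 1) 0
  replace hMa := hMa 0 (by simp)
  have hMa0 := hMa.nonneg
  have hM0 : 0 ≤ M := (h 0 0 ⟨le_rfl, hT0⟩).nonneg
  set K := N.const m with hK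
  have hK0 : 0 ≤ K := N.const_nonneg m
  set ε := 1 / (2 * (K * M + 1)) with hε
  have hε0 : 0 < ε := by positivity
  have hε1 : ε * (K * M) ≤ 1 / 2 := by
    rw [hε, one_div_mul_eq_div, div_le_div_iff₀ (by positivity) (by norm_num)]; linarith
  obtain ⟨l, hl0, hl⟩ := exists_exp_bd_duh (d := d) (F := V) hε0
  set M' := 2 * (Ma + ε * (K * M ^ 3)) with hM'
  have hM'0 : 0 ≤ M' := by positivity
  have hMaM' : Ma ≤ M' := by
    have : 0 ≤ ε * (K * M ^ 3) := by positivity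
    linarith
  have hexp : ∀ s, 0 ≤ s → 1 ≤ Real.exp (l * s) := fun s hs => Real.one_le_exp (by positivity)
  have hheat : ∀ t, Bd (m + 1) (hs t a) Ma := fun t => (ha (m + 1)).bd_hs (s := 0) hMa t
  have main : ∀ n, ∀ s ∈ Ioc 0 T, Bd (m + 1) (N.picard a n s) (M' * Real.exp (l * s)) := by
    intro n
    induction n with
    | zero =>
      intro s hs'
      refine (hheat s).mono ?_
      have := hexp s hs'.1.le
      nlinarith
    | succ n ih =>
      intro t ht
      have rP := N.reg_picard ha n
      have rf : ∀ k, Reg k fun s => N.app (N.picard a n s) := fun k => N.reg_app (rP (k + 1))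
      have ht1 : t ∈ Ioc (0 : ℝ) 1 := ⟨ht.1, ht.2.trans hT⟩
      have hsrc : ∀ s ∈ Ioo 0 t, Bd m (N.app (N.picard a n s))
          (K * (M * M' + M ^ 3) * Real.exp (l * s)) := by
        intro s hs'
        have hsT : s ∈ Ioc 0 T := ⟨hs'.1, hs'.2.le.trans ht.2⟩
        have hneg : ∀ {k : ℕ} {D : ℝ}, Bd k (N.picard a n s) D →
            Bd k (fun x => (0 : E d → V) x - N.picard a n s x) D := by
          intro k D hD j hj x
          have e : (fun x => (0 : E d → V) x - N.picard a n s x) = -N.picard a n s := by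
            ext x; simp
          rw [e, iteratedFDeriv_neg_apply, norm_neg]
          exact hD j hj x
        have hz : ∀ {k : ℕ} {D : ℝ}, 0 ≤ D → Bd k (0 : E d → V) D := by
          intro k D hD j _ x
          have : iteratedFDeriv ℝ j (0 : E d → V) = 0 := iteratedFDeriv_fun_zero
          rw [this]; simpa using hD
        -- Taking `u = 0` allows `M₁ = 0`, so the estimate involves no product of two `C^{m+1}`
        -- norms.
        have hb := N.bd_app_sub (m := m) (u := (0 : E d → V)) (v := N.picard a n s)
          contDiff_const ((rP (m + 1)).contDiff s) (hneg (h n s ⟨hs'.1.le, hsT.2⟩))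
          (hneg (ih s hsT)) (hz hM0) (h n s ⟨hs'.1.le, hsT.2⟩) (hz le_rfl)
        rw [app_zero] at hb
        have hb' : Bd m (N.app (N.picard a n s))
            (K * (M * 0 + M * (M' * Real.exp (l * s)) + M ^ 2 * M)) := by
          intro j hj x
          have := hb j hj x
          have e : (fun x => (0 : E d → V) x - N.app (N.picard a n s) x)
              = -N.app (N.picard a n s) := by ext x; simp
          rwa [e, iteratedFDeriv_neg_apply, norm_neg] at this
        refine hb'.mono ?_
        have := hexp s hs'.1.le
        calc _ = K * (M * M' * Real.exp (l * s) + M ^ 3 * 1) := by ring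
          _ ≤ K * (M * M' * Real.exp (l * s) + M ^ 3 * Real.exp (l * s)) := by gcongr
          _ = _ := by ring
      have hd := hl m _ rf t ht1 _ (by positivity) hsrc
      have := (hheat t).add (((ha (m + 1)).hs (ρ := fun _ => t) continuous_const).contDiff t)
        ((rf (m + 1)).duh.contDiff t) hd
      refine this.mono ?_
      have he := hexp t ht.1.le
      calc _ = Ma * 1 + (ε * (K * M)) * (M' * Real.exp (l * t))
            + ε * (K * M ^ 3) * Real.exp (l * t) := by ring
        _ ≤ Ma * Real.exp (l * t) + 1 / 2 * (M' * Real.exp (l * t))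
            + ε * (K * M ^ 3) * Real.exp (l * t) := by gcongr
        _ = _ := by rw [hM']; ring
  refine ⟨M' * Real.exp (l * 1), fun n s hs' => ?_⟩
  rcases hs'.1.eq_or_lt with rfl | hs0
  · rw [picard_at_zero]
    refine hMa.mono ?_
    have := hexp 1 zero_le_one
    nlinarith
  · refine (main n s ⟨hs0, hs'.2⟩).mono ?_
    have := hs'.2.trans hT
    gcongr

/-- With uniform bounds available, the iteration is a contraction of factor `1/2` for a suitable
exponential weight. -/
theorem picard_bd_sub (ha : ∀ k, Reg k fun _ => a) {T : ℝ} (hT : T ≤ 1) {m : ℕ} {M : ℝ}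
    (h : ∀ n, ∀ s ∈ Icc 0 T, Bd (m + 1) (N.picard a n s) M) :
    ∃ C, ∀ n, ∀ s ∈ Icc 0 T,
      Bd (m + 1) (fun x => N.picard a (n + 1) s x - N.picard a n s x) (C * (1 / 2) ^ n) := by
  rcases lt_or_ge T 0 with hT0 | hT0
  · exact ⟨0, fun n s hs' => absurd (hs'.1.trans hs'.2) (not_le.2 hT0)⟩
  have hM0 : 0 ≤ M := (h 0 0 ⟨le_rfl, hT0⟩).nonneg
  set K := N.const m with hK
  have hK0 : 0 ≤ K := N.const_nonneg m
  set ε := 1 / (2 * (K * (2 * M + M ^ 2) + 1)) with hε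
  have hε0 : 0 < ε := by positivity
  have hε1 : ε * (K * (2 * M + M ^ 2)) ≤ 1 / 2 := by
    rw [hε, one_div_mul_eq_div, div_le_div_iff₀ (by positivity) (by norm_num)]; linarith
  obtain ⟨l, hl0, hl⟩ := exists_exp_bd_duh (d := d) (F := V) hε0
  have hexp : ∀ s, 0 ≤ s → 1 ≤ Real.exp (l * s) := fun s hs => Real.one_le_exp (by positivity)
  have main : ∀ n, ∀ s ∈ Ioc 0 T,
      Bd (m + 1) (fun x => N.picard a (n + 1) s x - N.picard a n s x)
        (2 * M * (1 / 2) ^ n * Real.exp (l * s)) := by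
    intro n
    induction n with
    | zero =>
      intro s hs' j hj x
      have h1 := h 1 s ⟨hs'.1.le, hs'.2⟩ j hj x
      have h2 := h 0 s ⟨hs'.1.le, hs'.2⟩ j hj x
      have c1 := (N.reg_picard ha 1 j).contDiff s
      have c0 := (N.reg_picard ha 0 j).contDiff s
      have e : iteratedFDeriv ℝ j (fun x => N.picard a (0 + 1) s x - N.picard a 0 s x) x
          = iteratedFDeriv ℝ j (N.picard a 1 s) x - iteratedFDeriv ℝ j (N.picard a 0 s) x :=
        iteratedFDeriv_sub_apply c1.contDiffAt c0.contDiffAt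
      rw [e]
      refine (norm_sub_le _ _).trans ?_
      have := hexp s hs'.1.le
      rw [pow_zero]
      nlinarith
    | succ n ih =>
      intro t ht
      have rf : ∀ n k, Reg k fun s => N.app (N.picard a n s) := fun n k =>
        N.reg_app (N.reg_picard ha n (k + 1))
      have ht1 : t ∈ Ioc (0 : ℝ) 1 := ⟨ht.1, ht.2.trans hT⟩
      have hsrc : ∀ s ∈ Ioo 0 t, Bd m
          (fun x => N.app (N.picard a (n + 1) s) x - N.app (N.picard a n s) x)
          (K * (2 * M + M ^ 2) * (2 * M * (1 / 2) ^ n) * Real.exp (l * s)) := by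
        intro s hs'
        have hsT : s ∈ Ioc 0 T := ⟨hs'.1, hs'.2.le.trans ht.2⟩
        have hsT' : s ∈ Icc 0 T := ⟨hs'.1.le, hsT.2⟩
        refine (N.bd_app_sub ((N.reg_picard ha (n + 1) (m + 1)).contDiff s)
          ((N.reg_picard ha n (m + 1)).contDiff s) ((ih s hsT).of_le (Nat.le_succ m)) (ih s hsT)
          ((h _ s hsT').of_le (Nat.le_succ m)) ((h _ s hsT').of_le (Nat.le_succ m))
          (h _ s hsT')).mono (le_of_eq ?_)
        ring
      have hd := hl m _ (fun k => (rf (n + 1) k).sub (rf n k)) t ht1 _ (by positivity) hsrc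
      have e : (fun x => N.picard a (n + 1 + 1) t x - N.picard a (n + 1) t x)
          = duh (fun s x => N.app (N.picard a (n + 1) s) x - N.app (N.picard a n s) x) t := by
        ext1 x
        rw [duh_sub (rf (n + 1) 0).tame (rf n 0).tame]
        simp [picard]
      rw [e]
      refine hd.mono ?_
      calc _ = (ε * (K * (2 * M + M ^ 2))) * (2 * M * (1 / 2) ^ n * Real.exp (l * t)) := by ring
        _ ≤ 1 / 2 * (2 * M * (1 / 2) ^ n * Real.exp (l * t)) := by gcongr
        _ = _ := by rw [pow_succ]; ring
  refine ⟨2 * M * Real.exp (l * 1), fun n s hs' => ?_⟩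
  rcases hs'.1.eq_or_lt with rfl | hs0
  · intro j hj x
    simp only [picard_at_zero, sub_self]
    have : iteratedFDeriv ℝ j (fun _ : E d => (0 : V)) = 0 := iteratedFDeriv_fun_zero
    rw [this]
    simp only [Pi.zero_apply, norm_zero]
    positivity
  · refine (main n s ⟨hs0, hs'.2⟩).mono ?_
    have := hs'.2.trans hT
    calc _ ≤ 2 * M * (1 / 2) ^ n * Real.exp (l * 1) := by gcongr
      _ = _ := by ring

/-- The Picard iteration converges to a smooth mild solution as soon as the iterates do not blow up
too fast at time zero. -/
theorem exists_mild_solution (ha : ∀ k, Reg k fun _ => a) {T : ℝ} (hT0 : 0 < T) (hT : T ≤ 1)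
    {C ν : ℝ} (hC : 0 ≤ C) (hν0 : 0 ≤ ν) (hν : ν < 1 / 2)
    (h : ∀ n, ∀ s ∈ Ioc 0 T, ∀ x, ‖N.picard a n s x‖ ≤ C * s ^ (-ν)) :
    ∃ u : ℝ → E d → V, (∀ k, Reg k u) ∧
      (∀ t ∈ Icc 0 T, ∀ x, u t x = hs t a x + duh (fun s => N.app (u s)) t x) ∧
      ∀ k, ∃ C, ∀ n, ∀ s ∈ Icc 0 T, Bd k (fun x => u s x - N.picard a n s x) (C * (1 / 2) ^ n) := by
  have hbd : ∀ m, ∃ M, ∀ n, ∀ s ∈ Icc 0 T, Bd m (N.picard a n s) M := by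
    intro m
    induction m with
    | zero => exact picard_bd_zero ha hT hC hν0 hν h
    | succ m ih => exact picard_bd_succ ha hT ih.choose_spec
  -- The bounds hold on `[0, T]` only; freezing time outside produces paths regular on all of `ℝ`.
  let φ : ℝ → ℝ := fun s => max 0 (min s T)
  have hφc : Continuous φ := by fun_prop
  have hφ : ∀ s, φ s ∈ Icc 0 T := fun s => ⟨le_max_left _ _, max_le hT0.le (min_le_right _ _)⟩
  have hφid : ∀ s ∈ Icc 0 T, φ s = s := fun s hs' => by
    simp only [φ]; rw [min_eq_left hs'.2, max_eq_right hs'.1]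
  obtain ⟨u, hu, hlim⟩ := exists_reg_limit (A := fun n s => N.picard a n (φ s))
    (fun n k => (N.reg_picard ha n k).comp_time hφc) (fun k => by
      obtain ⟨M, hM⟩ := hbd (k + 1)
      obtain ⟨C, hC⟩ := picard_bd_sub ha hT hM
      exact ⟨C, fun n s => (hC n (φ s) (hφ s)).of_le (Nat.le_succ k)⟩)
  have hlim' : ∀ k, ∃ C, ∀ n, ∀ s ∈ Icc 0 T,
      Bd k (fun x => u s x - N.picard a n s x) (C * (1 / 2) ^ n) := fun k =>
    (hlim k).imp fun C hC n s hs' => by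
      have := hC n s
      rwa [hφid s hs'] at this
  refine ⟨u, hu, fun t ht x => ?_, hlim'⟩
  obtain ⟨C₁, hC₁⟩ := hlim' 1
  obtain ⟨M₀, hM₀⟩ := hbd 0
  obtain ⟨M₁, hM₁⟩ := Reg.exists_bd hu 1 T
  have hM₁' : ∀ s ∈ Icc 0 T, Bd 1 (u s) M₁ := fun s hs' =>
    hM₁ s (by rw [abs_of_nonneg hs'.1]; exact hs'.2)
  have h0T : (0 : ℝ) ∈ Icc 0 T := ⟨le_rfl, hT0.le⟩
  have hM₀0 := (hM₀ 0 0 h0T).nonneg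
  have hM₁0 := (hM₁' 0 h0T).nonneg
  set M := max M₀ M₁
  set c := N.const 0 * (C₁ * M₁ + M * C₁ + M ^ 2 * C₁) with hc
  have rfu : ∀ k, Reg k fun s => N.app (u s) := fun k => N.reg_app (hu (k + 1))
  have rfn : ∀ n k, Reg k fun s => N.app (N.picard a n s) := fun n k =>
    N.reg_app (N.reg_picard ha n (k + 1))
  have hpow : Tendsto (fun n : ℕ => (1 / 2 : ℝ) ^ n) atTop (𝓝 0) :=
    tendsto_pow_atTop_nhds_zero_of_lt_one (by norm_num) (by norm_num)
  have hd : ∀ n, ‖duh (fun s => N.app (u s)) t x - duh (fun s => N.app (N.picard a n s)) t x‖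
      ≤ t * c * (1 / 2) ^ n := by
    intro n
    rw [← duh_sub (rfu 0).tame (rfn n 0).tame, ← norm_iteratedFDeriv_zero (𝕜 := ℝ) (f := duh _ t)]
    refine (((rfu 0).sub (rfn n 0)).norm_iteratedFDeriv_duh_le ht.1
      (K := fun _ => c * (1 / 2) ^ n) intervalIntegrable_const (fun s hs' y => ?_) x).trans ?_
    · rw [norm_iteratedFDeriv_zero]
      have hsT : s ∈ Icc 0 T := ⟨hs'.1.le, hs'.2.le.trans ht.2⟩
      refine norm_hs_le (fun y => ?_) _ y
      have hb := N.bd_app_sub (m := 0) (by simpa using (hu 1).contDiff s)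
        (by simpa using (N.reg_picard ha n 1).contDiff s)
        ((hC₁ n s hsT).of_le zero_le_one) (hC₁ n s hsT)
        (((hM₁' s hsT).of_le zero_le_one).mono (le_max_right M₀ M₁))
        ((hM₀ n s hsT).mono (le_max_left M₀ M₁)) (hM₁' s hsT)
      refine (hb.norm_le y).trans (le_of_eq ?_)
      rw [hc]; ring
    · rw [intervalIntegral.integral_const, sub_zero, smul_eq_mul, hc]
      exact le_of_eq (by ring)
  have hpow' : ∀ r : ℝ, Tendsto (fun n : ℕ => r * (1 / 2 : ℝ) ^ n) atTop (𝓝 0) := fun r => by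
    have := hpow.const_mul r
    rwa [mul_zero] at this
  have l1 : Tendsto (fun n => duh (fun s => N.app (N.picard a n s)) t x) atTop
      (𝓝 (duh (fun s => N.app (u s)) t x)) := by
    rw [tendsto_iff_norm_sub_tendsto_zero]
    refine squeeze_zero (fun _ => norm_nonneg _) (fun n => ?_) (hpow' (t * c))
    rw [norm_sub_rev]; exact hd n
  have l2 : Tendsto (fun n => N.picard a n t x) atTop (𝓝 (u t x)) := by
    rw [tendsto_iff_norm_sub_tendsto_zero]
    refine squeeze_zero (fun _ => norm_nonneg _) (fun n => ?_) (hpow' C₁)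
    rw [norm_sub_rev]; exact (hC₁ n t ht).norm_le x
  exact tendsto_nhds_unique (l2.comp (tendsto_add_atTop_nat 1)) (l1.const_add (hs t a x))

end Nonlin

end PicardBounds

/-! ### Uniqueness and parabolic smoothing of solutions. -/

section Solutions

variable {d : ℕ} {V W : Type u} [NormedAddCommGroup V] [NormedSpace ℝ V]
  [NormedAddCommGroup W] [NormedSpace ℝ W]

theorem Bd.neg {k : ℕ} {f : E d → V} {C : ℝ} (h : Bd k f C) : Bd k (fun x => -f x) C := by
  intro j hj x
  have := iteratedFDeriv_neg_apply (𝕜 := ℝ) (i := j) (f := f) (x := x)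
  rw [show (fun x => -f x) = -f from rfl, this, norm_neg]
  exact h j hj x

theorem Bd.sub_comm {k : ℕ} {f g : E d → V} {C : ℝ} (h : Bd k (fun x => f x - g x) C) :
    Bd k (fun x => g x - f x) C := by
  simpa using h.neg

namespace Nonlin

variable (N : Nonlin d V W)

/-- Smooth classical solutions of `∂ₜ u = Δ u + N(u)` on `[0, T]`. -/
structure IsSol (T : ℝ) (u : ℝ → E d → V) : Prop where
  reg : ∀ k, Reg k u
  eqn : ∀ s ∈ Icc 0 T, ∀ x,
    HasDerivWithinAt (fun r => u r x) (lap (u s) x + N.app (u s) x) (Icc 0 T) s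

variable {N}

namespace IsSol

variable {T : ℝ} {u v : ℝ → E d → V}

theorem shift (hu : N.IsSol T u) {t₀ : ℝ} (ht₀ : 0 ≤ t₀) :
    N.IsSol (T - t₀) fun s => u (t₀ + s) := by
  refine ⟨fun k => (hu.reg k).comp_time (by fun_prop), fun s hs' x => ?_⟩
  have h1 := hu.eqn (t₀ + s) ⟨by linarith [hs'.1], by linarith [hs'.2]⟩ x
  have h2 : HasDerivWithinAt (fun s : ℝ => t₀ + s) 1 (Icc 0 (T - t₀)) s :=
    ((hasDerivAt_id s).const_add t₀).hasDerivWithinAt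
  have h3 := h1.scomp s h2 (fun r hr => ⟨by linarith [hr.1], by linarith [hr.2]⟩)
  rw [one_smul] at h3
  exact h3

theorem mono (hu : N.IsSol T u) {T' : ℝ} (hT : T' ≤ T) : N.IsSol T' u :=
  ⟨hu.reg, fun s hs' x => (hu.eqn s ⟨hs'.1, hs'.2.trans hT⟩ x).mono (Icc_subset_Icc_right hT)⟩

theorem reg_app (hu : N.IsSol T u) (k : ℕ) : Reg k fun s => N.app (u s) := N.reg_app (hu.reg (k + 1))

variable [CompleteSpace V]

theorem mild (hu : N.IsSol T u) {t : ℝ} (ht : t ∈ Icc 0 T) (x : E d) :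
    u t x = hs t (u 0) x + duh (fun s => N.app (u s)) t x :=
  eq_hs_add_duh (hu.reg 2) (hu.reg_app 0).tame
    (fun s hs' x => (hu.eqn s ⟨hs'.1.le, hs'.2.le⟩ x).hasDerivAt (Icc_mem_nhds hs'.1 hs'.2)) ht x

theorem of_mild {a : E d → V} (ha : ∀ k, Reg k fun _ => a) (hu : ∀ k, Reg k u)
    (h : ∀ t ∈ Icc 0 T, ∀ x, u t x = hs t a x + duh (fun s => N.app (u s)) t x) :
    N.IsSol T u := by
  refine ⟨hu, fun t ht x => ?_⟩
  have h1 := hasDerivWithinAt_hs_add_duh (ha 2) (N.reg_app (hu 3)) ht x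
  have e : (fun y => hs t a y + duh (fun s => N.app (u s)) t y) = u t :=
    funext fun y => (h t ht y).symm
  rw [e] at h1
  exact h1.congr_of_mem (fun s hs' => h s hs' x) ht

theorem sub_mild (hu : N.IsSol T u) (hv : N.IsSol T v) {t : ℝ} (ht : t ∈ Icc 0 T) :
    (fun x => u t x - v t x) = fun x => hs t (fun y => u 0 y - v 0 y) x
      + duh (fun s y => N.app (u s) y - N.app (v s) y) t x := by
  ext1 x
  obtain ⟨C, hC⟩ := (hu.reg 0).tame.bdd_at 0
  obtain ⟨D, hD⟩ := (hv.reg 0).tame.bdd_at 0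
  rw [hu.mild ht, hv.mild ht, duh_sub (hu.reg_app 0).tame (hv.reg_app 0).tame,
    hs_sub ((hu.reg 0).tame.cont_at 0) ((hv.reg 0).tame.cont_at 0) hC hD]
  abel

/-- The exponentially weighted `C^1` norm of the difference is at most half of itself. The condition
`T ≤ 1` comes from the Duhamel estimates. -/
theorem unique (hT : T ≤ 1) (hu : N.IsSol T u) (hv : N.IsSol T v) (h0 : u 0 = v 0) {t : ℝ}
    (ht : t ∈ Icc 0 T) : u t = v t := by
  rcases ht.1.eq_or_lt with rfl | ht0
  · exact h0
  obtain ⟨M₁, hM₁⟩ := Reg.exists_bd hu.reg 1 T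
  obtain ⟨M₂, hM₂⟩ := Reg.exists_bd hv.reg 1 T
  set M := max M₁ M₂
  have hMu : ∀ s ∈ Icc 0 T, Bd 1 (u s) M := fun s hs' =>
    (hM₁ s (by rw [abs_of_nonneg hs'.1]; exact hs'.2)).mono (le_max_left _ _)
  have hMv : ∀ s ∈ Icc 0 T, Bd 1 (v s) M := fun s hs' =>
    (hM₂ s (by rw [abs_of_nonneg hs'.1]; exact hs'.2)).mono (le_max_right _ _)
  have hM0 : 0 ≤ M := (hMu t ht).nonneg
  set K := N.const 0 with hK
  have hK0 : 0 ≤ K := N.const_nonneg 0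
  set ε := 1 / (2 * (K * (2 * M + M ^ 2) + 1)) with hε
  have hε0 : 0 < ε := by positivity
  have hε1 : ε * (K * (2 * M + M ^ 2)) ≤ 1 / 2 := by
    rw [hε, one_div_mul_eq_div, div_le_div_iff₀ (by positivity) (by norm_num)]; linarith
  obtain ⟨l, hl0, hl⟩ := exists_exp_bd_duh (d := d) (F := V) hε0
  have main : ∀ n : ℕ, ∀ s ∈ Ioc 0 T,
      Bd 1 (fun x => u s x - v s x) (2 * M * (1 / 2) ^ n * Real.exp (l * s)) := by
    intro n
    induction n with
    | zero =>
      intro s hs'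
      have hsT : s ∈ Icc 0 T := ⟨hs'.1.le, hs'.2⟩
      have := (hMu s hsT).add ((hu.reg 1).contDiff s) ((hv.reg 1).contDiff s).neg (hMv s hsT).neg
      simp only [← sub_eq_add_neg] at this
      refine this.mono ?_
      have : 1 ≤ Real.exp (l * s) := Real.one_le_exp (mul_nonneg hl0.le hs'.1.le)
      rw [pow_zero]
      nlinarith
    | succ n ih =>
      intro s hs'
      have hsT : s ∈ Icc 0 T := ⟨hs'.1.le, hs'.2⟩
      have hsrc : ∀ r ∈ Ioo 0 s, Bd 0 (fun x => N.app (u r) x - N.app (v r) x)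
          (K * (2 * M + M ^ 2) * (2 * M * (1 / 2) ^ n) * Real.exp (l * r)) := by
        intro r hr
        have hrT : r ∈ Ioc 0 T := ⟨hr.1, hr.2.le.trans hs'.2⟩
        have hrT' : r ∈ Icc 0 T := ⟨hr.1.le, hrT.2⟩
        refine (N.bd_app_sub (m := 0) (by simpa using (hu.reg 1).contDiff r)
          (by simpa using (hv.reg 1).contDiff r) ((ih r hrT).of_le zero_le_one) (ih r hrT)
          ((hMu r hrT').of_le zero_le_one) ((hMv r hrT').of_le zero_le_one)
          (hMu r hrT')).mono (le_of_eq ?_)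
        ring
      have hd := hl 0 _ (fun k => (hu.reg_app k).sub (hv.reg_app k)) s ⟨hs'.1, hs'.2.trans hT⟩ _
        (by positivity) hsrc
      have e : (fun x => u s x - v s x) = duh (fun s y => N.app (u s) y - N.app (v s) y) s := by
        rw [hu.sub_mild hv hsT, h0]
        ext1 x
        have : hs s (fun y => v 0 y - v 0 y) x = 0 := by simp [hs]
        rw [this, zero_add]
      rw [e]
      refine hd.mono ?_
      calc _ = (ε * (K * (2 * M + M ^ 2))) * (2 * M * (1 / 2) ^ n * Real.exp (l * s)) := by ring
        _ ≤ 1 / 2 * (2 * M * (1 / 2) ^ n * Real.exp (l * s)) := by gcongr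
        _ = _ := by rw [pow_succ]; ring
  ext1 x
  rw [← sub_eq_zero, ← norm_le_zero_iff]
  have hlim : Tendsto (fun n : ℕ => 2 * M * (1 / 2 : ℝ) ^ n * Real.exp (l * t)) atTop (𝓝 0) := by
    have := ((tendsto_pow_atTop_nhds_zero_of_lt_one (r := (1 / 2 : ℝ)) (by norm_num)
      (by norm_num)).const_mul (2 * M)).mul_const (Real.exp (l * t))
    rwa [mul_zero, zero_mul] at this
  exact ge_of_tendsto' hlim fun n => (main n t ⟨ht0, ht.2⟩).norm_le x

/-- The weight `s^{-1/2}` is the price of gaining one derivative on the initial difference. The term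
with the top derivative of `u - v` reproduces this weight with a factor at most `1/2` when `s ≤ τ`,
and `τ` depends only on the `C^m` bound `M` once `N`, `d` and `m` are fixed. -/
theorem bd_sub_rpow (m : ℕ) {M M₁ : ℝ} (hM : 0 ≤ M) (hM₁ : 0 ≤ M₁) :
    ∃ τ C : ℝ, 0 < τ ∧ 0 ≤ C ∧ ∀ (T : ℝ) (u v : ℝ → E d → V), T ≤ 1 → T ≤ τ → N.IsSol T u →
      N.IsSol T v → (∀ s ∈ Icc 0 T, Bd m (u s) M) → (∀ s ∈ Icc 0 T, Bd m (v s) M) →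
      (∀ s ∈ Icc 0 T, Bd (m + 1) (u s) M₁) → ∀ w₀, (∀ s ∈ Icc 0 T, Bd m (fun x => u s x - v s x) w₀) →
      ∀ s ∈ Ioc 0 T, Bd (m + 1) (fun x => u s x - v s x) (C * w₀ * s ^ (-(1 / 2) : ℝ)) := by
  set K := N.const m with hK
  have hK0 : 0 ≤ K := N.const_nonneg m
  set h := 1 + gradConst d with hh
  have hh0 : 0 < h := by linarith [gradConst_nonneg d]
  set β := betaC (1 / 2) (1 / 2) with hβ
  have hβ0 : 0 ≤ β := betaC_nonneg _ _
  set C₀ := h + h * β * (K * (M₁ + M ^ 2)) with hC₀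
  have hC₀0 : 0 ≤ C₀ := by positivity
  set y := 1 / (2 * (h * β * (K * M) + 1)) with hy
  have hy0 : 0 < y := by positivity
  have hy1 : h * β * (K * M) * y ≤ 1 / 2 := by
    rw [hy, mul_one_div, div_le_div_iff₀ (by positivity) (by norm_num)]; linarith
  refine ⟨y ^ 2, 2 * C₀, by positivity, by positivity, ?_⟩
  intro T u v hT hTτ hu hv hMu hMv hM₁u w₀ hw₀ s hs'
  have hw₀0 : 0 ≤ w₀ := (hw₀ s ⟨hs'.1.le, hs'.2⟩).nonneg
  have hreg : ∀ k, Reg k fun s x => u s x - v s x := fun k => (hu.reg k).sub (hv.reg k)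
  -- `Φ` is a merely qualitative bound that starts the iteration; it is halved at every step and
  -- disappears in the limit.
  obtain ⟨Φ, hΦ⟩ := Reg.exists_bd hreg (m + 1) T
  have hΦ0 : 0 ≤ Φ := (hΦ s (by rw [abs_of_pos hs'.1]; exact hs'.2)).nonneg
  have main : ∀ n : ℕ, ∀ s ∈ Ioc 0 T, Bd (m + 1) (fun x => u s x - v s x)
      ((2 * C₀ * w₀ + Φ * (1 / 2) ^ n) * s ^ (-(1 / 2) : ℝ)) := by
    intro n
    induction n with
    | zero =>
      intro s hs'
      refine (hΦ s (by rw [abs_of_pos hs'.1]; exact hs'.2)).mono ?_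
      have h1 : 1 ≤ s ^ (-(1 / 2) : ℝ) :=
        Real.one_le_rpow_of_pos_of_le_one_of_nonpos hs'.1 (hs'.2.trans hT) (by norm_num)
      have h2 : 0 ≤ 2 * C₀ * w₀ := by positivity
      rw [pow_zero]
      nlinarith
    | succ n ih =>
      intro s hs'
      have hsT : s ∈ Icc 0 T := ⟨hs'.1.le, hs'.2⟩
      set A := 2 * C₀ * w₀ + Φ * (1 / 2) ^ n with hA
      have hA0 : 0 ≤ A := by positivity
      have hs1 : 1 ≤ s ^ (-(1 / 2) : ℝ) :=
        Real.one_le_rpow_of_pos_of_le_one_of_nonpos hs'.1 (hs'.2.trans hT) (by norm_num)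
      have hsrc : ∀ r ∈ Ioo 0 s, Bd m (fun x => N.app (u r) x - N.app (v r) x)
          ((K * (M₁ + M ^ 2) * w₀ + K * M * A) * r ^ (-(1 / 2) : ℝ)) := by
        intro r hr
        have hrT : r ∈ Ioc 0 T := ⟨hr.1, hr.2.le.trans hs'.2⟩
        have hrT' : r ∈ Icc 0 T := ⟨hr.1.le, hrT.2⟩
        have hr1 : 1 ≤ r ^ (-(1 / 2) : ℝ) :=
          Real.one_le_rpow_of_pos_of_le_one_of_nonpos hrT.1 (hrT.2.trans hT) (by norm_num)
        refine (N.bd_app_sub ((hu.reg (m + 1)).contDiff r) ((hv.reg (m + 1)).contDiff r)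
          (hw₀ r hrT') (ih r hrT) (hMu r hrT') (hMv r hrT') (hM₁u r hrT')).mono ?_
        calc _ = K * (M₁ + M ^ 2) * w₀ * 1 + K * M * A * r ^ (-(1 / 2) : ℝ) := by ring
          _ ≤ K * (M₁ + M ^ 2) * w₀ * r ^ (-(1 / 2) : ℝ) + K * M * A * r ^ (-(1 / 2) : ℝ) := by
            gcongr
          _ = _ := by ring
      have i1 := intervalIntegrable_beta (p := 1 / 2) (q := 1 / 2) (by norm_num) (by norm_num) hs'.1
      have ei : (fun r : ℝ => (s - r) ^ (-(1 / 2) : ℝ)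
          * ((K * (M₁ + M ^ 2) * w₀ + K * M * A) * r ^ (-(1 / 2) : ℝ)))
          = fun r => (K * (M₁ + M ^ 2) * w₀ + K * M * A)
            * ((s - r) ^ (-(1 / 2) : ℝ) * r ^ (-(1 / 2) : ℝ)) := by ext r; ring
      have hd := Reg.bd_duh (fun k => (hu.reg_app k).sub (hv.reg_app k)) ⟨hs'.1, hs'.2.trans hT⟩
        (K := fun r => (K * (M₁ + M ^ 2) * w₀ + K * M * A) * r ^ (-(1 / 2) : ℝ))
        (by rw [ei]; exact i1.const_mul _) hsrc
      rw [ei, intervalIntegral.integral_const_mul, integral_beta hs'.1,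
        show (1 : ℝ) - 1 / 2 - 1 / 2 = 0 by norm_num, Real.rpow_zero, one_mul] at hd
      have hheat : Bd (m + 1) (hs s (fun y => u 0 y - v 0 y)) (h * w₀ * s ^ (-(1 / 2) : ℝ)) := by
        have h0 := hw₀ 0 ⟨le_rfl, hsT.1.trans hsT.2⟩
        have hg := gradConst_nonneg d
        intro j hj x
        rcases hj.lt_or_eq with hj | rfl
        · calc _ ≤ w₀ := (hreg j).norm_iteratedFDeriv_hs_le (s := 0) (h0 j (by omega)) s x
            _ = 1 * w₀ * 1 := by ring
            _ ≤ _ := by gcongr; linarith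
        · calc _ ≤ gradConst d * s ^ (-(1 / 2) : ℝ) * w₀ :=
              (hreg (m + 1)).norm_iteratedFDeriv_succ_hs_le (s := 0) (h0 m le_rfl) hs'.1 x
            _ = gradConst d * w₀ * s ^ (-(1 / 2) : ℝ) := by ring
            _ ≤ _ := by gcongr; linarith
      rw [hu.sub_mild hv hsT]
      refine (hheat.add (((hreg (m + 1)).comp_time (φ := fun _ => 0) continuous_const).hs
        (ρ := fun _ => s) continuous_const |>.contDiff 0)
        (((hu.reg_app (m + 1)).sub (hv.reg_app (m + 1))).duh.contDiff s) hd).mono ?_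
      have hsy : s ^ (1 / 2 : ℝ) ≤ y := by
        calc s ^ (1 / 2 : ℝ) ≤ (y ^ 2) ^ (1 / 2 : ℝ) :=
              Real.rpow_le_rpow hs'.1.le (hs'.2.trans hTτ) (by norm_num)
          _ = y := by rw [← Real.sqrt_eq_rpow, Real.sqrt_sq hy0.le]
      have hss : s ^ (1 / 2 : ℝ) * s ^ (-(1 / 2) : ℝ) = 1 := by
        rw [← Real.rpow_add hs'.1]; norm_num
      -- Since `s ≤ y²`, a bounded term may be charged to the weight `s^{-1/2}` with the small
      -- factor `y`.
      have hone : 1 ≤ y * s ^ (-(1 / 2) : ℝ) :=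
        hss.symm.le.trans (mul_le_mul_of_nonneg_right hsy (by linarith))
      have hX : 0 ≤ h * β * (K * (M₁ + M ^ 2)) * w₀ := by positivity
      calc _ = h * w₀ * s ^ (-(1 / 2) : ℝ) + h * β * (K * (M₁ + M ^ 2)) * w₀ * 1
            + h * β * (K * M) * A * 1 := by ring
        _ ≤ h * w₀ * s ^ (-(1 / 2) : ℝ) + h * β * (K * (M₁ + M ^ 2)) * w₀ * s ^ (-(1 / 2) : ℝ)
            + h * β * (K * M) * A * (y * s ^ (-(1 / 2) : ℝ)) := by gcongr
        _ = (C₀ * w₀ + h * β * (K * M) * y * A) * s ^ (-(1 / 2) : ℝ) := by rw [hC₀]; ring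
        _ ≤ (C₀ * w₀ + 1 / 2 * A) * s ^ (-(1 / 2) : ℝ) := by gcongr
        _ = _ := by rw [hA, pow_succ]; ring
  intro j hj x
  have hlim : Tendsto (fun n : ℕ => (2 * C₀ * w₀ + Φ * (1 / 2 : ℝ) ^ n) * s ^ (-(1 / 2) : ℝ)) atTop
      (𝓝 (2 * C₀ * w₀ * s ^ (-(1 / 2) : ℝ))) := by
    have := ((tendsto_pow_atTop_nhds_zero_of_lt_one (r := (1 / 2 : ℝ)) (by norm_num)
      (by norm_num)).const_mul Φ).const_add (2 * C₀ * w₀) |>.mul_const (s ^ (-(1 / 2) : ℝ))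
    rwa [mul_zero, add_zero] at this
  exact ge_of_tendsto' hlim fun n => main n s hs' j hj x

/-- Parabolic smoothing for differences of solutions. -/
theorem bd_succ_sub (m : ℕ) {M M₁ ε : ℝ} (hM : 0 ≤ M) (hM₁ : 0 ≤ M₁) (hε : 0 < ε) :
    ∃ C : ℝ, 0 ≤ C ∧ ∀ (T : ℝ) (u v : ℝ → E d → V), T ≤ 1 → N.IsSol T u →
      N.IsSol T v → (∀ s ∈ Icc 0 T, Bd m (u s) M) → (∀ s ∈ Icc 0 T, Bd m (v s) M) →
      (∀ s ∈ Icc 0 T, Bd (m + 1) (u s) M₁) → ∀ w₀, (∀ s ∈ Icc 0 T, Bd m (fun x => u s x - v s x) w₀) →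
      ∀ s ∈ Icc ε T, Bd (m + 1) (fun x => u s x - v s x) (C * w₀) := by
  obtain ⟨τ, C, hτ, hC, h⟩ := bd_sub_rpow (N := N) m hM hM₁
  -- Restarting at time `s - r` fixes the elapsed time, so the factor `r^{-1/2}` is uniform in `s`.
  set r := min τ ε with hr
  have hr0 : 0 < r := lt_min hτ hε
  refine ⟨C * r ^ (-(1 / 2) : ℝ), mul_nonneg hC (Real.rpow_nonneg hr0.le _), ?_⟩
  intro T u v hT hu hv hMu hMv hM₁u w₀ hw₀ s hs'
  have hrs : r ≤ s := (min_le_right _ _).trans hs'.1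
  have h0 : 0 ≤ s - r := by linarith
  have hI : ∀ σ ∈ Icc 0 r, s - r + σ ∈ Icc 0 T := fun σ hσ =>
    ⟨by linarith [hσ.1], by linarith [hσ.2, hs'.2]⟩
  have hrT : r ≤ T - (s - r) := by linarith [hs'.2]
  have := h r (fun σ => u (s - r + σ)) (fun σ => v (s - r + σ)) (by linarith [hs'.2])
    (min_le_left _ _) ((hu.shift h0).mono hrT) ((hv.shift h0).mono hrT)
    (fun σ hσ => hMu _ (hI σ hσ)) (fun σ hσ => hMv _ (hI σ hσ)) (fun σ hσ => hM₁u _ (hI σ hσ)) w₀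
    (fun σ hσ => hw₀ _ (hI σ hσ)) r ⟨hr0, le_rfl⟩
  simp only [sub_add_cancel] at this
  exact this.mono (le_of_eq (by ring))

/-- Lipschitz bounds for a family of solutions in `C^1` at positive times improve to `C^k`. -/
theorem bd_sub_of_bd_one {ι : Type*} {U : ι → ℝ → E d → V} (hT : T ≤ 1)
    (hU : ∀ i, N.IsSol T (U i)) {θ : ι → ι → ℝ} (hθ : ∀ i j, 0 ≤ θ i j) {o : ι}
    (ho : ∀ s ∈ Icc 0 T, U o s = 0) {R : ℝ} (hR : ∀ i, θ o i ≤ R)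
    (h1 : ∀ ε > 0, ∃ C, ∀ i j, ∀ s ∈ Icc ε T, Bd 1 (fun x => U i s x - U j s x) (C * θ i j))
    (k : ℕ) (ε : ℝ) (hε : 0 < ε) :
    ∃ C, ∀ i j, ∀ s ∈ Icc ε T, Bd (k + 1) (fun x => U i s x - U j s x) (C * θ i j) := by
  induction k generalizing ε with
  | zero => exact h1 ε hε
  | succ k ih =>
    -- Two smoothing steps per derivative: one from `ε/3` to `2ε/3` for a size bound, one from
    -- `2ε/3` to `ε` for the Lipschitz bound.
    have hε3 : 0 < ε / 3 := by positivity
    obtain ⟨C, hC⟩ := ih (ε / 3) hε3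
    have hR0 : 0 ≤ R := (hθ o o).trans (hR o)
    set M := |C| * R with hM
    have hM0 : 0 ≤ M := by positivity
    have hCle : ∀ i, C * θ o i ≤ M := fun i =>
      mul_le_mul (le_abs_self _) (hR i) (hθ _ _) (abs_nonneg _)
    have hbd : ∀ {m : ℕ} {D : ℝ} i, ∀ s ∈ Icc 0 T, Bd m (fun x => U o s x - U i s x) D →
        Bd m (U i s) D := fun i s hs' hb => by
      have := hb.neg
      simpa [ho s hs'] using this
    have hU0 : ∀ i, ∀ s ∈ Icc (ε / 3) T, Bd (k + 1) (U i s) M := fun i s hs' =>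
      hbd i s ⟨hε3.le.trans hs'.1, hs'.2⟩ ((hC o i s hs').mono (hCle i))
    -- Comparison with the zero solution, which has `M₁ = 0`; it supplies the higher norm needed
    -- when two arbitrary solutions are compared.
    obtain ⟨C₁, hC₁0, hC₁⟩ := bd_succ_sub (N := N) (k + 1) hM0 le_rfl hε3
    have hU1 : ∀ i, ∀ s ∈ Icc (2 * ε / 3) T, Bd (k + 1 + 1) (U i s) (C₁ * M) := by
      intro i s hs'
      have hI : ∀ σ ∈ Icc 0 (T - ε / 3), ε / 3 + σ ∈ Icc (ε / 3) T := fun σ hσ =>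
        ⟨by linarith [hσ.1], by linarith [hσ.2]⟩
      have := hC₁ (T - ε / 3) (fun σ => U o (ε / 3 + σ)) (fun σ => U i (ε / 3 + σ)) (by linarith)
        ((hU o).shift hε3.le) ((hU i).shift hε3.le) (fun σ hσ => hU0 _ _ (hI σ hσ))
        (fun σ hσ => hU0 _ _ (hI σ hσ)) (fun σ hσ => by
          rw [ho _ ⟨hε3.le.trans (hI σ hσ).1, (hI σ hσ).2⟩]
          intro j _ x
          have : iteratedFDeriv ℝ j (0 : E d → V) = 0 := iteratedFDeriv_fun_zero
          rw [this]; simp) M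
        (fun σ hσ => (hC o i _ (hI σ hσ)).mono (hCle i)) (s - ε / 3)
        ⟨by linarith [hs'.1], by linarith [hs'.2]⟩
      simp only [add_sub_cancel] at this
      exact hbd i s ⟨by linarith [hs'.1], hs'.2⟩ this
    obtain ⟨C₂, hC₂0, hC₂⟩ := bd_succ_sub (N := N) (k + 1) hM0 (mul_nonneg hC₁0 hM0) hε3
    refine ⟨C₂ * C, fun i j s hs' => ?_⟩
    have h23 : 0 ≤ 2 * ε / 3 := by positivity
    have hI : ∀ σ ∈ Icc 0 (T - 2 * ε / 3), 2 * ε / 3 + σ ∈ Icc (2 * ε / 3) T := fun σ hσ =>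
      ⟨by linarith [hσ.1], by linarith [hσ.2]⟩
    have hI' : ∀ σ ∈ Icc 0 (T - 2 * ε / 3), 2 * ε / 3 + σ ∈ Icc (ε / 3) T := fun σ hσ =>
      ⟨by linarith [hσ.1], by linarith [hσ.2]⟩
    have := hC₂ (T - 2 * ε / 3) (fun σ => U i (2 * ε / 3 + σ)) (fun σ => U j (2 * ε / 3 + σ))
      (by linarith) ((hU i).shift h23) ((hU j).shift h23) (fun σ hσ => hU0 _ _ (hI' σ hσ))
      (fun σ hσ => hU0 _ _ (hI' σ hσ)) (fun σ hσ => hU1 _ _ (hI σ hσ)) (C * θ i j)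
      (fun σ hσ => hC i j _ (hI' σ hσ)) (s - 2 * ε / 3)
      ⟨by linarith [hs'.1], by linarith [hs'.2]⟩
    simp only [add_sub_cancel] at this
    exact this.mono (le_of_eq (by ring))

end IsSol

end Nonlin

end Solutions

/-! ### Interpolation of the two bounds on the quadratic term. -/

section Interpolation

theorem le_rpow_mul_rpow_of_le {x K A B θ : ℝ} (hx : 0 ≤ x) (hK : 0 ≤ K) (hA : 0 ≤ A) (hB : 0 ≤ B)
    (h0 : 0 ≤ θ) (h1 : θ ≤ 1) (hxA : x ≤ K * A) (hxB : x ≤ K * B) :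
    x ≤ K * (A ^ θ * B ^ (1 - θ)) := by
  have hsum : θ + (1 - θ) = 1 := by ring
  have e : ∀ y : ℝ, 0 ≤ y → y = y ^ θ * y ^ (1 - θ) := fun y hy => by
    rw [← Real.rpow_add_of_nonneg hy h0 (by linarith), hsum, Real.rpow_one]
  calc x = x ^ θ * x ^ (1 - θ) := e x hx
    _ ≤ (K * A) ^ θ * (K * B) ^ (1 - θ) := mul_le_mul (Real.rpow_le_rpow hx hxA h0)
        (Real.rpow_le_rpow hx hxB (by linarith)) (Real.rpow_nonneg hx _)
        (Real.rpow_nonneg (mul_nonneg hK hA) _)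
    _ = (K ^ θ * K ^ (1 - θ)) * (A ^ θ * B ^ (1 - θ)) := by
        rw [Real.mul_rpow hK hA, Real.mul_rpow hK hB]; ring
    _ = _ := by rw [← e K hK]

/-- The last two conclusions say `(-1/2 - η) / (1/2 - η - δ) < θ < (1 + η) / (-β)`, and `hp` says
that this interval is nonempty. Its lower end is below `1` because `δ < 1`. -/
theorem exists_interpolation_exponent {η β δ : ℝ} (hη : η < -1 / 2) (hβ : β < 0) (hδ : δ < 1)
    (hp : β * (2 * η + 1) < (1 + η) * (1 - 2 * η - 2 * δ)) :
    ∃ θ, 0 ≤ θ ∧ θ ≤ 1 ∧ -(θ * β) < 1 + η ∧ δ * θ + (1 / 2 - η) * (1 - θ) < 1 := by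
  have h1 : 0 < 1 / 2 - η - δ := by linarith
  have h2 : 0 < -1 / 2 - η := by linarith
  obtain ⟨θ, hθ₀, hθ⟩ := exists_between (a₁ := (-1 / 2 - η) / (1 / 2 - η - δ))
    (a₂ := min 1 ((1 + η) / -β)) (lt_min ((div_lt_one h1).2 (by linarith))
      ((div_lt_div_iff₀ h1 (by linarith)).2 (by linarith)))
  refine ⟨θ, (div_pos h2 h1).le.trans hθ₀.le, (hθ.trans_le (min_le_left _ _)).le, ?_, ?_⟩
  · have := (lt_div_iff₀ (by linarith)).1 (hθ.trans_le (min_le_right _ _))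
    linarith
  · have := (div_lt_iff₀ h1).1 hθ₀
    linarith

variable {d : ℕ} {V W : Type u} [NormedAddCommGroup V] [NormedSpace ℝ V] [CompleteSpace V]
  [NormedAddCommGroup W] [NormedSpace ℝ W]

/-- Split `P_r = P_{r/2} P_{r/2}`, using one half for the assumed bound and the other for the
gradient. -/
theorem norm_fderiv_hs_le_of_half {f : E d → V} (hf : ∀ k, Reg k fun _ => f) {r C : ℝ} (hr : 0 < r)
    (hC : ∀ x, ‖hs (r / 2) f x‖ ≤ C) (x : E d) :
    ‖fderiv ℝ (hs r f) x‖ ≤ gradConst d * (r / 2) ^ (-(1 / 2) : ℝ) * C := by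
  have h2 : 0 < r / 2 := by positivity
  have hg : ∀ k, Reg k fun _ : ℝ => hs (r / 2) f := fun k =>
    (hf k).hs (ρ := fun _ => r / 2) continuous_const
  have e : hs r f = hs (r / 2) (hs (r / 2) f) := funext fun y => by
    rw [hs_hs (hf 2) h2.le h2.le, add_halves]
  rw [e, (hg 1).fderiv_hs (r / 2) 0]
  obtain ⟨D, hD⟩ := (hg 1).fderiv.tame.bdd_at 0
  exact norm_hs_fderiv_le ((hg 1).differentiable 0) ((hg 1).fderiv.tame.cont_at 0) hC hD h2 x

namespace Nonlin

variable {N : Nonlin d V W}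

theorem norm_quad_sub_le {u v : E d → V} {x : E d} {c R Θ P H : ℝ}
    (hdu : ‖u x - v x‖ ≤ c * Θ * P) (hDu : ‖fderiv ℝ u x‖ ≤ c * R * H)
    (hv : ‖v x‖ ≤ c * R * P) (hdD : ‖fderiv ℝ u x - fderiv ℝ v x‖ ≤ c * Θ * H) :
    ‖N.quad u x - N.quad v x‖ ≤ ‖N.b‖ * 2 * c ^ 2 * R * Θ * (P * H) := by
  have h1 := (norm_nonneg _).trans hdu
  have h2 := (norm_nonneg _).trans hv
  have e : N.quad u x - N.quad v x = N.b (u x - v x) (fderiv ℝ u x)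
      + N.b (v x) (fderiv ℝ u x - fderiv ℝ v x) := by
    simp only [quad, map_sub, sub_apply]; abel
  rw [e]
  calc _ ≤ ‖N.b‖ * (c * Θ * P) * (c * R * H) + ‖N.b‖ * (c * R * P) * (c * Θ * H) :=
        (norm_add_le _ _).trans (add_le_add ((N.b.le_opNorm₂ _ _).trans (by gcongr))
          ((N.b.le_opNorm₂ _ _).trans (by gcongr)))
    _ = _ := by ring

/-- All gradient bounds follow by halving the time. The exponents of the quadratic term are those of
the geometric mean, with weight `θ`, of the hypothesis `hquad` and the pointwise product bound. -/
theorem exists_admissible {S : Set (E d → V)} {Θ : (E d → V) → (E d → V) → ℝ} {R η β δ θ : ℝ}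
    (hreg : ∀ a ∈ S, ∀ k, Reg k fun _ => a) (hzero : 0 ∈ S) (hΘ : ∀ a b, 0 ≤ Θ a b)
    (hR : ∀ a ∈ S, Θ a 0 ≤ R) (hθ0 : 0 ≤ θ) (hθ1 : θ ≤ 1)
    (hheat : ∀ a₁ ∈ S, ∀ a₂ ∈ S, ∀ s ∈ Ioo (0 : ℝ) 1, ∀ x,
      ‖hs s a₁ x - hs s a₂ x‖ ≤ Θ a₁ a₂ * s ^ (η / 2))
    (hquad : ∀ a₁ ∈ S, ∀ a₂ ∈ S, ∀ s ∈ Ioo (0 : ℝ) 1, ∀ r ∈ Ioo (0 : ℝ) 1, ∀ x,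
      ‖hs r (fun y => N.quad (hs s a₁) y - N.quad (hs s a₂) y) x‖
        ≤ Θ a₁ a₂ * (s ^ (-δ) * r ^ (β / 2))) :
    ∃ c, 0 ≤ c ∧ N.Admissible S Θ R c (-η / 2) (δ * θ + (1 / 2 - η) * (1 - θ)) (-(θ * β) / 2) := by
  have hR0 : 0 ≤ R := (hΘ _ _).trans (hR 0 hzero)
  have hg := gradConst_nonneg d
  set c₁ := 1 + gradConst d * (1 / 2) ^ (-(1 / 2) + η / 2 : ℝ) with hc₁
  have hc₁1 : 1 ≤ c₁ := by rw [hc₁]; linarith [mul_nonneg hg (Real.rpow_nonneg (by norm_num : (0:ℝ) ≤ 1 / 2) (-(1 / 2) + η / 2 : ℝ))]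
  have hc₁' : gradConst d * (1 / 2) ^ (-(1 / 2) + η / 2 : ℝ) ≤ c₁ := by rw [hc₁]; linarith
  have hhalf : ∀ {r : ℝ}, 0 < r → ∀ p q : ℝ,
      (r / 2) ^ p * (r / 2) ^ q = (1 / 2) ^ (p + q) * r ^ (p + q) := fun {r} hr p q => by
    rw [← Real.rpow_add (by positivity), div_eq_mul_one_div, Real.mul_rpow hr.le (by norm_num),
      mul_comm]
  have hH : ∀ a₁ ∈ S, ∀ a₂ ∈ S, ∀ s ∈ Ioo (0 : ℝ) 1, ∀ x,
      ‖hs s a₁ x - hs s a₂ x‖ ≤ c₁ * Θ a₁ a₂ * s ^ (-(-η / 2)) := by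
    intro a₁ h₁ a₂ h₂ s hs' x
    refine (hheat a₁ h₁ a₂ h₂ s hs' x).trans ?_
    rw [show -(-η / 2) = η / 2 by ring]
    have := hΘ a₁ a₂
    have := Real.rpow_nonneg hs'.1.le (η / 2)
    gcongr
    nlinarith
  have hsubhs : ∀ a₁ ∈ S, ∀ a₂ ∈ S, ∀ s, hs s (fun y => a₁ y - a₂ y) = fun x => hs s a₁ x - hs s a₂ x := by
    intro a₁ h₁ a₂ h₂ s
    obtain ⟨C, hC⟩ := (hreg a₁ h₁ 0).tame.bdd_at 0
    obtain ⟨D, hD⟩ := (hreg a₂ h₂ 0).tame.bdd_at 0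
    exact funext fun x => hs_sub ((hreg a₁ h₁ 0).tame.cont_at 0) ((hreg a₂ h₂ 0).tame.cont_at 0)
      hC hD s x
  have hregs : ∀ a ∈ S, ∀ s k, Reg k fun _ : ℝ => hs s a := fun a ha s k =>
    (hreg a ha k).hs (ρ := fun _ => s) continuous_const
  have hD : ∀ a₁ ∈ S, ∀ a₂ ∈ S, ∀ s ∈ Ioo (0 : ℝ) 1, ∀ x,
      ‖fderiv ℝ (hs s a₁) x - fderiv ℝ (hs s a₂) x‖ ≤ c₁ * Θ a₁ a₂ * s ^ (-(-η / 2 + 1 / 2)) := by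
    intro a₁ h₁ a₂ h₂ s hs' x
    have h2 : s / 2 ∈ Ioo (0 : ℝ) 1 := ⟨by linarith [hs'.1], by linarith [hs'.1, hs'.2]⟩
    have h := norm_fderiv_hs_le_of_half (f := fun y => a₁ y - a₂ y)
      (fun k => (hreg a₁ h₁ k).sub (hreg a₂ h₂ k)) hs'.1 (C := Θ a₁ a₂ * (s / 2) ^ (η / 2))
      (fun y => by rw [hsubhs a₁ h₁ a₂ h₂]; exact hheat a₁ h₁ a₂ h₂ _ h2 y) x
    rw [hsubhs a₁ h₁ a₂ h₂, fderiv_fun_sub ((hregs a₁ h₁ s 1).differentiable 0 x)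
      ((hregs a₂ h₂ s 1).differentiable 0 x)] at h
    refine h.trans ?_
    calc _ = gradConst d * ((s / 2) ^ (-(1 / 2) : ℝ) * (s / 2) ^ (η / 2)) * Θ a₁ a₂ := by ring
      _ = (gradConst d * (1 / 2) ^ (-(1 / 2) + η / 2 : ℝ)) * Θ a₁ a₂ * s ^ (-(1 / 2) + η / 2) := by
        rw [hhalf hs'.1]; ring
      _ ≤ c₁ * Θ a₁ a₂ * s ^ (-(1 / 2) + η / 2) := by
        have := hΘ a₁ a₂
        have := Real.rpow_nonneg hs'.1.le (-(1 / 2) + η / 2)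
        gcongr
      _ = _ := by congr 2; ring
  set c₂ := 1 + ‖N.b‖ * 2 * c₁ ^ 2 * R with hc₂
  have hc₂' : 0 ≤ ‖N.b‖ * 2 * c₁ ^ 2 * R := by positivity
  have hc₂1 : 1 ≤ c₂ := by linarith
  have hregQ : ∀ a₁ ∈ S, ∀ a₂ ∈ S, ∀ s k,
      Reg k fun _ : ℝ => fun y => N.quad (hs s a₁) y - N.quad (hs s a₂) y := fun a₁ h₁ a₂ h₂ s k =>
    (N.reg_quad (hregs a₁ h₁ s (k + 1))).sub (N.reg_quad (hregs a₂ h₂ s (k + 1)))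
  have hQ : ∀ a₁ ∈ S, ∀ a₂ ∈ S, ∀ s ∈ Ioo (0 : ℝ) 1, ∀ r ∈ Ioo (0 : ℝ) 1, ∀ x,
      ‖hs r (fun y => N.quad (hs s a₁) y - N.quad (hs s a₂) y) x‖ ≤ c₂ * Θ a₁ a₂
        * (r ^ (-(-(θ * β) / 2)) * s ^ (-(δ * θ + (1 / 2 - η) * (1 - θ)))) := by
    intro a₁ h₁ a₂ h₂ s hs' r hr x
    have hΘ' := hΘ a₁ a₂
    have p1 := Real.rpow_nonneg hs'.1.le (-δ)
    have p2 := Real.rpow_nonneg hr.1.le (β / 2)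
    have p3 := Real.rpow_nonneg hs'.1.le (-(1 / 2 - η))
    have hzs : ∀ y, hs s (0 : E d → V) y = 0 := fun y => by rw [hs_zero_fun]; rfl
    have hA : ‖hs r (fun y => N.quad (hs s a₁) y - N.quad (hs s a₂) y) x‖
        ≤ c₂ * Θ a₁ a₂ * (s ^ (-δ) * r ^ (β / 2)) := by
      refine (hquad a₁ h₁ a₂ h₂ s hs' r hr x).trans ?_
      gcongr
      nlinarith
    -- The a priori bound: no cancellation and no loss in `r`, but a power of `s` that is not
    -- integrable when `η < -1/2`.
    have hB : ‖hs r (fun y => N.quad (hs s a₁) y - N.quad (hs s a₂) y) x‖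
        ≤ c₂ * Θ a₁ a₂ * s ^ (-(1 / 2 - η)) := by
      refine norm_hs_le (fun y => ?_) r x
      have hq1 := Real.rpow_nonneg hs'.1.le (-(-η / 2))
      have hq2 := Real.rpow_nonneg hs'.1.le (-(-η / 2 + 1 / 2))
      have hv : ‖hs s a₂ y‖ ≤ c₁ * R * s ^ (-(-η / 2)) := by
        have := hH a₂ h₂ 0 hzero s hs' y
        rw [hzs, sub_zero] at this
        have := hR a₂ h₂
        exact ‹‖hs s a₂ y‖ ≤ _›.trans (by gcongr)
      have hDu : ‖fderiv ℝ (hs s a₁) y‖ ≤ c₁ * R * s ^ (-(-η / 2 + 1 / 2)) := by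
        have := hD a₁ h₁ 0 hzero s hs' y
        have hz : fderiv ℝ (0 : E d → V) y = 0 := by simp
        rw [hs_zero_fun, hz, sub_zero] at this
        have := hR a₁ h₁
        exact ‹‖fderiv ℝ (hs s a₁) y‖ ≤ _›.trans (by gcongr)
      refine (norm_quad_sub_le (hH a₁ h₁ a₂ h₂ s hs' y) hDu hv (hD a₁ h₁ a₂ h₂ s hs' y)).trans ?_
      rw [← Real.rpow_add hs'.1, show -(-η / 2) + -(-η / 2 + 1 / 2) = -(1 / 2 - η) by ring]
      gcongr
      linarith
    refine (le_rpow_mul_rpow_of_le (norm_nonneg _) (by positivity) (by positivity) p3 hθ0 hθ1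
      hA hB).trans (le_of_eq ?_)
    rw [Real.mul_rpow p1 p2, ← Real.rpow_mul hs'.1.le, ← Real.rpow_mul hr.1.le,
      ← Real.rpow_mul hs'.1.le]
    have e1 : s ^ (-(δ * θ + (1 / 2 - η) * (1 - θ)))
        = s ^ (-δ * θ) * s ^ (-(1 / 2 - η) * (1 - θ)) := by
      rw [← Real.rpow_add hs'.1]; congr 1; ring
    rw [e1, show -(-(θ * β) / 2) = β / 2 * θ by ring]
    ring
  set e := -(-(θ * β) / 2) with he
  set c₃ := c₁ + c₂ + gradConst d * (1 / 2) ^ (-(1 / 2) + e : ℝ) * c₂ with hc₃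
  have hx : 0 ≤ gradConst d * (1 / 2 : ℝ) ^ (-(1 / 2) + e : ℝ) * c₂ :=
    mul_nonneg (mul_nonneg hg (Real.rpow_nonneg (by norm_num) _)) (by linarith)
  have h13 : c₁ ≤ c₃ := by rw [hc₃]; linarith
  have h23 : c₂ ≤ c₃ := by rw [hc₃]; linarith
  have hx3 : gradConst d * (1 / 2 : ℝ) ^ (-(1 / 2) + e : ℝ) * c₂ ≤ c₃ := by rw [hc₃]; linarith
  refine ⟨c₃, by linarith, hreg, hzero, hΘ, hR, ?_, ?_, ?_, ?_⟩
  · intro a₁ h₁ a₂ h₂ s hs' x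
    refine (hH a₁ h₁ a₂ h₂ s hs' x).trans ?_
    have := hΘ a₁ a₂
    have := Real.rpow_nonneg hs'.1.le (-(-η / 2))
    gcongr
  · intro a₁ h₁ a₂ h₂ s hs' x
    refine (hD a₁ h₁ a₂ h₂ s hs' x).trans ?_
    have := hΘ a₁ a₂
    have := Real.rpow_nonneg hs'.1.le (-(-η / 2 + 1 / 2))
    gcongr
  · intro a₁ h₁ a₂ h₂ s hs' r hr x
    refine (hQ a₁ h₁ a₂ h₂ s hs' r hr x).trans ?_
    have := hΘ a₁ a₂
    have := Real.rpow_nonneg hr.1.le e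
    have := Real.rpow_nonneg hs'.1.le (-(δ * θ + (1 / 2 - η) * (1 - θ)))
    gcongr
  · intro a₁ h₁ a₂ h₂ s hs' r hr x
    have h2 : r / 2 ∈ Ioo (0 : ℝ) 1 := ⟨by linarith [hr.1], by linarith [hr.1, hr.2]⟩
    refine (norm_fderiv_hs_le_of_half (hregQ a₁ h₁ a₂ h₂ s) hr.1
      (hQ a₁ h₁ a₂ h₂ s hs' _ h2) x).trans ?_
    set X := s ^ (-(δ * θ + (1 / 2 - η) * (1 - θ)))
    have hX : 0 ≤ X := Real.rpow_nonneg hs'.1.le _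
    calc _ = gradConst d * ((r / 2) ^ (-(1 / 2) : ℝ) * (r / 2) ^ e) * c₂ * Θ a₁ a₂ * X := by ring
      _ = (gradConst d * (1 / 2) ^ (-(1 / 2) + e : ℝ) * c₂) * Θ a₁ a₂ * (r ^ (-(1 / 2) + e) * X) := by
        rw [hhalf hr.1]; ring
      _ ≤ c₃ * Θ a₁ a₂ * (r ^ (-(1 / 2) + e) * X) := by
        have := hΘ a₁ a₂
        have := Real.rpow_nonneg hr.1.le (-(1 / 2) + e)
        gcongr
      _ = _ := by rw [he]; congr 3; ring

end Nonlin

end Interpolation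

/-! ### The solution map on an admissible set of data. -/

section Flow

variable {d : ℕ} {V W : Type u} [NormedAddCommGroup V] [NormedSpace ℝ V]
  [NormedAddCommGroup W] [NormedSpace ℝ W]

theorem Bd.sub_of_approx {k : ℕ} {f g : E d → V} {φ γ : ℕ → E d → V} (hf : ContDiff ℝ k f)
    (hg : ContDiff ℝ k g) (hφ : ∀ n, ContDiff ℝ k (φ n)) (hγ : ∀ n, ContDiff ℝ k (γ n)) {A B c : ℝ}
    {C : ℕ → ℝ} (h1 : ∀ n : ℕ, Bd k (fun x => f x - φ n x) (A * (1 / 2) ^ n))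
    (h2 : ∀ n : ℕ, Bd k (fun x => g x - γ n x) (B * (1 / 2) ^ n))
    (h : ∀ n, Bd k (fun x => φ n x - γ n x) (C n)) (hC : Tendsto C atTop (𝓝 c)) :
    Bd k (fun x => f x - g x) c := by
  have key : ∀ n : ℕ, Bd k (fun x => f x - g x) ((A + B) * (1 / 2) ^ n + C n) := by
    intro n
    have e : (fun x => f x - g x)
        = fun x => ((f x - φ n x) + (γ n x - g x)) + (φ n x - γ n x) := by ext1 x; abel
    rw [e]
    refine (((h1 n).add (hf.sub (hφ n)) ((hγ n).sub hg) (h2 n).sub_comm).add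
      ((hf.sub (hφ n)).add ((hγ n).sub hg)) ((hφ n).sub (hγ n)) (h n)).mono (le_of_eq (by ring))
  intro j hj x
  have hlim : Tendsto (fun n : ℕ => (A + B) * (1 / 2 : ℝ) ^ n + C n) atTop (𝓝 c) := by
    have := ((tendsto_pow_atTop_nhds_zero_of_lt_one (r := (1 / 2 : ℝ)) (by norm_num)
      (by norm_num)).const_mul (A + B)).add hC
    rwa [mul_zero, zero_add] at this
  exact ge_of_tendsto' hlim fun n => key n j hj x

namespace Nonlin.Admissible

variable {N : Nonlin d V W} [CompleteSpace V] {S : Set (E d → V)}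
  {Θ : (E d → V) → (E d → V) → ℝ} {R c ν δ b : ℝ}

/-- The estimate on deviations gives each datum the growth bound required by `exists_mild_solution`,
with the same `T`. The `C^1` Lipschitz bounds at positive times pass to the limit of the iterates
and are then upgraded by smoothing. -/
theorem exists_flow (hA : N.Admissible S Θ R c ν δ b) (hΘ : ∀ a₁ a₂, Θ a₁ a₂ = Θ a₂ a₁)
    (hc : 0 ≤ c) {μ : ℝ} (hμ : 0 ≤ μ)
    (hμν : μ ≤ ν) (hνμ : ν + μ < 1 / 2) (hν : ν < 1 / 3) (hb : b < 1 / 2)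
    (hδ : δ < 1) (hμb : b + δ - 1 < μ) :
    ∃ T, 0 < T ∧ T < 1 ∧ ∃ U : S → ℝ → E d → V, (∀ a, N.IsSol T (U a)) ∧
      (∀ a : S, U a 0 = a) ∧ (∀ a : S, ∀ s ∈ Icc 0 T, ∀ x, Tendsto (fun n => N.picard a n s x) atTop (𝓝 (U a s x))) ∧
      ∀ k, ∀ ε > 0, ∃ C, ∀ a₁ a₂ : S, ∀ s ∈ Icc ε T,
        Bd (k + 1) (fun x => U a₁ s x - U a₂ s x) (C * Θ a₁ a₂) := by
  obtain ⟨T, hT0, hT1, hdev⟩ := hA.norm_dev_sub_le hc hμ hμν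
    (κ := max (ν + μ + 1 / 2) (3 * ν)) (le_max_left _ _) (le_max_right _ _)
    (max_lt (by linarith) (by linarith)) hb hδ hμb
  have hR := hA.R_nonneg
  have hT2 : ∀ s ∈ Ioc 0 T, s ∈ Ioo (0 : ℝ) 1 := fun s hs' => ⟨hs'.1, hs'.2.trans_lt hT1⟩
  have hpow : ∀ s ∈ Ioc 0 T, ∀ {y z : ℝ}, y ≤ z → s ^ (-y) ≤ s ^ (-z) := fun s hs' _ _ h =>
    Real.rpow_le_rpow_of_exponent_ge hs'.1 (hs'.2.trans hT1.le) (neg_le_neg h)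
  have hdiff : ∀ n, ∀ a₁ ∈ S, ∀ a₂ ∈ S, ∀ s ∈ Ioc 0 T, ∀ x,
      ‖N.picard a₁ n s x - N.picard a₂ n s x‖ ≤ (c + 1) * Θ a₁ a₂ * s ^ (-ν) ∧
      ‖fderiv ℝ (N.picard a₁ n s) x - fderiv ℝ (N.picard a₂ n s) x‖
        ≤ (c + 1) * Θ a₁ a₂ * s ^ (-(ν + 1 / 2)) := by
    intro n a₁ h₁ a₂ h₂ s hs' x
    have hΘ := hA.nonneg a₁ a₂
    obtain ⟨d1, d2⟩ := hdev n a₁ h₁ a₂ h₂ s hs' x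
    constructor
    · have e : N.picard a₁ n s x - N.picard a₂ n s x
          = (hs s a₁ x - hs s a₂ x) + (N.dev a₁ n s x - N.dev a₂ n s x) := by
        simp only [dev]; abel
      rw [e]
      calc _ ≤ c * Θ a₁ a₂ * s ^ (-ν) + Θ a₁ a₂ * s ^ (-ν) :=
            (norm_add_le _ _).trans (add_le_add (hA.heat_sub a₁ h₁ a₂ h₂ s (hT2 s hs') x)
              (d1.trans (mul_le_mul_of_nonneg_left (hpow s hs' hμν) hΘ)))
        _ = _ := by ring
    · rw [fderiv_picard (hA.reg a₁ h₁), fderiv_picard (hA.reg a₂ h₂), add_sub_add_comm]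
      calc _ ≤ c * Θ a₁ a₂ * s ^ (-(ν + 1 / 2)) + Θ a₁ a₂ * s ^ (-(ν + 1 / 2)) :=
            (norm_add_le _ _).trans (add_le_add (hA.dheat_sub a₁ h₁ a₂ h₂ s (hT2 s hs') x)
              (d2.trans (mul_le_mul_of_nonneg_left (hpow s hs' (by linarith)) hΘ)))
        _ = _ := by ring
  have hbd : ∀ a ∈ S, ∀ n, ∀ s ∈ Ioc 0 T, ∀ x, ‖N.picard a n s x‖ ≤ (c + 1) * R * s ^ (-ν) := by
    intro a ha n s hs' x
    have h := (hdiff n a ha 0 hA.zero_mem s hs' x).1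
    rw [picard_zero_fun] at h
    simp only [Pi.zero_apply, sub_zero] at h
    have := Real.rpow_nonneg hs'.1.le (-ν)
    have := hA.dist_zero_le a ha
    exact h.trans (by gcongr)
  choose! U hUr hUm hUl using fun a ha => N.exists_mild_solution (hA.reg a ha) hT0 hT1.le
    (by positivity : 0 ≤ (c + 1) * R) (hμ.trans hμν) (by linarith) (hbd a ha)
  have hsol : ∀ a ∈ S, N.IsSol T (U a) := fun a ha =>
    IsSol.of_mild (hA.reg a ha) (hUr a ha) (hUm a ha)
  have htend : ∀ a ∈ S, ∀ s ∈ Icc 0 T, ∀ x,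
      Tendsto (fun n => N.picard a n s x) atTop (𝓝 (U a s x)) := by
    intro a ha s hs' x
    obtain ⟨C, hC⟩ := hUl a ha 0
    refine tendsto_iff_norm_sub_tendsto_zero.2 (squeeze_zero (fun _ => norm_nonneg _)
      (g := fun n : ℕ => C * (1 / 2 : ℝ) ^ n)
      (fun n => by rw [norm_sub_rev]; exact (hC n s hs').norm_le x) ?_)
    have := (tendsto_pow_atTop_nhds_zero_of_lt_one (r := (1 / 2 : ℝ)) (by norm_num)
      (by norm_num)).const_mul C
    rwa [mul_zero] at this
  refine ⟨T, hT0, hT1, fun a => U a, fun a => hsol a a.2, fun a => ?_, fun a => htend a a.2,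
    fun k ε hε => ?_⟩
  · ext1 x
    refine tendsto_nhds_unique (htend a a.2 0 ⟨le_rfl, hT0.le⟩ x) ?_
    simp_rw [picard_at_zero]
    exact tendsto_const_nhds
  · refine IsSol.bd_sub_of_bd_one (N := N) (T := T) hT1.le (U := fun a : S => U a)
      (θ := fun a b => Θ a b) (fun a => hsol a a.2) (fun _ _ => hA.nonneg _ _)
      (o := ⟨0, hA.zero_mem⟩) (R := R) ?_
      (fun a => by rw [hΘ]; exact hA.dist_zero_le a a.2) ?_ k ε hε
    · intro s hs'
      ext1 x
      refine tendsto_nhds_unique (htend 0 hA.zero_mem s hs' x) ?_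
      simp_rw [picard_zero_fun]
      exact tendsto_const_nhds
    · intro ε hε
      -- For `s ≥ ε` the weights of the function and of its gradient are both at most
      -- `ε^{-(ν+1/2)}`.
      refine ⟨(c + 1) * ε ^ (-(ν + 1 / 2)), fun a₁ a₂ s hs' => ?_⟩
      have hsT : s ∈ Ioc 0 T := ⟨hε.trans_le hs'.1, hs'.2⟩
      have hsT' : s ∈ Icc 0 T := ⟨hsT.1.le, hsT.2⟩
      obtain ⟨A, hA'⟩ := hUl a₁ a₁.2 1
      obtain ⟨B, hB'⟩ := hUl a₂ a₂.2 1
      refine Bd.sub_of_approx ((hUr a₁ a₁.2 1).contDiff s) ((hUr a₂ a₂.2 1).contDiff s)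
        (fun n => (N.reg_picard (hA.reg a₁ a₁.2) n 1).contDiff s)
        (fun n => (N.reg_picard (hA.reg a₂ a₂.2) n 1).contDiff s)
        (fun n => hA' n s hsT') (fun n => hB' n s hsT')
        (C := fun _ => (c + 1) * ε ^ (-(ν + 1 / 2)) * Θ a₁ a₂) (fun n => ?_) tendsto_const_nhds
      have hν0 : 0 ≤ ν := hμ.trans hμν
      have hε2 : s ^ (-(ν + 1 / 2)) ≤ ε ^ (-(ν + 1 / 2)) :=
        Real.rpow_le_rpow_of_nonpos hε hs'.1 (by linarith)
      have hε1 : s ^ (-ν) ≤ ε ^ (-(ν + 1 / 2)) :=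
        (hpow s hsT (by linarith : ν ≤ ν + 1 / 2)).trans hε2
      have hΘ := hA.nonneg a₁ a₂
      refine bd_succ_iff.2 ⟨fun x => ?_, bd_zero_iff.2 fun x => ?_⟩
      · refine (hdiff n a₁ a₁.2 a₂ a₂.2 s hsT x).1.trans ?_
        calc _ ≤ (c + 1) * Θ a₁ a₂ * ε ^ (-(ν + 1 / 2)) := by gcongr
          _ = _ := by ring
      · rw [fderiv_fun_sub ((N.reg_picard (hA.reg a₁ a₁.2) n 1).differentiable s x)
          ((N.reg_picard (hA.reg a₂ a₂.2) n 1).differentiable s x)]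
        refine (hdiff n a₁ a₁.2 a₂ a₂.2 s hsT x).2.trans ?_
        calc _ ≤ (c + 1) * Θ a₁ a₂ * ε ^ (-(ν + 1 / 2)) := by gcongr
          _ = _ := by ring

end Nonlin.Admissible

end Flow

/-! ### Periodicity along the Picard iteration. -/

section Periodic

variable {d : ℕ} {V W : Type u} [NormedAddCommGroup V] [NormedSpace ℝ V]
  [NormedAddCommGroup W] [NormedSpace ℝ W]

theorem IsPeriodic.hs {f : E d → V} (hf : IsPeriodic f) (r : ℝ) : IsPeriodic (hs r f) := by
  intro x n
  unfold YMFlow.hs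
  congr 1; ext z
  rw [add_sub_right_comm, hf]

theorem IsPeriodic.duh {f : ℝ → E d → V} (hf : ∀ s, IsPeriodic (f s)) (t : ℝ) :
    IsPeriodic (duh f t) := by
  intro x n
  unfold YMFlow.duh
  congr 1; ext s
  exact (hf s).hs _ x n

theorem Nonlin.isPeriodic_picard (N : Nonlin d V W) [CompleteSpace V] {a : E d → V}
    (ha : IsPeriodic a) (n : ℕ) (t : ℝ) : IsPeriodic (N.picard a n t) := by
  induction n generalizing t with
  | zero => exact ha.hs t
  | succ n ih =>
    have h : IsPeriodic (YMFlow.duh (fun s => N.app (N.picard a n s)) t) :=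
      IsPeriodic.duh (fun s x m => by simp only [app, quad]; rw [ih s, (ih s).fderiv]) t
    intro x m
    simp only [picard]
    rw [ha.hs t, h]

theorem IsPeriodic.iteratedFDeriv {f : E d → V} (hf : IsPeriodic f) (j : ℕ) :
    IsPeriodic (iteratedFDeriv ℝ j f) := by
  intro x n
  rw [← iteratedFDeriv_comp_add_right]
  congr 1
  ext y
  exact hf y n

end Periodic

/-! ### The Yang–Mills nonlinearity and the metric `Θ`. -/

section YangMills

variable {d : ℕ} {𝔤 : Type u} [NormedLieRing 𝔤] [CompactLieAlgebra 𝔤]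

theorem SmoothOneForm.reg (a : SmoothOneForm d 𝔤) (k : ℕ) : Reg k fun _ => a.toFun := by
  have hc : ∀ n : ℕ, ContDiff ℝ n a.toFun := contDiff_infty.1 a.contDiff'
  refine Reg.of_iteratedFDeriv (fun _ => hc k) fun j _ => ?_
  have hcj : Continuous (iteratedFDeriv ℝ j a.toFun) := (hc j).continuous_iteratedFDeriv le_rfl
  obtain ⟨C, hC⟩ := (a.periodic'.iteratedFDeriv j).bounded hcj
  exact ⟨hcj.comp continuous_snd, fun _ => ⟨C, fun _ _ x => hC x⟩⟩

variable [FiniteDimensional ℝ 𝔤]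

variable (d 𝔤) in
/-- The nonlinearity of the Yang–Mills flow with DeTurck term. -/
def ymNonlin : Nonlin d (Fin d → 𝔤) (Fin d → Fin d → 𝔤) where
  b := LinearMap.toContinuousBilinearMap (LinearMap.mk₂ ℝ
    (fun (u : Fin d → 𝔤) (D : E d →L[ℝ] (Fin d → 𝔤)) i =>
      ∑ j, ⁅u j, (2 : ℝ) • D (EuclideanSpace.single j 1) i - D (EuclideanSpace.single i 1) j⁆)
    (fun u v D => by ext i; simp only [Pi.add_apply, add_lie, Finset.sum_add_distrib])
    (fun c u D => by ext i; simp only [Pi.smul_apply, smul_lie, Finset.smul_sum])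
    (fun u D D' => by
      ext i
      simp only [add_apply, Pi.add_apply, smul_add, ← Finset.sum_add_distrib]
      refine Finset.sum_congr rfl fun j _ => ?_
      rw [← lie_add]; congr 1; abel)
    (fun c u D => by
      ext i
      simp only [smul_apply, Pi.smul_apply, Finset.smul_sum]
      refine Finset.sum_congr rfl fun j _ => ?_
      rw [← lie_smul, smul_sub, smul_comm]))
  c := LinearMap.toContinuousBilinearMap (LinearMap.mk₂ ℝ
    (fun (u : Fin d → 𝔤) (w : Fin d → Fin d → 𝔤) i => ∑ j, ⁅u j, w j i⁆)
    (fun u v D => by ext i; simp [Finset.sum_add_distrib])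
    (fun c u D => by ext i; simp [Finset.smul_sum])
    (fun u v D => by ext i; simp [Finset.sum_add_distrib])
    (fun c u D => by ext i; simp [Finset.smul_sum]))
  q := LinearMap.toContinuousBilinearMap (LinearMap.mk₂ ℝ
    (fun (u v : Fin d → 𝔤) j i => ⁅u j, v i⁆)
    (fun u v D => by ext i j; simp)
    (fun c u D => by ext i j; simp)
    (fun u v D => by ext i j; simp)
    (fun c u D => by ext i j; simp))

theorem ymNonlin_quad (u : E d → Fin d → 𝔤) : (ymNonlin d 𝔤).quad u = quadTerm u := rfl

theorem ymRHS_eq (u : E d → Fin d → 𝔤) (x : E d) :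
    ymRHS u x = lap u x + (ymNonlin d 𝔤).app u x := by
  rw [ymRHS, laplacian_eq_lap, add_assoc]
  rfl

/-- The distance `theta` on arbitrary functions. -/
def thetaFun (p : ThetaExponents) (A B : E d → Fin d → 𝔤) : ℝ≥0∞ :=
  negHolderNorm p.η (A - B) +
    ⨆ t ∈ Ioo (0 : ℝ) 1, ENNReal.ofReal (t ^ p.δ) *
      negHolderNorm p.β (quadTerm (heat t A) - quadTerm (heat t B))

theorem thetaFun_comm (p : ThetaExponents) (A B : E d → Fin d → 𝔤) :
    thetaFun p A B = thetaFun p B A := by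
  unfold thetaFun
  rw [negHolderNorm_sub_comm]
  congr 1
  refine iSup_congr fun t => iSup_congr fun _ => ?_
  rw [negHolderNorm_sub_comm]

theorem le_negHolderNorm {F : Type u} [NormedAddCommGroup F] [NormedSpace ℝ F] (α : ℝ) (f : E d → F)
    {t : ℝ} (ht : t ∈ Ioo (0 : ℝ) 1) (x : E d) :
    ENNReal.ofReal (t ^ (-α / 2)) * ‖heat t f x‖ₑ ≤ negHolderNorm α f :=
  le_iSup₂_of_le (f := fun t (_ : t ∈ Ioo (0 : ℝ) 1) => ⨆ x,
    ENNReal.ofReal (t ^ (-α / 2)) * ‖heat t f x‖ₑ) t ht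
    (le_iSup (fun x => ENNReal.ofReal (t ^ (-α / 2)) * ‖heat t f x‖ₑ) x)

theorem norm_le_of_rpow_mul_enorm_le {F : Type u} [NormedAddCommGroup F] {v : F} {t y : ℝ}
    {C : ℝ≥0∞} (ht : 0 < t) (hC : C ≠ ⊤) (h : ENNReal.ofReal (t ^ y) * ‖v‖ₑ ≤ C) :
    ‖v‖ ≤ C.toReal * t ^ (-y) := by
  have h1 := ENNReal.toReal_mono hC h
  rw [ENNReal.toReal_mul, ENNReal.toReal_ofReal (Real.rpow_nonneg ht.le _), toReal_enorm] at h1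
  rw [Real.rpow_neg ht.le, ← div_eq_mul_inv, le_div_iff₀ (Real.rpow_pos_of_pos ht _), mul_comm]
  exact h1

theorem norm_hs_sub_le_theta (p : ThetaExponents) (a b : SmoothOneForm d 𝔤) {s : ℝ}
    (hs' : s ∈ Ioo (0 : ℝ) 1) (x : E d) :
    ‖hs s a.toFun x - hs s b.toFun x‖ ≤ (theta p a b).toReal * s ^ (p.η / 2) := by
  obtain ⟨C, hC⟩ := a.bounded
  obtain ⟨D, hD⟩ := b.bounded
  rw [hs_eq_heat hs'.1, hs_eq_heat hs'.1, ← heat_sub hs'.1 a.continuous b.continuous hC hD,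
    show p.η / 2 = -(-p.η / 2) by ring]
  exact norm_le_of_rpow_mul_enorm_le hs'.1 (theta_ne_top p a b)
    ((le_negHolderNorm _ _ hs' x).trans le_self_add)

theorem norm_hs_quad_sub_le_theta (p : ThetaExponents) (a b : SmoothOneForm d 𝔤) {s r : ℝ}
    (hs' : s ∈ Ioo (0 : ℝ) 1) (hr : r ∈ Ioo (0 : ℝ) 1) (x : E d) :
    ‖hs r (fun y => (ymNonlin d 𝔤).quad (hs s a.toFun) y - (ymNonlin d 𝔤).quad (hs s b.toFun) y) x‖
      ≤ (theta p a b).toReal * (s ^ (-p.δ) * r ^ (p.β / 2)) := by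
  have e : ∀ a : SmoothOneForm d 𝔤, hs s a.toFun = heat s a.toFun := fun a =>
    funext fun y => hs_eq_heat hs'.1 _ y
  rw [hs_eq_heat hr.1, e, e, ymNonlin_quad, ymNonlin_quad]
  have h1 : ENNReal.ofReal (s ^ p.δ) * (ENNReal.ofReal (r ^ (-p.β / 2)) *
      ‖heat r (quadTerm (heat s a.toFun) - quadTerm (heat s b.toFun)) x‖ₑ) ≤ theta p a b :=
    (mul_le_mul_right (le_negHolderNorm _ _ hr x) _).trans
      ((le_iSup₂_of_le (f := fun t (_ : t ∈ Ioo (0 : ℝ) 1) => ENNReal.ofReal (t ^ p.δ) *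
        negHolderNorm p.β (quadTerm (heat t a.toFun) - quadTerm (heat t b.toFun))) s hs' le_rfl).trans
        le_add_self)
  have h2 := ENNReal.toReal_mono (theta_ne_top p a b) h1
  rw [ENNReal.toReal_mul, ENNReal.toReal_mul, ENNReal.toReal_ofReal (Real.rpow_nonneg hs'.1.le _),
    ENNReal.toReal_ofReal (Real.rpow_nonneg hr.1.le _), toReal_enorm, ← mul_assoc] at h2
  rw [Real.rpow_neg hs'.1.le, show p.β / 2 = -(-p.β / 2) by ring, Real.rpow_neg hr.1.le,
    ← mul_inv, ← div_eq_mul_inv, le_div_iff₀ (mul_pos (Real.rpow_pos_of_pos hs'.1 _)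
      (Real.rpow_pos_of_pos hr.1 _)), mul_comm]
  exact h2

/-- Local existence, uniformly on `Θ`-balls of smooth initial data, with Lipschitz dependence. -/
theorem exists_ym_flow (p : ThetaExponents) (hη : -2 / 3 < p.η)
    (hp : p.β * (2 * p.η + 1) < (1 + p.η) * (1 - 2 * p.η - 2 * p.δ)) {R : ℝ} (hR : 0 < R) :
    ∃ T, 0 < T ∧ T < 1 ∧
      ∃ U : {a : SmoothOneForm d 𝔤 // (theta p a 0).toReal < R} → ℝ → E d → Fin d → 𝔤,
        (∀ a, (ymNonlin d 𝔤).IsSol T (U a)) ∧ (∀ a, U a 0 = a.1.toFun) ∧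
        (∀ a, ∀ s ∈ Icc 0 T, IsPeriodic (U a s)) ∧
        ∀ k, ∀ ε > 0, ∃ C, ∀ a₁ a₂, ∀ s ∈ Icc ε T,
          Bd (k + 1) (fun x => U a₁ s x - U a₂ s x) (C * (theta p a₁.1 a₂.1).toReal) := by
  obtain ⟨θ, hθ0, hθ1, hθβ, hδ⟩ := exists_interpolation_exponent p.η_lt p.β_lt p.δ_lt hp
  -- The abstract theory works with plain functions; on smooth forms `thetaFun` is `theta` by
  -- definition.
  let S : Set (E d → Fin d → 𝔤) := {f | ∃ a : SmoothOneForm d 𝔤, (theta p a 0).toReal < R ∧ a.toFun = f}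
  obtain ⟨c, hc, hA⟩ := Nonlin.exists_admissible (N := ymNonlin d 𝔤) (S := S) (R := R)
    (Θ := fun f g => (thetaFun p f g).toReal) (η := p.η) (β := p.β) (δ := p.δ)
    (by rintro _ ⟨a, _, rfl⟩ k; exact a.reg k)
    ⟨0, by rw [theta_self]; simpa using hR, rfl⟩ (fun _ _ => ENNReal.toReal_nonneg)
    (by rintro _ ⟨a, ha, rfl⟩; exact ha.le) hθ0 hθ1
    (by rintro _ ⟨a, _, rfl⟩ _ ⟨b, _, rfl⟩ s hs' x; exact norm_hs_sub_le_theta p a b hs' x)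
    (by rintro _ ⟨a, _, rfl⟩ _ ⟨b, _, rfl⟩ s hs' r hr x
        exact norm_hs_quad_sub_le_theta p a b hs' hr x)
  have hη1 := p.η_lt
  have hθβ0 : 0 ≤ -(θ * p.β) := by nlinarith [p.β_lt]
  -- With `μ = b` the condition `b + δ' - 1 < μ` is `δ' < 1`, while `ν + μ < 1/2` is `-θβ < 1 + η`.
  -- The latter also gives `μ ≤ ν` and `b < 1/2`, since `η < -1/2`.
  obtain ⟨T, hT0, hT1, U, hU, hU0, hlim, hLip⟩ := hA.exists_flow
    (fun _ _ => by rw [thetaFun_comm]) hc (μ := -(θ * p.β) / 2) (by linarith) (by linarith)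
    (by linarith) (by linarith) (by linarith) hδ (by linarith)
  refine ⟨T, hT0, hT1, fun a => U ⟨a.1.toFun, a.1, a.2, rfl⟩, fun a => hU _, fun a => hU0 _,
    fun a s hs' x n => ?_, fun k ε hε => ?_⟩
  · refine tendsto_nhds_unique (hlim _ s hs' _) ?_
    simp_rw [(ymNonlin d 𝔤).isPeriodic_picard a.1.periodic' _ s x n]
    exact hlim ⟨a.1.toFun, a.1, a.2, rfl⟩ s hs' x
  · obtain ⟨C, hC⟩ := hLip k ε hε
    exact ⟨C, fun a₁ a₂ => hC _ _⟩

end YangMills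

/-! ### The `C^∞` topology on periodic forms. -/

section Topology

variable {d : ℕ} {F : Type u} [NormedAddCommGroup F]

/-- Lets periodic functions inherit uniform bounds and uniform convergence from a compact set. -/
theorem exists_compact_fundamental_domain (d : ℕ) : ∃ K : Set (E d), IsCompact K ∧
    ∀ x, ∃ n : Fin d → ℤ, x + WithLp.toLp 2 (fun i => (n i : ℝ)) ∈ K := by
  refine ⟨(WithLp.toLp 2) '' (Set.pi univ fun _ : Fin d => Icc (0 : ℝ) 1),
    (isCompact_univ_pi fun _ => isCompact_Icc).image (PiLp.continuous_toLp 2 _), fun x =>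
    ⟨fun i => -⌊x i⌋, fun i => Int.fract (x i), fun i _ =>
      ⟨Int.fract_nonneg _, (Int.fract_lt_one _).le⟩, ?_⟩⟩
  ext i
  simp [Int.fract, sub_eq_add_neg]

theorem Tame.of_isPeriodic {f : ℝ → E d → F} (hc : Continuous fun p : ℝ × E d => f p.1 p.2)
    (hp : ∀ s, IsPeriodic (f s)) : Tame f := by
  refine ⟨hc, fun T => ?_⟩
  obtain ⟨K, hK, hK'⟩ := exists_compact_fundamental_domain d
  obtain ⟨C, hC⟩ := ((isCompact_Icc (a := -T) (b := T)).prod hK).exists_bound_of_continuousOn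
    hc.continuousOn
  refine ⟨C, fun s hs' x => ?_⟩
  obtain ⟨n, hn⟩ := hK' x
  rw [← hp s x n]
  exact hC (s, _) ⟨abs_le.1 hs', hn⟩

theorem tendstoUniformly_of_isPeriodic {f : ℝ → E d → F}
    (hc : Continuous fun p : ℝ × E d => f p.1 p.2) (hp : ∀ s, IsPeriodic (f s)) (s : ℝ) :
    TendstoUniformly f (f s) (𝓝 s) := by
  intro v hv
  obtain ⟨K, hK, hK'⟩ := exists_compact_fundamental_domain d
  obtain ⟨w, hw, hw'⟩ := hK.mem_uniformity_of_prod (f := f) (s := univ) hc.continuousOn (mem_univ s)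
    (symm_le_uniformity hv)
  rw [nhdsWithin_univ] at hw
  filter_upwards [hw] with r hr x
  obtain ⟨n, hn⟩ := hK' x
  rw [← hp s x n, ← hp r x n]
  exact hw' r hr _ hn

theorem continuous_uncurry_of_tendstoUniformly {f : ℝ → E d → F} (hc : ∀ s, Continuous (f s))
    (h : ∀ s, TendstoUniformly f (f s) (𝓝 s)) : Continuous fun p : ℝ × E d => f p.1 p.2 := by
  refine continuous_iff_continuousAt.2 fun p => ?_
  have h1 : TendstoUniformly (fun q : ℝ × E d => f q.1) (f p.1) (𝓝 p) := fun v hv =>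
    continuous_fst.continuousAt.eventually (h p.1 v hv)
  exact h1.tendsto_comp (hc p.1).continuousAt continuous_snd.continuousAt

variable [NormedSpace ℝ F]

theorem SmoothOneForm.continuous_iff {X : Type*} [TopologicalSpace X] {A : X → SmoothOneForm d F} :
    Continuous A ↔ ∀ j x, TendstoUniformly (fun y => iteratedFDeriv ℝ j (A y).toFun)
      (iteratedFDeriv ℝ j (A x).toFun) (𝓝 x) := by
  rw [continuous_induced_rng, continuous_pi_iff]
  refine forall_congr' fun j => ?_
  rw [continuous_iff_continuousAt]
  refine forall_congr' fun x => ?_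
  rw [ContinuousAt, UniformFun.tendsto_iff_tendstoUniformly]
  rfl

theorem SmoothOneForm.continuous_of_reg {A : ℝ → SmoothOneForm d F}
    (h : ∀ k, Reg k fun s => (A s).toFun) : Continuous A :=
  SmoothOneForm.continuous_iff.2 fun j s => tendstoUniformly_of_isPeriodic
    (f := fun s => iteratedFDeriv ℝ j (A s).toFun) (h j).tame_iteratedFDeriv.cont
    (fun r => (A r).periodic'.iteratedFDeriv j) s

/-- Needed for uniqueness among all classical solutions, which are only assumed continuous in `C^∞`:
uniform convergence of each derivative gives joint continuity, and periodicity gives boundedness. -/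
theorem SmoothOneForm.reg_of_continuous {A : ℝ → SmoothOneForm d F} (h : Continuous A) (k : ℕ) :
    Reg k fun s => (A s).toFun := by
  have hc : ∀ s (n : ℕ), ContDiff ℝ n (A s).toFun := fun s => contDiff_infty.1 (A s).contDiff'
  exact Reg.of_iteratedFDeriv (fun s => hc s k) fun j _ => Tame.of_isPeriodic
    (continuous_uncurry_of_tendstoUniformly (fun s => (hc s j).continuous_iteratedFDeriv le_rfl)
      (SmoothOneForm.continuous_iff.1 h j)) fun s => (A s).periodic'.iteratedFDeriv j

theorem SmoothOneForm.ckEDist_le {A B : SmoothOneForm d F} {k : ℕ} {C : ℝ}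
    (h : Bd k (fun x => A.toFun x - B.toFun x) C) : A.ckEDist k B ≤ ENNReal.ofReal C := by
  refine iSup₂_le fun j hj => iSup_le fun x => ?_
  rw [← ofReal_norm]
  exact ENNReal.ofReal_le_ofReal (h j hj x)

theorem SmoothOneForm.continuous_of_bd {X : Type*} [PseudoMetricSpace X] {A : X → SmoothOneForm d F}
    (h : ∀ k, ∃ C : ℝ, ∀ x y, Bd k (fun z => (A x).toFun z - (A y).toFun z) (C * dist x y)) :
    Continuous A := by
  refine SmoothOneForm.continuous_iff.2 fun j x => Metric.tendstoUniformly_iff.2 fun ε hε => ?_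
  obtain ⟨C, hC⟩ := h j
  have h0 : Tendsto (fun y => C * dist x y) (𝓝 x) (𝓝 0) := by
    have : Continuous fun y => C * dist x y := by fun_prop
    simpa using this.tendsto x
  filter_upwards [h0.eventually_lt_const hε] with y hy z
  have hc : ∀ x, ContDiff ℝ j (A x).toFun := fun x => contDiff_infty.1 (A x).contDiff' j
  rw [dist_eq_norm, ← iteratedFDeriv_sub_apply (hc x).contDiffAt (hc y).contDiffAt]
  exact (hC x y j le_rfl z).trans_lt hy

end Topology

/-! ### Extension of Lipschitz maps to the completion. -/

section Extension

variable {d : ℕ} {F : Type u} [NormedAddCommGroup F] [NormedSpace ℝ F] [CompleteSpace F]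

/-- Limits of `C^k`-Lipschitz maps into smooth forms, along a sequence in the domain converging in a
larger space. -/
theorem exists_smoothOneForm_limit {ι X : Type*} [PseudoMetricSpace X]
    {e : ι → X} {f : ι → SmoothOneForm d F} {C : ℕ → ℝ}
    (h : ∀ k i j, Bd k (fun x => (f i).toFun x - (f j).toFun x) (C k * dist (e i) (e j)))
    {x : X} (hx : ∀ ε > 0, ∃ i, dist x (e i) < ε) :
    ∃ g : SmoothOneForm d F, ∀ k i, Bd k (fun z => g.toFun z - (f i).toFun z)
      (C k * dist x (e i)) := by
  -- Approximation at rate `2^{-n}` makes consecutive images geometrically close in every `C^k`, so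
  -- `exists_reg_limit` applies to paths constant in time.
  choose i hi using fun n : ℕ => hx ((1 / 2) ^ n) (by positivity)
  have hlim : Tendsto (fun n => dist x (e (i n))) atTop (𝓝 0) :=
    squeeze_zero (fun _ => dist_nonneg) (fun n => (hi n).le)
      (tendsto_pow_atTop_nhds_zero_of_lt_one (by norm_num) (by norm_num))
  have hreg : ∀ j k, Reg k fun _ : ℝ => (f j).toFun := fun j k =>
    SmoothOneForm.reg_of_continuous continuous_const k
  obtain ⟨u, hu, hul⟩ := exists_reg_limit (A := fun n _ => (f (i n)).toFun) (fun n => hreg (i n))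
    fun k => ⟨|C k| * 2, fun n _ => (h k (i (n + 1)) (i n)).mono (by
      have h1 := hi n
      have h2 := hi (n + 1)
      have h3 := dist_triangle_left (e (i (n + 1))) (e (i n)) x
      rw [pow_succ] at h2
      have h4 : (0 : ℝ) < (1 / 2) ^ n := by positivity
      calc _ ≤ |C k| * (2 * (1 / 2) ^ n) :=
            mul_le_mul (le_abs_self _) (by linarith) dist_nonneg (abs_nonneg _)
        _ = _ := by ring)⟩
  have hpt : ∀ z, Tendsto (fun n => (f (i n)).toFun z) atTop (𝓝 (u 0 z)) := by
    intro z
    obtain ⟨D, hD⟩ := hul 0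
    refine tendsto_iff_norm_sub_tendsto_zero.2 (squeeze_zero (fun _ => norm_nonneg _)
      (g := fun n : ℕ => D * (1 / 2 : ℝ) ^ n)
      (fun n => by rw [norm_sub_rev]; exact (hD n 0).norm_le z) ?_)
    have := (tendsto_pow_atTop_nhds_zero_of_lt_one (r := (1 / 2 : ℝ)) (by norm_num)
      (by norm_num)).const_mul D
    rwa [mul_zero] at this
  refine ⟨⟨u 0, contDiff_infty.2 fun k => (hu k).contDiff 0, fun z m => ?_⟩, fun k j => ?_⟩
  · refine tendsto_nhds_unique (hpt _) ?_
    simp_rw [(f _).periodic' z m]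
    exact hpt z
  · obtain ⟨D, hD⟩ := hul k
    have hlim' : Tendsto (fun n => C k * dist (e (i n)) (e j)) atTop (𝓝 (C k * dist x (e j))) := by
      have : Tendsto (fun n => e (i n)) atTop (𝓝 x) :=
        tendsto_iff_dist_tendsto_zero.2 (by simpa [dist_comm] using hlim)
      exact (this.dist tendsto_const_nhds).const_mul _
    refine Bd.sub_of_approx (φ := fun n => (f (i n)).toFun) (γ := fun _ => (f j).toFun) (B := 0)
      ((hu k).contDiff 0) ((hreg j k).contDiff 0) (fun n => (hreg (i n) k).contDiff 0)
      (fun _ => (hreg j k).contDiff 0) (fun n => hD n 0) (fun n => ?_) (fun n => h k (i n) j) hlim'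
    intro l _ z
    have : iteratedFDeriv ℝ l (fun _ : E d => (0 : Fin d → F)) = 0 := iteratedFDeriv_fun_zero
    simp [this]

/-- Extension by density of `C^k`-Lipschitz maps into smooth forms. -/
theorem exists_smoothOneForm_extension {ι X : Type*} [PseudoMetricSpace X]
    {e : ι → X} {f : ι → SmoothOneForm d F}
    (h : ∀ k, ∃ C : ℝ, ∀ i j,
      Bd k (fun x => (f i).toFun x - (f j).toFun x) (C * dist (e i) (e j)))
    (he : DenseRange e) :
    ∃ G : X → SmoothOneForm d F, (∀ i, G (e i) = f i) ∧
      ∀ k, ∃ C : ℝ, ∀ x y, Bd k (fun z => (G x).toFun z - (G y).toFun z) (C * dist x y) := by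
  choose C hC using h
  choose G hG using fun x => exists_smoothOneForm_limit hC (x := x) fun ε hε => he.exists_dist_lt x hε
  refine ⟨G, fun i => ?_, fun k => ⟨C k, fun x y => ?_⟩⟩
  · ext1
    ext1 z
    have := (hG (e i) 0 i).norm_le z
    rw [dist_self, mul_zero, norm_le_zero_iff, sub_eq_zero] at this
    exact this
  -- Both values are compared with the images of one sequence tending to `x`, so the bounds add up
  -- to `C k * dist x y` in the limit and the constant is not enlarged.
  · choose i hi using fun n : ℕ => he.exists_dist_lt x (ε := (1 / 2) ^ n) (by positivity)
    have hlim : Tendsto (fun n => e (i n)) atTop (𝓝 x) := by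
      refine tendsto_iff_dist_tendsto_zero.2 (squeeze_zero (fun _ => dist_nonneg)
        (fun n => by rw [dist_comm]; exact (hi n).le)
        (tendsto_pow_atTop_nhds_zero_of_lt_one (by norm_num) (by norm_num)))
    have hc : ∀ A : SmoothOneForm d F, ContDiff ℝ k A.toFun := fun A => contDiff_infty.1 A.contDiff' k
    have key : ∀ n, Bd k (fun z => (G x).toFun z - (G y).toFun z)
        (C k * dist x (e (i n)) + C k * dist y (e (i n))) := by
      intro n
      have := (hG x k (i n)).add ((hc _).sub (hc _)) ((hc _).sub (hc _)) (hG y k (i n)).sub_comm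
      simpa using this
    intro j hj z
    refine ge_of_tendsto' (x := atTop) (f := fun n => C k * dist x (e (i n)) + C k * dist y (e (i n)))
      ?_ fun n => key n j hj z
    have := ((tendsto_const_nhds (x := x)).dist hlim).const_mul (C k) |>.add
      (((tendsto_const_nhds (x := y)).dist hlim).const_mul (C k))
    rwa [dist_self, mul_zero, zero_add, dist_comm y x] at this

end Extension

/-! ### Translation between abstract solutions and the Yang–Mills flow. -/

section Main

variable {d : ℕ} {𝔤 : Type u} [NormedLieRing 𝔤] [CompactLieAlgebra 𝔤] [FiniteDimensional ℝ 𝔤]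

theorem dist_ofSmooth (p : ThetaExponents) (a b : SmoothOneForm d 𝔤) :
    dist (ofSmooth p a) (ofSmooth p b) = (theta p a b).toReal :=
  UniformSpace.Completion.dist_eq _ _

/-- Truncation of time to `[0, t]`. -/
def clamp (t s : ℝ) : ℝ := max 0 (min s t)

theorem continuous_clamp (t : ℝ) : Continuous (clamp t) := by unfold clamp; fun_prop

theorem clamp_mem {t : ℝ} (ht : 0 ≤ t) (s : ℝ) : clamp t s ∈ Icc 0 t :=
  ⟨le_max_left _ _, max_le ht (min_le_right _ _)⟩

theorem clamp_of_mem {t s : ℝ} (hs' : s ∈ Icc 0 t) : clamp t s = s := by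
  rw [clamp, min_eq_left hs'.2, max_eq_right hs'.1]

/-- Time is clamped because a form is required at every real time, whereas periodicity is known on
`[0, t]` only. -/
theorem Nonlin.IsSol.isYMFlow {t : ℝ} (ht : 0 ≤ t) {u : ℝ → E d → Fin d → 𝔤}
    (hu : (ymNonlin d 𝔤).IsSol t u) (hp : ∀ s ∈ Icc 0 t, IsPeriodic (u s)) {a : SmoothOneForm d 𝔤}
    (h0 : u 0 = a.toFun) :
    IsYMFlow t a fun s => ⟨u (clamp t s),
      contDiff_infty.2 fun k => (hu.reg k).contDiff _, hp _ (clamp_mem ht s)⟩ where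
  continuousOn := (SmoothOneForm.continuous_of_reg fun k =>
    (hu.reg k).comp_time (continuous_clamp t)).continuousOn
  initial := by
    ext1
    simpa [clamp_of_mem (left_mem_Icc.2 ht)] using h0
  eqn s hs' x := by
    simp only [clamp_of_mem hs']
    rw [ymRHS_eq]
    exact (hu.eqn s hs' x).congr_of_mem (fun r hr => by rw [clamp_of_mem hr]) hs'

/-- An arbitrary flow is constrained on `[0, t]` only; clamping discards its values elsewhere, which
need not be regular in time. -/
theorem IsYMFlow.isSol {t : ℝ} (ht : 0 ≤ t) {a : SmoothOneForm d 𝔤} {A : ℝ → SmoothOneForm d 𝔤}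
    (hA : IsYMFlow t a A) : (ymNonlin d 𝔤).IsSol t fun s => (A (clamp t s)).toFun where
  reg := SmoothOneForm.reg_of_continuous (A := fun s => A (clamp t s))
    (hA.continuousOn.comp_continuous (continuous_clamp t) (clamp_mem ht))
  eqn s hs' x := by
    rw [← ymRHS_eq]
    simp only [clamp_of_mem hs']
    exact (hA.eqn s hs' x).congr_of_mem (fun r hr => by rw [clamp_of_mem hr]) hs'

end Main

end YMFlow

end

theorem mainTheorem7 {𝔤 : Type*} [YMFlow.NormedLieRing 𝔤] [YMFlow.CompactLieAlgebra 𝔤]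
    [FiniteDimensional ℝ 𝔤] (p : YMFlow.ThetaExponents) (hη : -2 / 3 < p.η)
    (hp : p.β * (2 * p.η + 1) < (1 + p.η) * (1 - 2 * p.η - 2 * p.δ)) (R : ℝ) (hR : 0 < R) :
    ∃ T : ℝ, 0 < T ∧ ∀ t ∈ Set.Ioo 0 T,
      ∃ F : Metric.ball (YMFlow.ofSmooth p (0 : YMFlow.SmoothOneForm 3 𝔤)) R →
          YMFlow.SmoothOneForm 3 𝔤,
        Continuous F ∧
        (∀ k : ℕ, ∃ L : ℝ≥0, ∀ X Y, (F X).ckEDist k (F Y) ≤ L * edist X Y) ∧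
        ∀ (a : YMFlow.SmoothOneForm 3 𝔤)
          (ha : YMFlow.ofSmooth p a ∈ Metric.ball (YMFlow.ofSmooth p 0) R),
          (∃ A, YMFlow.IsYMFlow t a A) ∧
            ∀ A, YMFlow.IsYMFlow t a A → F ⟨YMFlow.ofSmooth p a, ha⟩ = A t := by
  obtain ⟨T, hT0, hT1, U, hU, hU0, hUp, hUL⟩ := YMFlow.exists_ym_flow (d := 3) (𝔤 := 𝔤) p hη hp hR
  refine ⟨T, hT0, fun t ht => ?_⟩
  have htT : t ∈ Icc 0 T := ⟨ht.1.le, ht.2.le⟩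
  have hmem : ∀ a : YMFlow.SmoothOneForm 3 𝔤,
      YMFlow.ofSmooth p a ∈ Metric.ball (YMFlow.ofSmooth p 0) R ↔
        (YMFlow.theta p a 0).toReal < R := fun a => by
    rw [Metric.mem_ball, YMFlow.dist_ofSmooth]
  let e : {a : YMFlow.SmoothOneForm 3 𝔤 // (YMFlow.theta p a 0).toReal < R} →
      Metric.ball (YMFlow.ofSmooth p (0 : YMFlow.SmoothOneForm 3 𝔤)) R :=
    fun a => ⟨YMFlow.ofSmooth p a.1, (hmem a.1).2 a.2⟩
  have he : DenseRange e := by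
    refine Metric.denseRange_iff.2 fun X ε hε => ?_
    -- The ball is open: an approximation closer than `R - dist X 0` stays inside it.
    obtain ⟨a, ha⟩ := UniformSpace.Completion.denseRange_coe.exists_dist_lt X.1
      (lt_min hε (sub_pos.2 (Metric.mem_ball.1 X.2)))
    have h1 : dist X.1 (YMFlow.ofSmooth p a.form) < ε := ha.trans_le (min_le_left _ _)
    have h2 : dist X.1 (YMFlow.ofSmooth p a.form) < R - dist X.1 (YMFlow.ofSmooth p 0) :=
      ha.trans_le (min_le_right _ _)
    refine ⟨⟨a.form, (hmem _).1 (Metric.mem_ball.2 ?_)⟩, h1⟩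
    linarith [dist_triangle_left (YMFlow.ofSmooth p a.form) (YMFlow.ofSmooth p 0) X.1]
  obtain ⟨G, hG, hGL⟩ := YMFlow.exists_smoothOneForm_extension (e := e)
    (f := fun a => ⟨U a t, contDiff_infty.2 fun k => ((hU a).reg k).contDiff t, hUp a t htT⟩)
    (fun k => by
      obtain ⟨C, hC⟩ := hUL k t ht.1
      refine ⟨C, fun a b => ?_⟩
      have h : dist (e a) (e b) = (YMFlow.theta p a.1 b.1).toReal := YMFlow.dist_ofSmooth p a.1 b.1
      rw [h]
      exact (hC a b t ⟨le_rfl, ht.2.le⟩).of_le (Nat.le_succ k)) he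
  refine ⟨G, YMFlow.SmoothOneForm.continuous_of_bd hGL, fun k => ?_, fun a ha => ⟨?_, fun A hA => ?_⟩⟩
  · obtain ⟨C, hC⟩ := hGL k
    refine ⟨C.toNNReal, fun X Y => ?_⟩
    refine (YMFlow.SmoothOneForm.ckEDist_le ((hC X Y).mono
      (mul_le_mul_of_nonneg_right (le_max_left C 0) dist_nonneg))).trans (le_of_eq ?_)
    rw [ENNReal.ofReal_mul (le_max_right _ _), edist_dist, ENNReal.ofReal_max]
    simp [ENNReal.ofReal]
  · exact ⟨_, ((hU ⟨a, (hmem a).1 ha⟩).mono ht.2.le).isYMFlow ht.1.le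
      (fun s hs' => hUp _ s ⟨hs'.1, hs'.2.trans ht.2.le⟩) (hU0 _)⟩
  · have h1 := hG ⟨a, (hmem a).1 ha⟩
    -- Uniqueness identifies any flow started from `a` with the constructed one, so the extension
    -- takes the value `A t` whichever `A` is chosen.
    have h2 := ((hU ⟨a, (hmem a).1 ha⟩).mono ht.2.le).unique (ht.2.le.trans hT1.le)
      (hA.isSol ht.1.le) (by
        rw [hU0, YMFlow.clamp_of_mem (Set.left_mem_Icc.2 ht.1.le), hA.initial])
      (Set.right_mem_Icc.2 ht.1.le)
    rw [YMFlow.clamp_of_mem (Set.right_mem_Icc.2 ht.1.le)] at h2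
    exact h1.trans (YMFlow.SmoothOneForm.ext h2)
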